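/- Let $X$ be a Gromov hyperbolic space, i.e. a geodesic metric space in which, for some $\delta$, every side of every geodesic triangle lies in the $\delta$-neighbourhood of the union of the other two sides. Let $G$ be a group acting on $X$ by isometries. An element $g\in G$ is loxodromic if its translation length $\lim_{n\to\infty} d(g^n y,y)/n$ is positive. For $K\ge 0$ and $y,z\in X$ put $$\mathrm{Stab}_K(y,z)=\{g\in G : d(y,gy)\le K \text{ and } d(z,gz)\le K\}.$$ An element $h\in G$ is WPD if it is loxodromic and for all $K\ge 0$ and $y\in X$ there is an integer $M>0$ such that $\mathrm{Stab}_K(y,h^My)$ is finite. Let $\mu$ be a probability measure on $G$ with countable support, and let $\Gamma_\mu$ be the semigroup generated by the support of $\mu$. Suppose that $\mu$ is - non-elementary: $\Gamma_\mu$ contains two loxodromic elements with disjoint fixed point sets on the Gromov boundary $\partial X$ (the set of quasigeodesic rays up to finite Hausdorff distance); - bounded: for some $y\in X$ the set $\{gy : g\in\mathrm{supp}\,\mu\}$ is bounded; - WPD: $\Gamma_\mu$ contains an element that is WPD in $G$. Let $w_n=g_1\cdots g_n$, where $g_1,g_2,\dots$ are independent with distribution $\mu$, and let $x\in X$. For $K_1\ge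 0$, a $(1,K_1)$-quasi-axis of $g\in G$ is the image of a map $\gamma:\mathbb R\to X$ with $\bigl|d(\gamma(s),\gamma(t))-|s-t|\bigr|\le K_1$ for all $s,t$, such that this image is invariant under $g$. Then for all $K\ge 0$ and $K_1\ge 0$ there are constants $N>0$, $B>0$ and $0<c<1$ such that for all $n\ge 0$ $$\mathbb P\bigl(|\mathrm{Stab}_K(x,w_nx)|\le N\bigr)\ \ge\ 1-Bc^{\sqrt n},$$ and, with probability at least $1-Bc^{\sqrt n}$, the element $w_n$ is loxodromic and $$|\mathrm{Stab}_K(p,w_np)|\le N$$ for every $(1,K_1)$-quasi-axis $\alpha$ of $w_n$ and every point $p$ of $\alpha$ at minimal distance from $x$. -/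

import Mathlib

open Filter Topology MeasureTheory
open scoped NNReal

namespace HypWalk

section Hyperbolic

variable {X : Type*} [MetricSpace X]

/-- `s` is (the image of) a geodesic segment from `x` to `y`. -/
def IsGeodesicSegment (s : Set X) (x y : X) : Prop :=
  ∃ γ : ℝ → X, γ 0 = x ∧ γ (dist x y) = y ∧
    (∀ a ∈ Set.Icc 0 (dist x y), ∀ b ∈ Set.Icc 0 (dist x y), dist (γ a) (γ b) = |a - b|) ∧
    s = γ '' Set.Icc 0 (dist x y)

variable (X) in
/-- A geodesic metric space in which every geodesic triangle is `δ`-thin: each side lies in the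
`δ`-neighbourhood of the union of the other two. -/
structure IsHyperbolicWith (δ : ℝ) : Prop where
  geodesic : ∀ x y : X, ∃ s : Set X, IsGeodesicSegment s x y
  thin : ∀ (x y z : X) (s t u : Set X),
    IsGeodesicSegment s x y → IsGeodesicSegment t y z → IsGeodesicSegment u z x →
      ∀ p ∈ s, ∃ q ∈ t ∪ u, dist p q ≤ δ

variable (X) in
/-- Gromov hyperbolic spaces. -/
def IsGromovHyperbolic : Prop := ∃ δ : ℝ, IsHyperbolicWith X δ

/-- `γ`, parametrized by an interval `I ⊆ ℝ`, is a `(Q, C)`-quasigeodesic. -/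
def IsQuasigeodesicOn (Q C : ℝ) (I : Set ℝ) (γ : ℝ → X) : Prop :=
  ∀ s ∈ I, ∀ t ∈ I,
    Q⁻¹ * |s - t| - C ≤ dist (γ s) (γ t) ∧ dist (γ s) (γ t) ≤ Q * |s - t| + C

variable (X) in
/-- Quasigeodesic rays `[0, ∞) → X` (with arbitrary constants). -/
def QuasigeodesicRay : Type _ :=
  {γ : ℝ≥0 → X // ∃ Q C : ℝ, 1 ≤ Q ∧ 0 ≤ C ∧
    IsQuasigeodesicOn Q C (Set.Ici 0) (fun t : ℝ => γ t.toNNReal)}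

/-- Two rays are asymptotic if their images are at finite Hausdorff distance. -/
def Asymptotic (γ η : QuasigeodesicRay X) : Prop :=
  ∃ C : ℝ, (∀ s, ∃ t, dist (γ.1 s) (η.1 t) ≤ C) ∧ (∀ t, ∃ s, dist (γ.1 s) (η.1 t) ≤ C)

variable (X) in
/-- The setoid of asymptotic quasigeodesic rays. -/
def asymptoticSetoid : Setoid (QuasigeodesicRay X) where
  r := Asymptotic
  iseqv :=
    { refl := fun γ => ⟨0, fun s => ⟨s, by simp⟩, fun s => ⟨s, by simp⟩⟩
      symm := by
        rintro γ η ⟨C, h₁, h₂⟩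
        refine ⟨C, fun s => ?_, fun s => ?_⟩
        · obtain ⟨t, ht⟩ := h₂ s
          exact ⟨t, by rwa [dist_comm]⟩
        · obtain ⟨t, ht⟩ := h₁ s
          exact ⟨t, by rwa [dist_comm]⟩
      trans := by
        rintro γ η ζ ⟨C, h₁, h₂⟩ ⟨D, k₁, k₂⟩
        refine ⟨C + D, fun s => ?_, fun s => ?_⟩
        · obtain ⟨t, ht⟩ := h₁ s
          obtain ⟨u, hu⟩ := k₁ t
          exact ⟨u, (dist_triangle _ _ _).trans (add_le_add ht hu)⟩
        · obtain ⟨t, ht⟩ := k₂ s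
          obtain ⟨u, hu⟩ := h₂ t
          exact ⟨u, (dist_triangle _ _ _).trans (add_le_add hu ht)⟩ }

variable (X) in
/-- The Gromov boundary `∂X`: asymptote classes of quasigeodesic rays. -/
def GromovBoundary : Type _ := Quotient (asymptoticSetoid X)

end Hyperbolic

section Action

variable {G : Type*} [Group G] {X : Type*} [MetricSpace X] [MulAction G X] [IsIsometricSMul G X]

/-- The translate of a quasigeodesic ray. -/
def QuasigeodesicRay.translate (g : G) (γ : QuasigeodesicRay X) : QuasigeodesicRay X :=
  ⟨fun t => g • γ.1 t, by
    obtain ⟨Q, C, hQ, hC, h⟩ := γ.2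
    refine ⟨Q, C, hQ, hC, fun s hs t ht => ?_⟩
    simpa only [dist_smul] using h s hs t ht⟩

/-- The action of an isometry `g ∈ G` on the Gromov boundary. -/
def boundaryMap (g : G) : GromovBoundary X → GromovBoundary X :=
  Quotient.map (sa := asymptoticSetoid X) (sb := asymptoticSetoid X)
    (QuasigeodesicRay.translate g) (by
      rintro γ η ⟨C, h₁, h₂⟩
      refine ⟨C, fun s => ?_, fun s => ?_⟩
      · obtain ⟨t, ht⟩ := h₁ s
        exact ⟨t, by simpa only [QuasigeodesicRay.translate, dist_smul] using ht⟩
      · obtain ⟨t, ht⟩ := h₂ s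
        exact ⟨t, by simpa only [QuasigeodesicRay.translate, dist_smul] using ht⟩)

variable (X) in
/-- The fixed points of `g` on the Gromov boundary. -/
def boundaryFixedPoints (g : G) : Set (GromovBoundary X) := {ξ | boundaryMap g ξ = ξ}

variable (X) in
/-- `g` is loxodromic: its translation length `lim d(gⁿ y, y) / n` is positive. -/
def IsLoxodromic (g : G) : Prop :=
  ∃ τ : ℝ, 0 < τ ∧
    ∀ y : X, Tendsto (fun n : ℕ => dist (g ^ n • y) y / (n : ℝ)) atTop (𝓝 τ)

variable (G) in
/-- The joint coarse stabilizer `Stab_K(x, y)`. -/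
def jointStab (K : ℝ) (x y : X) : Set G := {g | dist x (g • x) ≤ K ∧ dist y (g • y) ≤ K}

variable (X) in
/-- `h` is a WPD element of `G`. -/
def IsWPD (h : G) : Prop :=
  IsLoxodromic X h ∧
    ∀ K : ℝ, 0 ≤ K → ∀ y : X, ∃ M : ℕ, 0 < M ∧ (jointStab G K y (h ^ M • y)).Finite

/-- `α` is (the image of) a `(1, K₁)`-quasi-axis of `g`: a bi-infinite
`(1, K₁)`-quasigeodesic whose image is invariant under `g`. -/
def IsQuasiAxis (K₁ : ℝ) (g : G) (α : Set X) : Prop :=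
  (∃ γ : ℝ → X, IsQuasigeodesicOn 1 K₁ Set.univ γ ∧ α = Set.range γ) ∧
    (fun y => g • y) '' α = α

/-- `p` is a closest point projection of `x` to `α`. -/
def IsClosestPoint (x : X) (α : Set X) (p : X) : Prop :=
  p ∈ α ∧ ∀ q ∈ α, dist x p ≤ dist x q

/-- `Γ_μ`: the semigroup generated by the support of `μ`. -/
def generatedSemigroup (μ : PMF G) : Subsemigroup G := Subsemigroup.closure μ.support

variable (X) in
/-- `μ` is non-elementary: `Γ_μ` contains two loxodromic elements with disjoint fixed point sets
on the Gromov boundary. -/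
def IsNonElementary (μ : PMF G) : Prop :=
  ∃ g ∈ generatedSemigroup μ, ∃ h ∈ generatedSemigroup μ,
    IsLoxodromic X g ∧ IsLoxodromic X h ∧
      Disjoint (boundaryFixedPoints X g) (boundaryFixedPoints X h)

variable (X) in
/-- `μ` is bounded: its support moves some point of `X` within a bounded set. -/
def HasBoundedSupport (μ : PMF G) : Prop :=
  ∃ y : X, Bornology.IsBounded ((fun g : G => g • y) '' μ.support)

variable (X) in
/-- `μ` is WPD: `Γ_μ` contains an element which is WPD in `G`. -/
def IsWPDMeasure (μ : PMF G) : Prop := ∃ h ∈ generatedSemigroup μ, IsWPD X h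

/-- The law of the sequence of steps: the infinite product of copies of `μ` on `G^ℕ`, where `G`
is discrete. -/
noncomputable def stepMeasure (μ : PMF G) : @Measure (ℕ → G) (@MeasurableSpace.pi ℕ _ fun _ => ⊤) :=
  letI : MeasurableSpace G := ⊤
  Measure.infinitePi (fun _ : ℕ => μ.toMeasure)

/-- The location `w_n = g₁ ⋯ g_n` of the walk with steps `g_{i+1} = ω i`. -/
def walk (ω : ℕ → G) : ℕ → G
  | 0 => 1
  | n + 1 => walk ω n * ω n

/-- The probability that the `n`-th location `w_n` of the random walk lies in `A`. -/
noncomputable def walkProb (μ : PMF G) (n : ℕ) (A : Set G) : ℝ :=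
  (stepMeasure μ {ω | walk ω n ∈ A}).toReal

end Action

end HypWalk

/-! The heart of the matter is a conjugation. If the Gromov product of `P` and `Q` is at most `c`
both at `u • x` and at `u • f • x`, then an isometry moving `P` and `Q` by at most `K` moves these
two points by a bounded amount. So conjugation by `u` embeds the joint stabilizer of `P`, `Q` into
that of `x`, `f • x` with a larger constant (`encard_jointStab_le`). For `f` a high power of a WPD
element the target is finite (`IsWPD.exists_finite`), and its cardinality bounds all stabilizers at
once. What remains is to find such a `u`, with high probability, for the pair `x`, `w_n x` and for
the pair `p`, `w_n p`.

Drift: non-elementarity yields eight Schottky words of equal length, at most two of which can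
backtrack in any given situation. Hence `exp (-t d(y, x))`, averaged over the remaining part of the
law of a block of steps, is contracted by the walk (`IsSchottky.exists_contracted`). It follows that
the walk leaves every point `y` linearly, with exponential error bounds uniform in `y`
(`LinearDrift`).

Matching: wherever the walk is, it may read a Schottky word chosen to avoid backtracking, then a
fixed word `F` for `f`, and then move away linearly from `y` until its end. The words have
probability bounded below; the time at which a failure of the divergence is detected has an
exponential tail, and then the search restarts (`LinearDrift.exists_Pr_not_matches_le`). A success
produces the required `u` (`Matches.exists_gp_le`).

Quasi-axes: the product `(w⁻¹ x | w x)_x` is at most a small multiple of `n` outside an event of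
exponentially small probability. Then `w` is loxodromic and its quasi-axes pass near `x` on that
scale, whereas a match in the middle of the walk lies deeper and so still separates `p` from `w p`
(`hasDeepMatch_of_matches`, `HasDeepMatch.encard_le`). All error terms are exponential in `n`, which
is stronger than the stated rate. -/

namespace HypWalk

set_option linter.unusedSectionVars false

/-! ### Gromov products and the four point condition. -/

section GromovProduct

variable {X : Type*} [MetricSpace X]

/-- The Gromov product of `a` and `b` based at `o`. -/
noncomputable def gp (o a b : X) : ℝ := (dist o a + dist o b - dist a b) / 2

variable (X) in
/-- Gromov's four point condition. -/
def FourPoint (δ : ℝ) : Prop :=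
  ∀ o a b c : X, min (gp o a b) (gp o b c) - δ ≤ gp o a c

lemma gp_comm (o a b : X) : gp o a b = gp o b a := by
  simp only [gp, dist_comm a b]; ring

lemma gp_nonneg (o a b : X) : 0 ≤ gp o a b := by
  have := dist_triangle_left a b o
  simp only [gp]; linarith

lemma gp_le_left (o a b : X) : gp o a b ≤ dist o a := by
  have := dist_triangle o a b
  simp only [gp]; linarith

lemma gp_le_right (o a b : X) : gp o a b ≤ dist o b := by
  rw [gp_comm]; exact gp_le_left o b a

/-- Changing the base point to the other end of a side complements the Gromov product. -/
lemma gp_base_swap (a b c : X) : gp a b c = dist a b - gp b a c := by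
  simp only [gp, dist_comm b a]; ring

lemma dist_sub_dist_le_gp (o a b : X) : dist o a - dist a b ≤ gp o a b := by
  have := dist_triangle o b a
  simp only [gp, dist_comm b a] at *; linarith

lemma gp_le_add_dist_base (o o' a b : X) : gp o a b ≤ gp o' a b + dist o o' := by
  have h1 := dist_triangle o o' a
  have h2 := dist_triangle o o' b
  simp only [gp]; linarith

lemma gp_le_add_dist_left (o a a' b : X) : gp o a b ≤ gp o a' b + dist a a' := by
  have h1 := dist_triangle o a' a
  have h2 := dist_triangle a' a b
  rw [dist_comm a' a] at *
  simp only [gp]; linarith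

lemma gp_le_add_dist_right (o a b b' : X) : gp o a b ≤ gp o a b' + dist b b' := by
  rw [gp_comm o a b, gp_comm o a b']; exact gp_le_add_dist_left o b b' a

lemma dist_eq_gp (o a b : X) : dist a b = dist o a + dist o b - 2 * gp o a b := by
  simp only [gp]; ring

variable {δ : ℝ}

lemma FourPoint.nonneg [Nonempty X] (h : FourPoint X δ) : 0 ≤ δ := by
  obtain ⟨x⟩ := ‹Nonempty X›
  have := h x x x x
  simp only [gp, dist_self, min_self] at this
  linarith

/-- If `b` and `c` are far in the same direction, then `c` inherits small Gromov products from
`b`. -/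
lemma FourPoint.gp_le (h : FourPoint X δ) {o a b c : X} {C : ℝ} (h1 : gp o a b ≤ C)
    (h2 : C + δ < gp o b c) : gp o a c ≤ C + δ := by
  have h3 := h o a c b
  rw [gp_comm o c b] at h3
  by_contra! h4
  rcases min_choice (gp o a c) (gp o b c) with h5 | h5 <;> rw [h5] at h3 <;> linarith

end GromovProduct

/-! ### From thin triangles to the four point condition. -/

section Rips

variable {X : Type*} [MetricSpace X] {δ : ℝ}

lemma IsGeodesicSegment.symm {s : Set X} {x y : X} (h : IsGeodesicSegment s x y) :
    IsGeodesicSegment s y x := by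
  obtain ⟨γ, h0, h1, hd, rfl⟩ := h
  refine ⟨fun t => γ (dist x y - t), by simpa, by simp [dist_comm y x, h0], ?_, ?_⟩
  · intro a ha b hb
    rw [dist_comm y x] at ha hb
    rw [hd _ ⟨by linarith [ha.2], by linarith [ha.1]⟩ _ ⟨by linarith [hb.2], by linarith [hb.1]⟩,
      abs_sub_comm]
    congr 1; ring
  · rw [dist_comm y x]
    ext p; constructor
    · rintro ⟨t, ht, rfl⟩
      exact ⟨dist x y - t, ⟨by linarith [ht.2], by linarith [ht.1]⟩, by simp⟩
    · rintro ⟨t, ht, rfl⟩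
      exact ⟨dist x y - t, ⟨by linarith [ht.2], by linarith [ht.1]⟩, rfl⟩

lemma IsGeodesicSegment.dist_add {s : Set X} {x y : X} (h : IsGeodesicSegment s x y) {p : X}
    (hp : p ∈ s) : dist x p + dist p y = dist x y := by
  obtain ⟨γ, h0, h1, hd, rfl⟩ := h
  obtain ⟨t, ht, rfl⟩ := hp
  have h2 := hd 0 ⟨le_rfl, dist_nonneg⟩ t ht
  have h3 := hd t ht (dist x y) ⟨dist_nonneg, le_rfl⟩
  rw [h0] at h2
  rw [h1] at h3
  rw [h2, h3, abs_sub_comm, sub_zero, abs_of_nonneg ht.1, abs_sub_comm,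
    abs_of_nonneg (by linarith [ht.2])]
  ring

lemma IsGeodesicSegment.gp_le_dist {s : Set X} {x y : X} (h : IsGeodesicSegment s x y) {p : X}
    (hp : p ∈ s) (o : X) : gp o x y ≤ dist o p := by
  have := h.dist_add hp
  have h1 := dist_triangle o p x
  have h2 := dist_triangle o p y
  rw [dist_comm p x] at h1
  simp only [gp]; linarith

lemma IsHyperbolicWith.exists_between (h : IsHyperbolicWith X δ) (x z : X) {r : ℝ} (h0 : 0 ≤ r)
    (hr : r ≤ dist x z) : ∃ q, dist x q = r ∧ dist q z = dist x z - r := by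
  obtain ⟨s, hs⟩ := h.geodesic x z
  have hs' := hs
  obtain ⟨γ, g0, g1, hd, rfl⟩ := hs
  have h2 := hd 0 ⟨le_rfl, dist_nonneg⟩ r ⟨h0, hr⟩
  rw [g0, zero_sub, abs_neg, abs_of_nonneg h0] at h2
  have h3 := hs'.dist_add ⟨r, ⟨h0, hr⟩, rfl⟩
  exact ⟨γ r, h2, by linarith⟩

/-- The distance to a side of a triangle is bounded by the Gromov product. -/
lemma IsHyperbolicWith.exists_dist_le_gp (h : IsHyperbolicWith X δ) (hδ : 0 ≤ δ) {s : Set X}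
    {a c : X} (hs : IsGeodesicSegment s a c) (o : X) :
    ∃ p ∈ s, dist o p ≤ gp o a c + 2 * (δ + 1) := by
  obtain ⟨t, ht⟩ := h.geodesic c o
  obtain ⟨u, hu⟩ := h.geodesic o a
  obtain ⟨γ, g0, g1, hd, hs2⟩ := id hs
  have hct : c ∈ t := by
    obtain ⟨η, e0, e1, -, rfl⟩ := ht
    exact ⟨0, ⟨le_rfl, dist_nonneg⟩, e0⟩
  have hau : a ∈ u := by
    obtain ⟨η, e0, e1, -, rfl⟩ := hu
    exact ⟨dist o a, ⟨dist_nonneg, le_rfl⟩, e1⟩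
  have hcont : ContinuousOn γ (Set.Icc 0 (dist a c)) := by
    have : LipschitzOnWith 1 γ (Set.Icc 0 (dist a c)) := by
      apply LipschitzOnWith.of_dist_le_mul
      intro a ha b hb
      rw [hd a ha b hb, Real.dist_eq]; simp
    exact this.continuousOn
  -- The points of `[a, c]` close to `[o, a]` and those close to `[c, o]` form two nonempty closed
  -- sets covering an interval. By connectedness some point is close to both sides.
  have key : (Set.Icc 0 (dist a c) ∩ {r | Metric.infDist (γ r) u ≤ δ} ∩
      {r | Metric.infDist (γ r) t ≤ δ}).Nonempty := by
    have hpre := (isPreconnected_Icc (a := (0 : ℝ)) (b := dist a c))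
    rw [isPreconnected_closed_iff] at hpre
    have hcl : ∀ v : Set X, IsClosed (Set.Icc 0 (dist a c) ∩ {r | Metric.infDist (γ r) v ≤ δ}) := by
      intro v
      have : ContinuousOn (fun r => Metric.infDist (γ r) v) (Set.Icc 0 (dist a c)) :=
        (Metric.continuous_infDist_pt v).comp_continuousOn hcont
      exact this.preimage_isClosed_of_isClosed isClosed_Icc isClosed_Iic
    obtain ⟨r, hr, h1, h2⟩ := hpre _ _ (hcl u) (hcl t) (by
        intro r hr
        obtain ⟨q, hq, hpq⟩ := h.thin a c o s t u hs ht hu (γ r) (hs2 ▸ ⟨r, hr, rfl⟩)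
        rcases hq with hq | hq
        · exact Or.inr ⟨hr, (Metric.infDist_le_dist_of_mem hq).trans hpq⟩
        · exact Or.inl ⟨hr, (Metric.infDist_le_dist_of_mem hq).trans hpq⟩)
      ⟨0, ⟨le_rfl, dist_nonneg⟩, ⟨le_rfl, dist_nonneg⟩, by
        simpa [g0, Metric.infDist_zero_of_mem hau] using hδ⟩
      ⟨dist a c, ⟨dist_nonneg, le_rfl⟩, ⟨dist_nonneg, le_rfl⟩, by
        simpa [g1, Metric.infDist_zero_of_mem hct] using hδ⟩
    exact ⟨r, ⟨hr, h1.2⟩, h2.2⟩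
  obtain ⟨r, ⟨hr, hru⟩, hrt⟩ := key
  -- The extra `1` replaces `infDist ≤ δ` by an actual point, since segments are not shown to be
  -- compact here.
  obtain ⟨v, hv, hv2⟩ := (Metric.infDist_lt_iff ⟨a, hau⟩).1 (lt_of_le_of_lt hru (lt_add_one δ))
  obtain ⟨w, hw, hw2⟩ := (Metric.infDist_lt_iff ⟨c, hct⟩).1 (lt_of_le_of_lt hrt (lt_add_one δ))
  have hp : γ r ∈ s := hs2 ▸ ⟨r, hr, rfl⟩
  refine ⟨γ r, hp, ?_⟩
  have e1 := hs.dist_add hp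
  have e2 := hu.dist_add hv
  have e3 := ht.symm.dist_add hw
  have e4 := dist_triangle o v (γ r)
  have e5 := dist_triangle a v (γ r)
  have e6 := dist_triangle o w (γ r)
  have e7 := dist_triangle c w (γ r)
  rw [dist_comm v (γ r)] at e4 e5
  rw [dist_comm w (γ r)] at e6 e7
  rw [dist_comm v a] at e2
  rw [dist_comm w c] at e3
  rw [dist_comm (γ r) c] at e1
  simp only [gp]; linarith

/-- Some `p` on `[a, c]` realizes the Gromov product up to `2 * (δ + 1)`. Thinness moves it by `δ`
onto another side, and the distance from `o` to any point of a side bounds the product of its ends.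
-/
lemma IsHyperbolicWith.fourPoint (h : IsHyperbolicWith X δ) (hδ : 0 ≤ δ) :
    FourPoint X (3 * δ + 2) := by
  intro o a b c
  obtain ⟨s, hs⟩ := h.geodesic a c
  obtain ⟨t, ht⟩ := h.geodesic c b
  obtain ⟨u, hu⟩ := h.geodesic b a
  obtain ⟨p, hp, hop⟩ := h.exists_dist_le_gp hδ hs o
  obtain ⟨q, hq, hpq⟩ := h.thin a c b s t u hs ht hu p hp
  have h1 := dist_triangle o p q
  rcases hq with hq | hq
  · have h2 := ht.gp_le_dist hq o
    rw [gp_comm] at h2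
    linarith [min_le_right (gp o a b) (gp o b c)]
  · have h2 := hu.gp_le_dist hq o
    rw [gp_comm] at h2
    linarith [min_le_left (gp o a b) (gp o b c)]

/-- The consequences of hyperbolicity on which everything else is based. -/
structure GromovSpace (X : Type*) [MetricSpace X] (δ : ℝ) : Prop where
  nonneg : 0 ≤ δ
  fourPoint : FourPoint X δ
  between : ∀ (x z : X) (r : ℝ), 0 ≤ r → r ≤ dist x z → ∃ q, dist x q = r ∧ dist q z = dist x z - r

lemma IsGromovHyperbolic.exists_gromovSpace (h : IsGromovHyperbolic X) [Nonempty X] :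
    ∃ δ, GromovSpace X δ := by
  obtain ⟨δ, h⟩ := h
  have hδ : 0 ≤ δ := by
    obtain ⟨x⟩ := ‹Nonempty X›
    obtain ⟨s, hs⟩ := h.geodesic x x
    obtain ⟨γ, g0, g1, hd, e⟩ := id hs
    have hx : x ∈ s := e ▸ ⟨0, ⟨le_rfl, dist_nonneg⟩, g0⟩
    obtain ⟨q, -, hq⟩ := h.thin x x x s s s hs hs hs x hx
    exact dist_nonneg.trans hq
  exact ⟨_, by positivity, h.fourPoint hδ, fun x z r h0 hr => h.exists_between x z h0 hr⟩

end Rips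

/-! ### Paths that move away linearly from a point. -/

section Divergence

variable {X : Type*} [MetricSpace X] {δ : ℝ}

lemma dist_path_le {v : ℕ → X} {n : ℕ} {L : ℝ} (hL : ∀ i < n, dist (v i) (v (i + 1)) ≤ L)
    {a b : ℕ} (hab : a ≤ b) (hb : b ≤ n) : dist (v a) (v b) ≤ L * ((b : ℝ) - a) := by
  induction b, hab using Nat.le_induction with
  | base => simp
  | succ b hab ih =>
    have := ih (by omega)
    have h2 := hL b (by omega)
    have h3 := dist_triangle (v a) (v b) (v (b + 1))
    push_cast; linarith

/-- A path which moves away linearly from `q` has both ends in the same direction seen from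
`q`. -/
lemma FourPoint.le_gp_of_diverges (h : FourPoint X δ) {v : ℕ → X} {n s : ℕ} {L κ A : ℝ} {q : X}
    (hδ : 0 ≤ δ) (hL0 : 0 ≤ L) (hκ : 0 ≤ κ) (hs : 2 * δ ≤ κ * s) (hs0 : 0 < s)
    (hL : ∀ i < n, dist (v i) (v (i + 1)) ≤ L) (hdiv : ∀ i ≤ n, A + κ * i ≤ dist q (v i)) :
    ∀ a ≤ n, A + κ / 2 * a - (L * s + δ) ≤ gp q (v a) (v n) := by
  intro a ha
  induction hk : n - a using Nat.strong_induction_on generalizing a with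
  | _ k ih =>
    have h1 := hdiv a ha
    have ha0 : 0 ≤ κ * a := by positivity
    by_cases has : a + s ≤ n
    · have h2 := ih (n - (a + s)) (by omega) (a + s) has rfl
      have h3 := h q (v a) (v (a + s)) (v n)
      have h4 := dist_sub_dist_le_gp q (v a) (v (a + s))
      have h5 := dist_path_le hL (Nat.le_add_right a s) has
      push_cast at h2 h5
      -- Each jump of `s` steps loses `δ` in the four point condition; `2 * δ ≤ κ * s` lets half of
      -- the speed pay for it, which is why `κ / 2` appears in the conclusion.
      have : min (A + κ / 2 * a - L * s) (A + κ / 2 * a - (L * s + δ) + δ) ≤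
          min (gp q (v a) (v (a + s))) (gp q (v (a + s)) (v n)) := by
        refine min_le_min ?_ ?_
        · nlinarith
        · nlinarith
      have e : min (A + κ / 2 * a - L * s) (A + κ / 2 * a - (L * s + δ) + δ) =
        A + κ / 2 * a - L * s := by rw [min_eq_left]; linarith
      linarith
    · have h4 := dist_sub_dist_le_gp q (v a) (v n)
      have h5 := dist_path_le hL ha le_rfl
      have h6 : (n : ℝ) - a ≤ s := by
        have : (n : ℝ) ≤ a + s := by exact_mod_cast (by omega : n ≤ a + s)
        linarith
      have h7 := mul_le_mul_of_nonneg_left h6 hL0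
      linarith

/-- A path which moves away linearly from `z` has bounded Gromov product with `z`. -/
lemma GromovSpace.gp_le_of_diverges (h : GromovSpace X δ) {v : ℕ → X} {n s : ℕ} {L κ A : ℝ} {z : X}
    (hL0 : 0 ≤ L) (hκ : 0 ≤ κ) (hs : 2 * δ ≤ κ * s) (hs0 : 0 < s)
    (hL : ∀ i < n, dist (v i) (v (i + 1)) ≤ L)
    (hdiv : ∀ i ≤ n, dist z (v 0) + κ * i - A ≤ dist z (v i)) :
    gp (v 0) z (v n) ≤ A + L * s + 2 * δ := by
  set r := gp (v 0) z (v n) with hr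
  have hr0 : 0 ≤ r := gp_nonneg _ _ _
  -- `q` is the branch point on the way from `v 0` to `z`. Seen from `q`, the product of `v 0` and
  -- `v n` is at most `δ`; but the path also diverges from `q`, so that product is at least about `r
  -- - A`.
  obtain ⟨q, hq1, hq2⟩ := h.between (v 0) z r hr0 (gp_le_left _ _ _)
  have h1 : gp (v 0) q z = r := by simp only [gp, hq1, hq2]; ring
  have h2 := h.fourPoint (v 0) q z (v n)
  rw [h1, ← hr, min_self] at h2
  have h3 := gp_base_swap q (v 0) (v n)
  rw [dist_comm q, hq1] at h3
  have h4 := h.fourPoint.le_gp_of_diverges (A := r - A) (q := q) h.nonneg hL0 hκ hs hs0 hL (by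
    intro i hi
    have h5 := hdiv i hi
    have h6 := dist_triangle z q (v i)
    rw [dist_comm z q, hq2] at h6
    rw [dist_comm z (v 0)] at h5
    linarith) 0 (by omega)
  simp only [Nat.cast_zero, mul_zero, add_zero] at h4
  linarith

end Divergence

/-! ### Isometries displacing the ends of a segment by a bounded amount. -/

section Isometries

variable {G : Type*} [Group G] {X : Type*} [MetricSpace X] [MulAction G X] [IsIsometricSMul G X]
  {δ : ℝ}

lemma gp_smul (g : G) (o a b : X) : gp (g • o) (g • a) (g • b) = gp o a b := by
  simp only [gp, dist_smul]

lemma gp_smul_base (g : G) (o a b : X) : gp (g • o) a b = gp o (g⁻¹ • a) (g⁻¹ • b) := by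
  rw [← gp_smul g o, smul_inv_smul, smul_inv_smul]

lemma dist_smul_left (g : G) (a b : X) : dist (g • a) b = dist a (g⁻¹ • b) := by
  rw [← dist_smul g a, smul_inv_smul]

lemma dist_inv_smul_self (g : G) (x : X) : dist x (g⁻¹ • x) = dist x (g • x) := by
  rw [← dist_smul_left, dist_comm]

/-- An isometry which moves `p` and `q` a little moves each point near `[p, q]` a little. -/
lemma FourPoint.dist_smul_le (h : FourPoint X δ) {g : G} {p q o : X} {K C : ℝ}
    (hp : dist p (g • p) ≤ K) (hq : dist q (g • q) ≤ K) (ho : gp o p q ≤ C) :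
    dist o (g • o) ≤ 7 * K + 2 * C + 2 * δ := by
  -- Seen from `p`, both `o` and `g • o` lie in the direction of `q`, at distances from `p` that
  -- differ by at most `K`; so they are close to each other.
  have h1 := h p o q (g • o)
  have h2 := gp_base_swap p o q
  have h3 := gp_base_swap p (g • o) q
  have h4 := gp_le_add_dist_left (g • o) p (g • p) q
  have h5 := gp_le_add_dist_right (g • o) (g • p) q (g • q)
  rw [gp_smul] at h5
  have h6 := dist_triangle p (g • p) (g • o)
  have h7 := dist_triangle (g • p) p (g • o)
  rw [dist_comm (g • p) p] at h7
  rw [dist_smul] at *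
  have h8 := dist_eq_gp p o (g • o)
  rw [gp_comm p q (g • o)] at h1
  rcases min_choice (gp p o q) (gp p (g • o) q) with h9 | h9 <;> rw [h9] at h1 <;> linarith

end Isometries

/-! ### The local-to-global principle for products of long transverse letters. -/

section Chains

variable {G : Type*} [Group G] {X : Type*} [MetricSpace X] [MulAction G X] [IsIsometricSMul G X]
  {δ : ℝ}

/-- Consecutive letters of `l` are transverse, and all letters are long. -/
structure IsLocalGeodesic (x : X) (C D : ℝ) (l : List G) : Prop where
  long : ∀ g ∈ l, D ≤ dist x (g • x)
  transverse : l.IsChain fun a b => gp x (a⁻¹ • x) (b • x) ≤ C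

lemma IsLocalGeodesic.tail {x : X} {C D : ℝ} {g : G} {l : List G}
    (h : IsLocalGeodesic x C D (g :: l)) : IsLocalGeodesic x C D l :=
  ⟨fun a ha => h.long a (List.mem_cons_of_mem _ ha), h.transverse.tail⟩

/-- By induction the product of the tail agrees with its first letter `a` over a length of at least
`D - C - δ`, which exceeds `C + δ`. So it inherits the small product with `g⁻¹ • x` from `a • x`,
and the loss `δ` does not accumulate along the word. -/
lemma IsLocalGeodesic.gp_le (h4 : FourPoint X δ) (hδ : 0 ≤ δ) {x : X} {C D : ℝ} (hC : 0 ≤ C)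
    (hCD : 2 * C + 2 * δ < D) {l : List G} {g : G} (h : IsLocalGeodesic x C D (g :: l)) :
    gp x (g⁻¹ • x) (l.prod • x) ≤ C + δ := by
  induction l generalizing g with
  | nil =>
    have := gp_le_right x (g⁻¹ • x) x
    simp only [List.prod_nil, one_smul, dist_self] at this ⊢
    linarith
  | cons a l ih =>
    have h1 := ih h.tail
    have h2 : gp x (g⁻¹ • x) (a • x) ≤ C := (List.isChain_cons_cons.1 h.transverse).1
    refine h4.gp_le h2 ?_
    rw [gp_base_swap, gp_smul_base, List.prod_cons, ← mul_smul, inv_mul_cancel_left]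
    have := h.long a (by simp)
    linarith

/-- The product points in the direction of its first letter. -/
lemma IsLocalGeodesic.le_gp_cons (h4 : FourPoint X δ) (hδ : 0 ≤ δ) {x : X} {C D : ℝ} (hC : 0 ≤ C)
    (hCD : 2 * C + 2 * δ < D) {l : List G} {g : G} (h : IsLocalGeodesic x C D (g :: l)) :
    D - C - δ ≤ gp x (g • x) ((g :: l).prod • x) := by
  rw [gp_base_swap, gp_smul_base, List.prod_cons, ← mul_smul, inv_mul_cancel_left]
  linarith [h.long g (by simp), h.gp_le h4 hδ hC hCD]

/-- Every junction costs twice a Gromov product, and `IsLocalGeodesic.gp_le` bounds that product by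
`C + δ`. -/
lemma IsLocalGeodesic.sum_le_dist (h4 : FourPoint X δ) (hδ : 0 ≤ δ) {x : X} {C D : ℝ} (hC : 0 ≤ C)
    (hCD : 2 * C + 2 * δ < D) {l : List G} (h : IsLocalGeodesic x C D l) :
    (l.map fun g => dist x (g • x) - (2 * C + 2 * δ)).sum ≤ dist x (l.prod • x) := by
  induction l with
  | nil => simp
  | cons g l ih =>
    have h1 := ih h.tail
    have h2 := h.gp_le h4 hδ hC hCD
    have h3 := dist_eq_gp x (g⁻¹ • x) (l.prod • x)
    rw [dist_smul_left, inv_inv, ← mul_smul, dist_inv_smul_self] at h3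
    rw [List.map_cons, List.sum_cons, List.prod_cons]
    linarith

lemma dist_list_prod_le {x : X} {L : ℝ} {l : List G} (h : ∀ g ∈ l, dist x (g • x) ≤ L) :
    dist x (l.prod • x) ≤ L * l.length := by
  induction l with
  | nil => simp
  | cons g l ih =>
    have h1 := ih fun a ha => h a (List.mem_cons_of_mem _ ha)
    have h2 := h g (by simp)
    have h3 := dist_triangle x (g • x) ((g * l.prod) • x)
    rw [mul_smul, dist_smul] at h3
    rw [List.prod_cons, List.length_cons, mul_smul]
    push_cast; linarith

lemma isLocalGeodesic_replicate {x : X} {C D : ℝ} {g : G} (n : ℕ)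
    (h1 : gp x (g⁻¹ • x) (g • x) ≤ C) (h2 : D ≤ dist x (g • x)) :
    IsLocalGeodesic x C D (List.replicate n g) :=
  ⟨fun a ha => by rwa [List.eq_of_mem_replicate ha],
    List.isChain_replicate_of_rel n h1⟩

/-- If `g` moves `x` by much more than `(g⁻¹ x | g x)_x`, its orbit is a quasigeodesic. -/
lemma gp_pow_le (h4 : FourPoint X δ) (hδ : 0 ≤ δ) {x : X} {C D : ℝ} (hC : 0 ≤ C)
    (hCD : 2 * C + 3 * δ < D) {g : G} (h1 : gp x (g⁻¹ • x) (g • x) ≤ C)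
    (h2 : D ≤ dist x (g • x)) (i j : ℕ) : gp x (g⁻¹ ^ i • x) (g ^ j • x) ≤ C + 2 * δ := by
  -- One letter more than `j`: the first one plays the role of `g` in `IsLocalGeodesic.gp_le`, the
  -- tail is `g ^ j`.
  have hr := isLocalGeodesic_replicate (x := x) (C := C) (D := D) (j + 1) h1 h2
  have hr' := isLocalGeodesic_replicate (x := x) (C := C) (D := D) (g := g⁻¹) i
    (by rwa [inv_inv, gp_comm]) (by rwa [dist_inv_smul_self])
  rcases i with _ | i
  · have := gp_le_left x x (g ^ j • x)
    simp only [pow_zero, one_smul, dist_self] at this ⊢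
    linarith
  · rw [List.replicate_succ] at hr hr'
    have h3 := hr.gp_le h4 hδ hC (by linarith)
    have h5 := hr'.le_gp_cons h4 hδ hC (by linarith)
    rw [List.prod_replicate] at h3
    rw [← List.replicate_succ, List.prod_replicate] at h5
    rw [gp_comm] at h3 ⊢
    have := h4.gp_le h3 (c := g⁻¹ ^ (i + 1) • x) (by linarith)
    linarith

lemma le_dist_pow (h4 : FourPoint X δ) (hδ : 0 ≤ δ) {x : X} {C D : ℝ} (hC : 0 ≤ C)
    (hCD : 2 * C + 2 * δ < D) {g : G} (h1 : gp x (g⁻¹ • x) (g • x) ≤ C)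
    (h2 : D ≤ dist x (g • x)) (n : ℕ) : (D - 2 * C - 2 * δ) * n ≤ dist x (g ^ n • x) := by
  have h3 := (isLocalGeodesic_replicate (x := x) (C := C) (D := D) n h1 h2).sum_le_dist h4 hδ hC hCD
  rw [List.map_replicate, List.sum_replicate, List.prod_replicate, nsmul_eq_mul] at h3
  have : (n : ℝ) * (D - 2 * C - 2 * δ) ≤ n * (dist x (g • x) - (2 * C + 2 * δ)) := by
    refine mul_le_mul_of_nonneg_left ?_ (Nat.cast_nonneg n)
    linarith
  linarith

end Chains

/-! ### Linear growth and Gromov products along loxodromic orbits. -/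

section Loxodromic

variable {G : Type*} [Group G] {X : Type*} [MetricSpace X] [MulAction G X] [IsIsometricSMul G X]
  {δ : ℝ}

lemma dist_pow_add_le (g : G) (x : X) (m n : ℕ) :
    dist x (g ^ (m + n) • x) ≤ dist x (g ^ m • x) + dist x (g ^ n • x) := by
  rw [pow_add, mul_smul]
  have := dist_triangle x (g ^ m • x) (g ^ m • g ^ n • x)
  rwa [dist_smul] at this

lemma dist_pow_le (g : G) (x : X) (n : ℕ) : dist x (g ^ n • x) ≤ dist x (g • x) * n := by
  have := dist_list_prod_le (x := x) (l := List.replicate n g) (L := dist x (g • x))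
    (fun a ha => by rw [List.eq_of_mem_replicate ha])
  simpa using this

lemma tendsto_translation_of (g : G) (x y : X) {τ : ℝ}
    (h : Tendsto (fun n : ℕ => dist (g ^ n • x) x / (n : ℝ)) atTop (𝓝 τ)) :
    Tendsto (fun n : ℕ => dist (g ^ n • y) y / (n : ℝ)) atTop (𝓝 τ) := by
  have hb : Tendsto (fun n : ℕ => 2 * dist x y / (n : ℝ)) atTop (𝓝 0) :=
    tendsto_const_div_atTop_nhds_zero_nat _
  have h1 := h.sub hb
  have h2 := h.add hb
  rw [sub_zero] at h1
  rw [add_zero] at h2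
  refine tendsto_of_tendsto_of_tendsto_of_le_of_le h1 h2 (fun n => ?_) (fun n => ?_)
  · show dist (g ^ n • x) x / (n : ℝ) - 2 * dist x y / n ≤ _
    rw [← sub_div]
    gcongr
    have e1 := dist_triangle (g ^ n • x) (g ^ n • y) x
    have e2 := dist_triangle (g ^ n • y) y x
    rw [dist_smul] at e1
    rw [dist_comm y x] at e2
    linarith
  · show _ ≤ dist (g ^ n • x) x / (n : ℝ) + 2 * dist x y / n
    rw [← add_div]
    gcongr
    have e1 := dist_triangle (g ^ n • y) (g ^ n • x) y
    have e2 := dist_triangle (g ^ n • x) x y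
    rw [dist_smul, dist_comm y x] at e1
    linarith

/-- Linear growth of an orbit characterizes loxodromic elements. -/
lemma isLoxodromic_of_linear {g : G} {x : X} {c : ℝ} (hc : 0 < c)
    (h : ∀ n : ℕ, c * n ≤ dist x (g ^ n • x)) : IsLoxodromic X g := by
  have hsub : Subadditive fun n : ℕ => dist x (g ^ n • x) := dist_pow_add_le g x
  have hbdd : BddBelow (Set.range fun n : ℕ => dist x (g ^ n • x) / n) :=
    ⟨0, by rintro _ ⟨n, rfl⟩; positivity⟩
  have hl := hsub.tendsto_lim hbdd
  refine ⟨hsub.lim, lt_of_lt_of_le hc ?_, fun y => tendsto_translation_of g x y ?_⟩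
  · refine ge_of_tendsto hl ?_
    filter_upwards [eventually_gt_atTop 0] with n hn
    rw [le_div_iff₀ (by exact_mod_cast hn)]
    exact h n
  · simpa only [dist_comm x] using hl

/-- The translation length is the infimum of the averages, not only their limit: along the multiples
of `n`, subadditivity keeps the averages below the one at `n`. -/
lemma IsLoxodromic.le_dist {g : G} {τ : ℝ} {x : X}
    (h : Tendsto (fun n : ℕ => dist (g ^ n • x) x / (n : ℝ)) atTop (𝓝 τ)) (n : ℕ) :
    τ * n ≤ dist x (g ^ n • x) := by
  rcases Nat.eq_zero_or_pos n with rfl | hn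
  · simp
  have h1 : Tendsto (fun k : ℕ => dist (g ^ (n * k) • x) x / ((n * k : ℕ) : ℝ)) atTop (𝓝 τ) :=
    h.comp (tendsto_id.const_mul_atTop' hn)
  rw [← le_div_iff₀ (by exact_mod_cast hn)]
  refine le_of_tendsto h1 ?_
  filter_upwards [eventually_gt_atTop 0] with k hk
  have h2 := dist_pow_le (g ^ n) x k
  rw [← pow_mul] at h2
  have hn' : (0 : ℝ) < n := by exact_mod_cast hn
  have hk' : (0 : ℝ) < k := by exact_mod_cast hk
  rw [dist_comm, div_le_div_iff₀ (by positivity) hn']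
  push_cast
  nlinarith

/-- A loxodromic element has a power whose translation dominates its Gromov product. -/
lemma IsLoxodromic.exists_pow {g : G} (h : IsLoxodromic X g) (x : X) (δ : ℝ) :
    ∃ p : ℕ, 0 < p ∧ 2 * gp x ((g ^ p)⁻¹ • x) (g ^ p • x) + 3 * δ < dist x (g ^ p • x) := by
  obtain ⟨τ, hτ, hlim⟩ := h
  -- For large `p` the displacement of `g ^ p` is below `5 / 4 * τ * p` while that of `g ^ (2 * p)`
  -- is at least `2 * τ * p`. So twice the product is at most `τ * p / 2`, and `p > 6 * δ / τ`
  -- absorbs `3 * δ` into the other half.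
  have h1 := (hlim x).eventually (gt_mem_nhds (show τ < τ + τ / 4 by linarith))
  obtain ⟨p, ⟨hp1, hp2⟩, hp3⟩ := ((h1.and (eventually_gt_atTop 0)).and
    (eventually_gt_atTop ⌈6 * δ / τ⌉₊)).exists
  refine ⟨p, hp2, ?_⟩
  have hp : (0 : ℝ) < p := by exact_mod_cast hp2
  rw [div_lt_iff₀ hp] at hp1
  have h2 := IsLoxodromic.le_dist (hlim x) (p + p)
  have h3 := IsLoxodromic.le_dist (hlim x) p
  have h4 := dist_eq_gp x ((g ^ p)⁻¹ • x) (g ^ p • x)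
  rw [dist_smul_left, inv_inv, ← mul_smul, ← pow_add, dist_inv_smul_self] at h4
  have h5 : 6 * δ / τ < p := lt_of_le_of_lt (Nat.le_ceil _) (by exact_mod_cast hp3)
  rw [div_lt_iff₀ hτ] at h5
  push_cast at h2
  rw [dist_comm] at hp1
  nlinarith

lemma dist_pow_mul_mod_le (g : G) (x : X) (p i : ℕ) (hp : 0 < p) :
    dist (g ^ i • x) ((g ^ p) ^ (i / p) • x) ≤ dist x (g • x) * p := by
  have h : g ^ i = (g ^ p) ^ (i / p) * g ^ (i % p) := by
    rw [← pow_mul, ← pow_add, Nat.div_add_mod]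
  rw [h, mul_smul, dist_smul, dist_comm]
  refine (dist_pow_le g x _).trans ?_
  gcongr
  exact (Nat.mod_lt i hp).le

/-- A suitable power satisfies the local-to-global principle, and all other orbit points are within
bounded distance of the orbit of that power. -/
lemma IsLoxodromic.exists_gp_le (h4 : FourPoint X δ) (hδ : 0 ≤ δ) {g : G} (h : IsLoxodromic X g)
    (x : X) : ∃ C : ℝ, ∀ i j : ℕ, gp x (g⁻¹ ^ i • x) (g ^ j • x) ≤ C := by
  obtain ⟨p, hp, hlt⟩ := h.exists_pow x δ
  refine ⟨gp x ((g ^ p)⁻¹ • x) (g ^ p • x) + 2 * δ + dist x (g⁻¹ • x) * p + dist x (g • x) * p,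
    fun i j => ?_⟩
  have h1 := gp_pow_le h4 hδ (gp_nonneg _ _ _) hlt le_rfl le_rfl (i / p) (j / p)
  have h2 := dist_pow_mul_mod_le g x p j hp
  have h3 := dist_pow_mul_mod_le g⁻¹ x p i hp
  have h5 := gp_le_add_dist_left x (g⁻¹ ^ i • x) ((g⁻¹ ^ p) ^ (i / p) • x) (g ^ j • x)
  have h6 := gp_le_add_dist_right x ((g⁻¹ ^ p) ^ (i / p) • x) (g ^ j • x) ((g ^ p) ^ (j / p) • x)
  rw [inv_pow g p] at h3 h5 h6
  linarith

lemma IsLoxodromic.inv {g : G} (h : IsLoxodromic X g) : IsLoxodromic X g⁻¹ := by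
  obtain ⟨τ, hτ, h⟩ := h
  refine ⟨τ, hτ, fun y => ?_⟩
  have key : ∀ n : ℕ, dist (g⁻¹ ^ n • y) y = dist (g ^ n • y) y := fun n => by
    rw [inv_pow, dist_smul_left, inv_inv, dist_comm]
  simpa only [key] using h y

end Loxodromic

/-! ### Disjoint boundary fixed points give transverse orbits. -/

section Boundary

variable {G : Type*} [Group G] {X : Type*} [MetricSpace X] [MulAction G X] [IsIsometricSMul G X]
  {δ : ℝ}

lemma dist_pow_smul_pow (g : G) (x : X) {m n : ℕ} (h : m ≤ n) :
    dist (g ^ m • x) (g ^ n • x) = dist x (g ^ (n - m) • x) := by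
  conv_lhs => rw [← Nat.add_sub_cancel' h, pow_add, mul_smul, dist_smul]

/-- The orbit of a loxodromic element as a quasigeodesic ray. -/
noncomputable def IsLoxodromic.ray {g : G} (h : IsLoxodromic X g) (x : X) : QuasigeodesicRay X :=
  ⟨fun t => g ^ ⌊t⌋₊ • x, by
    obtain ⟨τ, hτ, hlim⟩ := h
    set L := dist x (g • x)
    set Q := max 1 (max L τ⁻¹)
    have hQ1 : 1 ≤ Q := le_max_left _ _
    have hQL : L ≤ Q := (le_max_left _ _).trans (le_max_right _ _)
    have hQτ : Q⁻¹ ≤ τ := inv_le_of_inv_le₀ hτ ((le_max_right _ _).trans (le_max_right _ _))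
    have hτQ : 0 < Q⁻¹ := by positivity
    have key : ∀ s t : ℝ, 0 ≤ s → s ≤ t → Q⁻¹ * |s - t| - (Q + 1) ≤
        dist (g ^ ⌊s⌋₊ • x) (g ^ ⌊t⌋₊ • x) ∧
        dist (g ^ ⌊s⌋₊ • x) (g ^ ⌊t⌋₊ • x) ≤ Q * |s - t| + (Q + 1) := by
      intro s t hs hst
      have hfl : ⌊s⌋₊ ≤ ⌊t⌋₊ := Nat.floor_mono hst
      rw [dist_pow_smul_pow g x hfl, abs_sub_comm, abs_of_nonneg (by linarith)]
      have e1 := IsLoxodromic.le_dist (hlim x) (⌊t⌋₊ - ⌊s⌋₊)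
      have e2 := dist_pow_le g x (⌊t⌋₊ - ⌊s⌋₊)
      rw [Nat.cast_sub hfl] at e1 e2
      have f1 := Nat.floor_le hs
      have f2 := Nat.lt_floor_add_one s
      have f3 := Nat.floor_le (hs.trans hst)
      have f4 := Nat.lt_floor_add_one t
      have f0 : (0 : ℝ) ≤ (⌊t⌋₊ : ℝ) - ⌊s⌋₊ := by
        have : (⌊s⌋₊ : ℝ) ≤ ⌊t⌋₊ := by exact_mod_cast hfl
        linarith
      have hQ2 : Q⁻¹ ≤ 1 := inv_le_one_of_one_le₀ hQ1
      have hL0 : 0 ≤ L := dist_nonneg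
      constructor
      · have : Q⁻¹ * (t - s) ≤ Q⁻¹ * ((⌊t⌋₊ : ℝ) - ⌊s⌋₊ + 1) := by gcongr; linarith
        have : Q⁻¹ * ((⌊t⌋₊ : ℝ) - ⌊s⌋₊) ≤ τ * ((⌊t⌋₊ : ℝ) - ⌊s⌋₊) := by gcongr
        linarith
      · have : L * ((⌊t⌋₊ : ℝ) - ⌊s⌋₊) ≤ Q * (t - s + 1) := by
          gcongr; linarith
        linarith
    refine ⟨Q, Q + 1, hQ1, by linarith, fun s hs t ht => ?_⟩
    simp only [Set.mem_Ici] at hs ht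
    have hfl : ∀ r : ℝ, 0 ≤ r → ⌊r.toNNReal⌋₊ = ⌊r⌋₊ := fun r hr => by
      refine eq_of_forall_le_iff fun n => ?_
      rw [Nat.le_floor_iff zero_le, Nat.le_floor_iff hr, Real.le_toNNReal_iff_coe_le hr]
      simp
    simp only [hfl s hs, hfl t ht]
    rcases le_total s t with h | h
    · exact key s t hs h
    · rw [abs_sub_comm, dist_comm]
      exact key t s ht h⟩

/-- An element commuting with `g` displaces all orbit points equally. Allowing `g₀ ≠ g` covers both
ends of the axis: the ray of `g⁻¹` is fixed by `g` as well. -/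
lemma IsLoxodromic.mem_boundaryFixedPoints {g g₀ : G} (h : IsLoxodromic X g) (x : X)
    (hc : Commute g₀ g) : Quotient.mk (asymptoticSetoid X) (h.ray x) ∈ boundaryFixedPoints X g₀ := by
  refine Quotient.sound (s := asymptoticSetoid X) ?_
  have key : ∀ s : ℝ≥0, dist (g₀ • g ^ ⌊s⌋₊ • x) (g ^ ⌊s⌋₊ • x) ≤ dist (g₀ • x) x := fun s => by
    rw [← mul_smul, (hc.pow_right _).eq, mul_smul, dist_smul]
  exact ⟨dist (g₀ • x) x, fun s => ⟨s, key s⟩, fun s => ⟨s, key s⟩⟩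

/-- Two orbits with unbounded products fellow-travel: a given `g ^ i • x` lies on the common part of
the ways to some `g ^ n • x` and `h ^ n' • x`, and so does a point of the `h`-orbit at about the
same distance from `x`. -/
lemma exists_dist_close {g h : G} {x : X} {C : ℝ} (h4 : FourPoint X δ)
    (hg : ∀ i j : ℕ, gp x (g⁻¹ ^ i • x) (g ^ j • x) ≤ C)
    (hh : ∀ i j : ℕ, gp x (h⁻¹ ^ i • x) (h ^ j • x) ≤ C)
    (hub : ∀ R : ℝ, ∃ i j : ℕ, R < gp x (g ^ i • x) (h ^ j • x)) (i : ℕ) :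
    ∃ j : ℕ, dist (g ^ i • x) (h ^ j • x) ≤ 4 * dist x (h • x) + 2 * C + 4 * δ := by
  obtain ⟨n, n', hR⟩ := hub (dist x (g • x) * i + dist x (h • x))
  have hgi := dist_pow_le g x i
  have hin : i ≤ n := by
    by_contra! hlt
    have h1 := gp_le_left x (g ^ n • x) (h ^ n' • x)
    have h2 := dist_pow_le g x n
    have h3 : dist x (g • x) * n ≤ dist x (g • x) * i := by gcongr
    have h5 := dist_nonneg (x := x) (y := h • x)
    linarith
  have hex : ∃ j, dist x (g ^ i • x) ≤ dist x (h ^ j • x) := by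
    refine ⟨n', ?_⟩
    have h1 := gp_le_right x (g ^ n • x) (h ^ n' • x)
    have h5 := dist_nonneg (x := x) (y := h • x)
    linarith
  classical
  -- The first point of the `h`-orbit at least as far away as `g ^ i • x`; by minimality it
  -- overshoots by at most one step.
  set j := Nat.find hex with hj
  have hj1 : dist x (g ^ i • x) ≤ dist x (h ^ j • x) := Nat.find_spec hex
  have hjn : j ≤ n' := Nat.find_min' hex (by
    have h1 := gp_le_right x (g ^ n • x) (h ^ n' • x)
    have h5 := dist_nonneg (x := x) (y := h • x)
    linarith)
  have hj2 : dist x (h ^ j • x) ≤ dist x (g ^ i • x) + dist x (h • x) := by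
    rcases Nat.eq_zero_or_pos j with h0 | h0
    · rw [h0, pow_zero, one_smul, dist_self]; positivity
    · have h1 := Nat.find_min hex (m := j - 1) (by omega)
      have h2 := dist_pow_add_le h x (j - 1) 1
      rw [Nat.sub_add_cancel h0, pow_one] at h2
      linarith
  have aux : ∀ (f : G) (a b : ℕ), a ≤ b → (∀ i j : ℕ, gp x (f⁻¹ ^ i • x) (f ^ j • x) ≤ C) →
      dist x (f ^ a • x) - C ≤ gp x (f ^ a • x) (f ^ b • x) := by
    intro f a b hab hf
    rw [gp_base_swap, gp_smul_base, ← inv_pow, ← mul_smul]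
    have := hf a (b - a)
    rw [show f⁻¹ ^ a * f ^ b = f ^ (b - a) by
      rw [inv_pow, inv_mul_eq_iff_eq_mul, ← pow_add, Nat.add_sub_cancel' hab]]
    linarith
  have a1 := aux g i n hin hg
  have a2 := aux h j n' hjn hh
  have b1 := h4 x (g ^ i • x) (g ^ n • x) (h ^ n' • x)
  have b2 := h4 x (g ^ i • x) (h ^ n' • x) (h ^ j • x)
  rw [gp_comm x (h ^ n' • x)] at b2
  refine ⟨j, ?_⟩
  rw [dist_eq_gp x]
  have hC : 0 ≤ C := (gp_nonneg _ _ _).trans (hg 0 0)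
  have hδ : 0 ≤ δ := by have : Nonempty X := ⟨x⟩; exact h4.nonneg
  have h5 := dist_nonneg (x := x) (y := h • x)
  have c1 : dist x (g ^ i • x) - C - δ ≤ gp x (g ^ i • x) (h ^ n' • x) := by
    refine le_trans ?_ b1
    have := le_min a1 (show dist x (g ^ i • x) - C ≤ gp x (g ^ n • x) (h ^ n' • x) by linarith)
    linarith
  have c2 : dist x (g ^ i • x) - C - 2 * δ ≤ gp x (g ^ i • x) (h ^ j • x) := by
    refine le_trans ?_ b2
    have := le_min c1 (show dist x (g ^ i • x) - C - δ ≤ gp x (h ^ j • x) (h ^ n' • x) by linarith)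
    linarith
  linarith

/-- Loxodromic elements without common fixed points have transverse orbits. -/
lemma exists_gp_le_of_disjoint (h4 : FourPoint X δ) {g h g₀ h₀ : G}
    (hg : IsLoxodromic X g) (hh : IsLoxodromic X h) (hcg : Commute g₀ g) (hch : Commute h₀ h)
    (hd : Disjoint (boundaryFixedPoints X g₀) (boundaryFixedPoints X h₀)) (x : X) :
    ∃ C : ℝ, ∀ i j : ℕ, gp x (g ^ i • x) (h ^ j • x) ≤ C := by
  by_contra! hub
  have hδ : 0 ≤ δ := by have : Nonempty X := ⟨x⟩; exact h4.nonneg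
  obtain ⟨Cg, hCg⟩ := hg.exists_gp_le h4 hδ x
  obtain ⟨Ch, hCh⟩ := hh.exists_gp_le h4 hδ x
  have hCg' : ∀ i j : ℕ, gp x (g⁻¹ ^ i • x) (g ^ j • x) ≤ max Cg Ch :=
    fun i j => (hCg i j).trans (le_max_left _ _)
  have hCh' : ∀ i j : ℕ, gp x (h⁻¹ ^ i • x) (h ^ j • x) ≤ max Cg Ch :=
    fun i j => (hCh i j).trans (le_max_right _ _)
  have k1 := exists_dist_close h4 hCg' hCh' hub
  have k2 := exists_dist_close h4 hCh' hCg' (fun R => by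
    obtain ⟨i, j, hij⟩ := hub R
    exact ⟨j, i, by rwa [gp_comm]⟩)
  have hasy : Quotient.mk (asymptoticSetoid X) (hg.ray x) =
      Quotient.mk (asymptoticSetoid X) (hh.ray x) := by
    refine Quotient.sound (s := asymptoticSetoid X) ?_
    refine ⟨4 * dist x (g • x) + 4 * dist x (h • x) + 2 * max Cg Ch + 4 * δ, fun s => ?_,
      fun t => ?_⟩
    · obtain ⟨j, hj⟩ := k1 ⌊s⌋₊
      refine ⟨(j : ℝ≥0), ?_⟩
      have : dist (g ^ ⌊s⌋₊ • x) (h ^ ⌊(j : ℝ≥0)⌋₊ • x) ≤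
          4 * dist x (h • x) + 2 * max Cg Ch + 4 * δ := by
        rw [Nat.floor_natCast]; exact hj
      have h5 := dist_nonneg (x := x) (y := g • x)
      exact this.trans (by linarith)
    · obtain ⟨j, hj⟩ := k2 ⌊t⌋₊
      refine ⟨(j : ℝ≥0), ?_⟩
      have : dist (g ^ ⌊(j : ℝ≥0)⌋₊ • x) (h ^ ⌊t⌋₊ • x) ≤
          4 * dist x (g • x) + 2 * max Cg Ch + 4 * δ := by
        rw [Nat.floor_natCast, dist_comm]; exact hj
      have h5 := dist_nonneg (x := x) (y := h • x)
      exact this.trans (by linarith)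
  refine Set.disjoint_left.1 hd (hg.mem_boundaryFixedPoints x hcg) ?_
  rw [hasy]
  exact hh.mem_boundaryFixedPoints x hch

end Boundary

/-! ### Eight pairwise transverse words of comparable length. -/

section Schottky

variable {G : Type*} [Group G] {X : Type*} [MetricSpace X] [MulAction G X] [IsIsometricSMul G X]
  {δ : ℝ}

/-- Two long elements whose four directions are pairwise transverse. -/
structure IsTransversePair (x : X) (C D : ℝ) (a b : G) : Prop where
  left : gp x (a⁻¹ • x) (a • x) ≤ C
  right : gp x (b⁻¹ • x) (b • x) ≤ C
  inv_left : gp x (a⁻¹ • x) (b • x) ≤ C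
  inv_right : gp x (b⁻¹ • x) (a • x) ≤ C
  pos : gp x (a • x) (b • x) ≤ C
  neg : gp x (a⁻¹ • x) (b⁻¹ • x) ≤ C
  long_left : D ≤ dist x (a • x)
  long_right : D ≤ dist x (b • x)

lemma IsTransversePair.inv {x : X} {C D : ℝ} {a b : G} (h : IsTransversePair x C D a b) :
    IsTransversePair x C D a⁻¹ b⁻¹ where
  left := by rw [inv_inv, gp_comm]; exact h.left
  right := by rw [inv_inv, gp_comm]; exact h.right
  inv_left := by rw [inv_inv, gp_comm]; exact h.inv_right
  inv_right := by rw [inv_inv, gp_comm]; exact h.inv_left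
  pos := h.neg
  neg := by rw [inv_inv, inv_inv]; exact h.pos
  long_left := by rw [dist_inv_smul_self]; exact h.long_left
  long_right := by rw [dist_inv_smul_self]; exact h.long_right

lemma IsTransversePair.isLocalGeodesic {x : X} {C D : ℝ} {a b : G}
    (h : IsTransversePair x C D a b) {l : List G} (hl : ∀ g ∈ l, g = a ∨ g = b) :
    IsLocalGeodesic x C D l := by
  refine ⟨fun g hg => ?_, (List.pairwise_of_forall_mem_list fun u hu v hv => ?_).isChain⟩
  · rcases hl g hg with rfl | rfl
    exacts [h.long_left, h.long_right]
  · rcases hl u hu with rfl | rfl <;> rcases hl v hv with rfl | rfl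
    exacts [h.left, h.inv_left, h.inv_right, h.right]

/-- The word `a ^ i * b ^ q * a ^ i` in the letters `a` and `b`. -/
def palindrome (a b : G) (i q : ℕ) : List G :=
  List.replicate i a ++ (List.replicate q b ++ List.replicate i a)

lemma palindrome_prod (a b : G) (i q : ℕ) :
    (palindrome a b i q).prod = a ^ i * (b ^ q * a ^ i) := by
  simp [palindrome]

lemma mem_palindrome {a b : G} {i q : ℕ} {g : G} (h : g ∈ palindrome a b i q) : g = a ∨ g = b := by
  simp only [palindrome, List.mem_append, List.mem_replicate] at h
  tauto

/-- After the common prefix `a ^ i` one word continues with `b` (as `q > 0`) and the other with `a`.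
Based at `a ^ i • x` the product is thus small, and moving the base back to `x` costs the
displacement of `a ^ i`. -/
lemma IsTransversePair.gp_palindrome_le (h4 : FourPoint X δ) (hδ : 0 ≤ δ) {x : X} {C D : ℝ}
    (hCD : 2 * C + 3 * δ < D) {a b : G} (h : IsTransversePair x C D a b) {i j q q' : ℕ}
    (hij : i < j) (hq : 0 < q) :
    gp x ((palindrome a b i q).prod • x) ((palindrome a b j q').prod • x) ≤
      C + 2 * δ + dist x (a • x) * i := by
  have hC : 0 ≤ C := (gp_nonneg _ _ _).trans h.left
  set l₁ := List.replicate (q - 1) b ++ List.replicate i a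
  set l₂ := List.replicate (j - i - 1) a ++ (List.replicate q' b ++ List.replicate j a)
  have e1 : (palindrome a b i q).prod = a ^ i * (b :: l₁).prod := by
    simp only [palindrome_prod, l₁, List.prod_cons, List.prod_append, List.prod_replicate]
    rw [← mul_assoc b, ← pow_succ', Nat.sub_add_cancel hq]
  have e2 : (palindrome a b j q').prod = a ^ i * (a :: l₂).prod := by
    simp only [palindrome_prod, l₂, List.prod_cons, List.prod_append, List.prod_replicate]
    rw [← mul_assoc a, ← pow_succ', ← mul_assoc (a ^ i), ← pow_add]
    congr 2; omega
  have h1 : IsLocalGeodesic x C D (b :: l₁) := h.isLocalGeodesic fun g hg => by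
    simp only [l₁, List.mem_cons, List.mem_append, List.mem_replicate] at hg; tauto
  have h2 : IsLocalGeodesic x C D (a :: l₂) := h.isLocalGeodesic fun g hg => by
    simp only [l₂, List.mem_cons, List.mem_append, List.mem_replicate] at hg; tauto
  have h3 := h1.le_gp_cons h4 hδ hC (by linarith)
  have h5 := h2.le_gp_cons h4 hδ hC (by linarith)
  have h6 : gp x (a • x) ((b :: l₁).prod • x) ≤ C + δ := h4.gp_le h.pos (by linarith)
  rw [gp_comm] at h6
  have h7 := h4.gp_le h6 (c := (a :: l₂).prod • x) (by linarith)
  rw [e1, e2, mul_smul, mul_smul]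
  have h8 := gp_smul_base (a ^ i)⁻¹ x ((b :: l₁).prod • x) ((a :: l₂).prod • x)
  rw [inv_inv] at h8
  rw [← h8]
  have h9 := gp_le_add_dist_base ((a ^ i)⁻¹ • x) x ((b :: l₁).prod • x) ((a :: l₂).prod • x)
  rw [dist_comm, dist_inv_smul_self] at h9
  linarith [dist_pow_le a x i]

/-- The reason for palindromes: inverses are words of the same shape, so separation of the words
gives separation of their inverses. -/
lemma palindrome_prod_inv (a b : G) (i q : ℕ) :
    (palindrome a b i q).prod⁻¹ = (palindrome a⁻¹ b⁻¹ i q).prod := by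
  simp [palindrome_prod, mul_assoc]

/-- A finite family of group elements whose directions are pairwise transverse and whose lengths
are comparable and much larger than their Gromov products. -/
structure IsSchottky (x : X) (δ C E : ℝ) (s : Fin 8 → G) : Prop where
  nonneg : 0 ≤ C
  one_le : 1 ≤ E
  sep : ∀ i j, i ≠ j → gp x (s i • x) (s j • x) ≤ C
  sep_inv : ∀ i j, i ≠ j → gp x ((s i)⁻¹ • x) ((s j)⁻¹ • x) ≤ C
  long : ∀ i, E + 4 * C + 6 * δ ≤ dist x (s i • x)
  short : ∀ i, dist x (s i • x) ≤ 2 * E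

/-- The exponent `T + 2 * (8 - i)` gives all words the same number `T + 16` of letters. A large `T`
makes `b` dominate, so that all lengths agree up to a factor below two. -/
lemma IsTransversePair.exists_isSchottky (h4 : FourPoint X δ) (hδ : 0 ≤ δ) {x : X} {C D : ℝ}
    (hD : 0 < D) (hCD : 8 * (C + δ) ≤ D) {a b : G} (h : IsTransversePair x C D a b) :
    ∃ (T : ℕ) (C' E : ℝ),
      IsSchottky x δ C' E fun i => (palindrome a b i (T + 2 * (8 - i))).prod := by
  have hC : 0 ≤ C := (gp_nonneg _ _ _).trans h.left
  set α := dist x (a • x)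
  set β := dist x (b • x)
  have hα : 0 ≤ α := dist_nonneg
  have hβ : D ≤ β := h.long_right
  have hCD' : 2 * C + 3 * δ < D := by linarith
  set C' := C + 2 * δ + α * 8
  obtain ⟨T, hT⟩ := exists_nat_ge ((32 * α + 32 * β + 16 * C' + 24 * δ + 2) / D)
  rw [div_le_iff₀ hD] at hT
  have hTβ : (T : ℝ) * D ≤ T * β := by gcongr
  have sepLt : ∀ {a b : G}, IsTransversePair x C D a b → dist x (a • x) = α → ∀ i j : Fin 8, i < j →
      gp x ((palindrome a b i (T + 2 * (8 - i))).prod • x)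
        ((palindrome a b j (T + 2 * (8 - j))).prod • x) ≤ C' := by
    intro a b hab e i j hij
    refine (hab.gp_palindrome_le h4 hδ hCD' hij (by omega)).trans ?_
    rw [e]
    have : ((i : ℕ) : ℝ) ≤ 8 := by exact_mod_cast (by omega : (i : ℕ) ≤ 8)
    have := mul_le_mul_of_nonneg_left this hα
    simp only [C']; linarith
  have sepNe : ∀ {a b : G}, IsTransversePair x C D a b → dist x (a • x) = α → ∀ i j : Fin 8, i ≠ j →
      gp x ((palindrome a b i (T + 2 * (8 - i))).prod • x)
        ((palindrome a b j (T + 2 * (8 - j))).prod • x) ≤ C' := by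
    intro a b hab e i j hij
    rcases lt_or_gt_of_ne hij with h | h
    · exact sepLt hab e i j h
    · rw [gp_comm]; exact sepLt hab e j i h
  -- `E` is chosen so that `E + 4 * C' + 6 * δ = 3 / 4 * T * β`, a lower bound for the lengths
  -- because `2 * C + 2 * δ ≤ β / 4`. The size of `T` makes `2 * E` exceed the upper bound `(T + 16)
  -- * β + 16 * α`.
  refine ⟨T, C', 3 / 4 * T * β - 4 * C' - 6 * δ, ⟨by positivity, ?_, ?_, ?_, ?_, ?_⟩⟩
  · linarith
  · exact fun i j hij => sepNe h rfl i j hij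
  · intro i j hij
    rw [palindrome_prod_inv, palindrome_prod_inv]
    exact sepNe h.inv (dist_inv_smul_self a x) i j hij
  · intro i
    have h1 := (h.isLocalGeodesic (l := palindrome a b i (T + 2 * (8 - i)))
      fun g hg => mem_palindrome hg).sum_le_dist h4 hδ hC (by linarith)
    refine le_trans ?_ h1
    simp only [palindrome, List.map_append, List.map_replicate, List.sum_append,
      List.sum_replicate, nsmul_eq_mul]
    have e1 : 0 ≤ α - (2 * C + 2 * δ) := by linarith [h.long_left]
    have e2 : 3 / 4 * β ≤ β - (2 * C + 2 * δ) := by linarith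
    have e3 : (T : ℝ) * (3 / 4 * β) ≤ ((T + 2 * (8 - i) : ℕ) : ℝ) * (β - (2 * C + 2 * δ)) := by
      refine mul_le_mul ?_ e2 (by linarith) (by positivity)
      exact_mod_cast Nat.le_add_right _ _
    have e4 : 0 ≤ ((i : ℕ) : ℝ) * (α - (2 * C + 2 * δ)) := by positivity
    linarith
  · intro i
    rw [palindrome_prod]
    have k1 : ∀ u v : G, dist x ((u * v) • x) ≤ dist x (u • x) + dist x (v • x) := fun u v => by
      have := dist_triangle x (u • x) ((u * v) • x)
      rwa [mul_smul, dist_smul, ← mul_smul] at this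
    have h1 := k1 (a ^ (i : ℕ)) (b ^ (T + 2 * (8 - i : ℕ)) * a ^ (i : ℕ))
    have h2 := k1 (b ^ (T + 2 * (8 - i : ℕ))) (a ^ (i : ℕ))
    have h3 := dist_pow_le a x i
    have h5 := dist_pow_le b x (T + 2 * (8 - i : ℕ))
    have h6 : ((i : ℕ) : ℝ) ≤ 8 := by exact_mod_cast (by omega : (i : ℕ) ≤ 8)
    have h7 := mul_le_mul_of_nonneg_left h6 hα
    have h8 : ((T + 2 * (8 - i : ℕ) : ℕ) : ℝ) ≤ T + 16 := by
      exact_mod_cast (by omega : T + 2 * (8 - i : ℕ) ≤ T + 16)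
    have h9 := mul_le_mul_of_nonneg_left h8 (hD.le.trans hβ)
    linarith

/-- The point `y` can be aligned with at most one of the transverse directions `s i • x`, and `z`
with at most one of the `(s i)⁻¹ • x`. -/
lemma IsSchottky.card_bad_le (h4 : FourPoint X δ) {x : X} {C E : ℝ} {s : Fin 8 → G}
    (h : IsSchottky x δ C E s) (y z : X) :
    (Finset.univ.filter fun i => ¬ (gp x y (s i • x) ≤ C + δ ∧
      gp x ((s i)⁻¹ • x) z ≤ C + δ)).card ≤ 2 := by
  classical
  have aux : ∀ (p : Fin 8 → X) (y : X), (∀ i j, i ≠ j → gp x (p i) (p j) ≤ C) →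
      (Finset.univ.filter fun i => ¬ gp x y (p i) ≤ C + δ).card ≤ 1 := by
    intro p y hp
    rw [Finset.card_le_one]
    intro i hi j hj
    simp only [Finset.mem_filter, Finset.mem_univ, true_and, not_le] at hi hj
    by_contra hij
    have h1 := h4 x (p i) y (p j)
    rw [gp_comm x (p i) y] at h1
    have := lt_min hi hj
    linarith [hp i j hij]
  have h1 := aux (fun i => s i • x) y h.sep
  have h2 := aux (fun i => (s i)⁻¹ • x) z h.sep_inv
  refine (Finset.card_le_card ?_).trans ((Finset.card_union_le _ _).trans (add_le_add h1 h2))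
  intro i hi
  simp only [Finset.mem_filter, Finset.mem_univ, true_and, Finset.mem_union, not_and_or] at hi ⊢
  rwa [gp_comm x z]

/-- For a good index the long letter decides the direction: `(s i)⁻¹ • y` looks like `(s i)⁻¹ • x`
from `x`, and the latter is transverse to `z`. -/
lemma IsSchottky.gp_le (h4 : FourPoint X δ) (hδ : 0 ≤ δ) {x : X} {C E : ℝ} {s : Fin 8 → G}
    (h : IsSchottky x δ C E s) {y z : X} {i : Fin 8} (h1 : gp x y (s i • x) ≤ C + δ)
    (h2 : gp x ((s i)⁻¹ • x) z ≤ C + δ) : gp x ((s i)⁻¹ • y) z ≤ C + 2 * δ := by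
  rw [gp_comm] at h2 ⊢
  have h3 : C + δ + δ < gp x ((s i)⁻¹ • x) ((s i)⁻¹ • y) := by
    rw [gp_base_swap, dist_inv_smul_self]
    rw [gp_smul_base, inv_inv, smul_inv_smul, gp_comm]
    linarith [h.long i, h.one_le, h.nonneg]
  linarith [h4.gp_le h2 h3]

end Schottky

/-! ### Schottky words spelled by the support of the measure. -/

section Existence

variable {G : Type*} [Group G] {X : Type*} [MetricSpace X] [MulAction G X] [IsIsometricSMul G X]
  {δ : ℝ}

lemma exists_list_of_mem_generatedSemigroup {μ : PMF G} {g : G}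
    (h : g ∈ generatedSemigroup μ) :
    ∃ l : List G, l ≠ [] ∧ (∀ a ∈ l, a ∈ μ.support) ∧ l.prod = g := by
  induction h using Subsemigroup.closure_induction with
  | mem g hg => exact ⟨[g], by simp, by simpa using hg, by simp⟩
  | mul a b _ _ iha ihb =>
    obtain ⟨l, hl, hs, rfl⟩ := iha
    obtain ⟨l', hl', hs', rfl⟩ := ihb
    exact ⟨l ++ l', by simp [hl], by simpa [or_imp, forall_and] using ⟨hs, hs'⟩, by simp⟩

/-- The `n`-fold concatenation of a word. -/
def listPow (l : List G) (n : ℕ) : List G := (List.replicate n l).flatten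

lemma listPow_prod (l : List G) (n : ℕ) : (listPow l n).prod = l.prod ^ n := by
  simp [listPow, List.prod_flatten]

lemma listPow_length (l : List G) (n : ℕ) : (listPow l n).length = n * l.length := by
  simp [listPow]

lemma mem_listPow {l : List G} {n : ℕ} {g : G} (h : g ∈ listPow l n) : g ∈ l := by
  simp only [listPow, List.mem_flatten, List.mem_replicate] at h
  obtain ⟨l', ⟨-, rfl⟩, hg⟩ := h
  exact hg

lemma IsNonElementary.exists_isSchottky (h4 : FourPoint X δ) (hδ : 0 ≤ δ) {μ : PMF G}
    (h : IsNonElementary X μ) (x : X) :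
    ∃ (m : ℕ) (C E : ℝ) (word : Fin 8 → List G), 0 < m ∧ (∀ i, (word i).length = m) ∧
      (∀ i, ∀ g ∈ word i, g ∈ μ.support) ∧ IsSchottky x δ C E fun i => (word i).prod := by
  obtain ⟨g, hg, h, hh, lg, lh, hd⟩ := h
  obtain ⟨A, hA0, hA, rfl⟩ := exists_list_of_mem_generatedSemigroup hg
  obtain ⟨B, hB0, hB, rfl⟩ := exists_list_of_mem_generatedSemigroup hh
  set g := A.prod
  set h := B.prod
  have cg : Commute g g⁻¹ := Commute.inv_right rfl
  have ch : Commute h h⁻¹ := Commute.inv_right rfl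
  obtain ⟨C₁, hC₁⟩ := lg.exists_gp_le h4 hδ x
  obtain ⟨C₂, hC₂⟩ := lh.exists_gp_le h4 hδ x
  obtain ⟨C₃, hC₃⟩ := exists_gp_le_of_disjoint h4 lg.inv lh cg rfl hd x
  obtain ⟨C₄, hC₄⟩ := exists_gp_le_of_disjoint h4 lg lh.inv rfl ch hd x
  obtain ⟨C₅, hC₅⟩ := exists_gp_le_of_disjoint h4 lg lh rfl rfl hd x
  obtain ⟨C₆, hC₆⟩ := exists_gp_le_of_disjoint h4 lg.inv lh.inv cg ch hd x
  obtain ⟨C, hC⟩ : ∃ C, C₁ ≤ C ∧ C₂ ≤ C ∧ C₃ ≤ C ∧ C₄ ≤ C ∧ C₅ ≤ C ∧ C₆ ≤ C := by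
    obtain ⟨C, hC⟩ := ({C₁, C₂, C₃, C₄, C₅, C₆} : Finset ℝ).exists_le
    exact ⟨C, hC _ (by simp), hC _ (by simp), hC _ (by simp), hC _ (by simp), hC _ (by simp),
      hC _ (by simp)⟩
  obtain ⟨c1, c2, c3, c4, c5, c6⟩ := hC
  have hC0 : 0 ≤ C := (gp_nonneg _ _ _).trans ((hC₁ 0 0).trans c1)
  obtain ⟨τ, hτ, hτlim⟩ := lg
  obtain ⟨σ, hσ, hσlim⟩ := lh
  set D := 8 * (C + δ) + 1
  have hA1 : 1 ≤ A.length := List.length_pos_iff.2 hA0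
  have hB1 : 1 ≤ B.length := List.length_pos_iff.2 hB0
  obtain ⟨p, hp⟩ := exists_nat_ge (max 1 (max (D / τ) (D / σ)))
  rw [max_le_iff, max_le_iff, div_le_iff₀ hτ, div_le_iff₀ hσ] at hp
  obtain ⟨hp1, hp2, hp3⟩ := hp
  have hp1 : 1 ≤ p := by exact_mod_cast hp1
  have hlong : ∀ (f : G) (ρ : ℝ) (k : ℕ), 0 < ρ → D ≤ p * ρ → p ≤ k →
      (∀ y : X, Tendsto (fun n : ℕ => dist (f ^ n • y) y / (n : ℝ)) atTop (𝓝 ρ)) →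
      D ≤ dist x (f ^ k • x) := by
    intro f ρ k hρ hD hk hlim
    refine le_trans ?_ (IsLoxodromic.le_dist (hlim x) k)
    have : (p : ℝ) * ρ ≤ k * ρ := by gcongr
    linarith
  -- The exponents are multiplied by the length of the other word, so that both powers are spelled
  -- with the same number of steps; all eight words then have a common length.
  have hpair : IsTransversePair x C D (g ^ (p * B.length)) (h ^ (p * A.length)) := by
    refine ⟨?_, ?_, ?_, ?_, ?_, ?_, ?_, ?_⟩
    · rw [← inv_pow]; exact (hC₁ _ _).trans c1
    · rw [← inv_pow]; exact (hC₂ _ _).trans c2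
    · rw [← inv_pow]; exact (hC₃ _ _).trans c3
    · rw [← inv_pow, gp_comm]; exact (hC₄ _ _).trans c4
    · exact (hC₅ _ _).trans c5
    · rw [← inv_pow, ← inv_pow]; exact (hC₆ _ _).trans c6
    · exact hlong g τ _ hτ hp2 (Nat.le_mul_of_pos_right _ hB1) hτlim
    · exact hlong h σ _ hσ hp3 (Nat.le_mul_of_pos_right _ hA1) hσlim
  obtain ⟨T, C', E, hS⟩ := hpair.exists_isSchottky h4 hδ (by positivity) (by simp [D])
  set a := listPow A (p * B.length)
  set b := listPow B (p * A.length)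
  have hab : b.length = a.length := by
    simp only [a, b, listPow_length]; ring
  refine ⟨(T + 16) * a.length, C', E, fun i => listPow a i ++
    (listPow b (T + 2 * (8 - i)) ++ listPow a i), ?_, fun i => ?_, fun i g hg => ?_, ?_⟩
  · simp only [a, listPow_length]
    positivity
  · simp only [List.length_append, listPow_length b, listPow_length a, hab]
    have : (i : ℕ) + (T + 2 * (8 - i) + i) = T + 16 := by omega
    rw [← this]; ring
  · simp only [List.mem_append] at hg
    rcases hg with hg | hg | hg
    · exact hA _ (mem_listPow (mem_listPow hg))
    · exact hB _ (mem_listPow (mem_listPow hg))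
    · exact hA _ (mem_listPow (mem_listPow hg))
  · convert hS using 2 with i
    rw [palindrome_prod]
    simp only [List.prod_append, listPow_prod, a, b, g, h]

lemma HasBoundedSupport.exists_dist_le {μ : PMF G} (h : HasBoundedSupport X μ) (x : X) :
    ∃ L : ℝ, 1 ≤ L ∧ ∀ g ∈ μ.support, dist x (g • x) ≤ L := by
  obtain ⟨y, hy⟩ := h
  obtain ⟨R, hR⟩ := (hy.subset_closedBall y)
  refine ⟨max 1 (2 * dist x y + R), le_max_left _ _, fun g hg => le_max_of_le_right ?_⟩
  have h1 : dist (g • y) y ≤ R := hR ⟨g, hg, rfl⟩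
  have h2 := dist_triangle4 x y (g • y) (g • x)
  rw [dist_smul, dist_comm y (g • y), dist_comm y x] at h2
  linarith

end Existence

/-! ### Expectations over finite words as iterated sums. -/

section Expectation

open scoped ENNReal

variable {G : Type*}

/-- The expectation of a function of the first `n` steps of the walk. -/
noncomputable def Ex (μ : PMF G) : ℕ → (List G → ℝ≥0∞) → ℝ≥0∞
  | 0, F => F []
  | n + 1, F => ∑' g, μ g * Ex μ n fun l => F (g :: l)

variable {μ : PMF G}

lemma Ex_mono {n : ℕ} {F F' : List G → ℝ≥0∞}
    (h : ∀ l : List G, l.length = n → (∀ g ∈ l, g ∈ μ.support) → F l ≤ F' l) :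
    Ex μ n F ≤ Ex μ n F' := by
  induction n generalizing F F' with
  | zero => exact h [] rfl (by simp)
  | succ n ih =>
    refine ENNReal.tsum_le_tsum fun g => ?_
    by_cases hg : g ∈ μ.support
    · gcongr
      exact ih fun l hl hs => h (g :: l) (by simp [hl]) (by simpa using ⟨hg, hs⟩)
    · rw [PMF.apply_eq_zero_iff μ g |>.2 hg]; simp

lemma Ex_congr {n : ℕ} {F F' : List G → ℝ≥0∞} (h : ∀ l : List G, l.length = n → F l = F' l) :
    Ex μ n F = Ex μ n F' :=
  le_antisymm (Ex_mono fun l hl _ => (h l hl).le) (Ex_mono fun l hl _ => (h l hl).ge)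

lemma Ex_const (n : ℕ) (c : ℝ≥0∞) : Ex μ n (fun _ => c) = c := by
  induction n with
  | zero => rfl
  | succ n ih => simp only [Ex, ih, ENNReal.tsum_mul_right, μ.tsum_coe, one_mul]

lemma Ex_add (n : ℕ) (F F' : List G → ℝ≥0∞) :
    Ex μ n (fun l => F l + F' l) = Ex μ n F + Ex μ n F' := by
  induction n generalizing F F' with
  | zero => rfl
  | succ n ih => simp only [Ex, ih, mul_add, ENNReal.tsum_add]

lemma Ex_const_mul (n : ℕ) (c : ℝ≥0∞) (F : List G → ℝ≥0∞) :
    Ex μ n (fun l => c * F l) = c * Ex μ n F := by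
  induction n generalizing F with
  | zero => rfl
  | succ n ih => simp only [Ex, ih, mul_left_comm _ c, ENNReal.tsum_mul_left]

lemma Ex_mul_const (n : ℕ) (c : ℝ≥0∞) (F : List G → ℝ≥0∞) :
    Ex μ n (fun l => F l * c) = Ex μ n F * c := by
  simp only [mul_comm _ c, Ex_const_mul]

lemma Ex_tsum {ι : Type*} (n : ℕ) (F : ι → List G → ℝ≥0∞) :
    Ex μ n (fun l => ∑' i, F i l) = ∑' i, Ex μ n (F i) := by
  induction n generalizing F with
  | zero => rfl
  | succ n ih =>
    simp only [Ex, ih, ← ENNReal.tsum_mul_left]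
    exact ENNReal.tsum_comm

lemma Ex_append (m n : ℕ) (F : List G → ℝ≥0∞) :
    Ex μ (m + n) F = Ex μ m fun l => Ex μ n fun l' => F (l ++ l') := by
  induction m generalizing F with
  | zero => simp [Ex]
  | succ m ih => 
    rw [show m + 1 + n = (m + n) + 1 by omega]
    simp only [Ex, ih, List.cons_append]

lemma Ex_take {m n : ℕ} (h : m ≤ n) (F : List G → ℝ≥0∞) :
    Ex μ n (fun l => F (l.take m)) = Ex μ m F := by
  obtain ⟨k, rfl⟩ := Nat.exists_eq_add_of_le h
  rw [Ex_append]
  refine Ex_congr fun l hl => ?_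
  simp only [← hl, List.take_left, Ex_const]

lemma Ex_drop {m n : ℕ} (h : m ≤ n) (F : List G → ℝ≥0∞) :
    Ex μ n (fun l => F (l.drop m)) = Ex μ (n - m) F := by
  obtain ⟨k, rfl⟩ := Nat.exists_eq_add_of_le h
  rw [Ex_append, Nat.add_sub_cancel_left, ← Ex_const m (Ex μ k F)]
  refine Ex_congr fun l hl => ?_
  simp only [← hl, List.drop_left]

/-- The probability that the first `n` steps of the walk form a word in `S`. -/
noncomputable def Pr (μ : PMF G) (n : ℕ) (S : Set (List G)) : ℝ≥0∞ := Ex μ n (S.indicator 1)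

lemma Pr_mono {n : ℕ} {S T : Set (List G)}
    (h : ∀ l : List G, l.length = n → (∀ g ∈ l, g ∈ μ.support) → l ∈ S → l ∈ T) :
    Pr μ n S ≤ Pr μ n T := by
  refine Ex_mono fun l hl hs => ?_
  by_cases hS : l ∈ S
  · simp [hS, h l hl hs hS]
  · simp [hS]

lemma Pr_le_one (n : ℕ) (S : Set (List G)) : Pr μ n S ≤ 1 := by
  rw [← Ex_const (μ := μ) n 1]
  exact Ex_mono fun l _ _ => Set.indicator_le_self' (by simp) l

lemma Pr_union_le (n : ℕ) (S T : Set (List G)) : Pr μ n (S ∪ T) ≤ Pr μ n S + Pr μ n T := by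
  rw [Pr, Pr, Pr, ← Ex_add]
  refine Ex_mono fun l _ _ => ?_
  by_cases hS : l ∈ S <;> by_cases hT : l ∈ T <;> simp [hS, hT]

lemma Pr_add_compl (n : ℕ) (S : Set (List G)) : Pr μ n S + Pr μ n Sᶜ = 1 := by
  rw [Pr, Pr, ← Ex_add, ← Ex_const (μ := μ) n 1]
  refine Ex_congr fun l _ => ?_
  by_cases hS : l ∈ S <;> simp [hS]

lemma Pr_biUnion_le {ι : Type*} (s : Finset ι) (n : ℕ) (S : ι → Set (List G)) :
    Pr μ n (⋃ i ∈ s, S i) ≤ ∑ i ∈ s, Pr μ n (S i) := by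
  classical
  induction s using Finset.induction_on with
  | empty => simp [Pr, Ex_const]
  | insert a s ha ih =>
    rw [Finset.set_biUnion_insert, Finset.sum_insert ha]
    exact (Pr_union_le _ _ _).trans (by gcongr)

lemma Pr_append (m n : ℕ) (S : Set (List G)) :
    Pr μ (m + n) S = Ex μ m fun l => Pr μ n {l' | l ++ l' ∈ S} := by
  rw [Pr, Ex_append]; rfl

lemma Pr_take {m n : ℕ} (h : m ≤ n) (S : Set (List G)) :
    Pr μ n {l | l.take m ∈ S} = Pr μ m S :=
  Ex_take h (S.indicator 1)

lemma Pr_drop {m n : ℕ} (h : m ≤ n) (S : Set (List G)) :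
    Pr μ n {l | l.drop m ∈ S} = Pr μ (n - m) S :=
  Ex_drop h (S.indicator 1)

/-- A word in the support of `μ` has positive probability. -/
lemma Pr_singleton_pos {l : List G} (h : ∀ g ∈ l, g ∈ μ.support) : 0 < Pr μ l.length {l} := by
  induction l with
  | nil => simp [Pr, Ex]
  | cons g l ih =>
    have h1 := ih fun a ha => h a (List.mem_cons_of_mem _ ha)
    have h2 : 0 < μ g := pos_iff_ne_zero.2 ((μ.mem_support_iff g).1 (h g (by simp)))
    refine lt_of_lt_of_le (ENNReal.mul_pos h2.ne' h1.ne') ?_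
    refine le_trans (le_of_eq ?_) (ENNReal.le_tsum g)
    refine congrArg (μ g * ·) (Ex_congr fun l' _ => ?_)
    by_cases hl : l' = l <;> simp [hl]

end Expectation

/-! ### Comparison with the infinite product measure. -/

section PathMeasure

open scoped ENNReal

variable {G : Type*} [Group G] {μ : PMF G}

lemma walk_eq_prod (ω : ℕ → G) (n : ℕ) : walk ω n = ((List.range' 0 n).map ω).prod := by
  rw [← List.range_eq_range']
  induction n with
  | zero => rfl
  | succ n ih => simp [walk, ih, List.range_succ]

/-- The sequences of steps which start with the first `k` terms of `η`. -/
def cyl (η : ℕ → G) (k : ℕ) : Set (ℕ → G) := {ω | ∀ i < k, ω i = η i}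

lemma stepMeasure_cyl (η : ℕ → G) (k : ℕ) :
    stepMeasure μ (cyl η k) = ∏ i ∈ Finset.range k, μ (η i) := by
  let _ : MeasurableSpace G := ⊤
  have : cyl η k = Set.pi (Finset.range k) fun i => {η i} := by
    ext ω; simp [cyl, Set.mem_pi]
  rw [this, stepMeasure, Measure.infinitePi_pi _ (fun _ _ => MeasurableSpace.measurableSet_top)]
  exact Finset.prod_congr rfl fun i _ => μ.toMeasure_apply_singleton _ MeasurableSpace.measurableSet_top

lemma stepMeasure_notMem_support (k : ℕ) : stepMeasure μ {ω | ω k ∉ μ.support} = 0 := by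
  let _ : MeasurableSpace G := ⊤
  have : {ω : ℕ → G | ω k ∉ μ.support} =
      Set.pi ({k} : Finset ℕ) fun _ => (μ.support)ᶜ := by
    ext ω; simp
  rw [this, stepMeasure, Measure.infinitePi_pi _ (fun _ _ => MeasurableSpace.measurableSet_top),
    Finset.prod_singleton,
    PMF.toMeasure_apply_eq_zero_iff _ MeasurableSpace.measurableSet_top]
  exact disjoint_compl_right

/-- Steps are revealed one at a time. Only countable subadditivity over the support is used, so `S`
needs no measurability; an upper bound for bad events is enough. -/
lemma stepMeasure_cyl_inter_le (n : ℕ) (η : ℕ → G) (k : ℕ) (S : Set (List G)) :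
    stepMeasure μ (cyl η k ∩ {ω | (List.range' k n).map ω ∈ S}) ≤
      (∏ i ∈ Finset.range k, μ (η i)) * Pr μ n S := by
  induction n generalizing η k S with
  | zero =>
    rw [← stepMeasure_cyl]
    by_cases h : [] ∈ S <;> simp [Pr, Ex, h]
  | succ n ih =>
    have hsub : cyl η k ∩ {ω | (List.range' k (n + 1)).map ω ∈ S} ⊆
        {ω | ω k ∉ μ.support} ∪ ⋃ g : μ.support, (cyl (Function.update η k g) (k + 1) ∩
          {ω | (List.range' (k + 1) n).map ω ∈ {l | (g : G) :: l ∈ S}}) := by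
      rintro ω ⟨h1, h2⟩
      by_cases hk : ω k ∈ μ.support
      · refine Or.inr (Set.mem_iUnion.2 ⟨⟨ω k, hk⟩, fun i hi => ?_, ?_⟩)
        · rcases Nat.lt_succ_iff_lt_or_eq.1 hi with h | rfl
          · rw [Function.update_of_ne h.ne]; exact h1 i h
          · simp
        · simpa [List.range'_succ] using h2
      · exact Or.inl hk
    have : Countable μ.support := μ.support_countable
    calc _ ≤ _ := measure_mono hsub
      _ ≤ _ := measure_union_le _ _
      _ ≤ 0 + ∑' g : μ.support, _ :=
        add_le_add (stepMeasure_notMem_support k).le (measure_iUnion_le _)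
      _ ≤ ∑' g : μ.support, (∏ i ∈ Finset.range k, μ (η i)) *
          (μ g * Pr μ n {l | (g : G) :: l ∈ S}) := by
        rw [zero_add]
        refine ENNReal.tsum_le_tsum fun g => (ih _ _ _).trans (le_of_eq ?_)
        rw [Finset.prod_range_succ, Function.update_self, mul_assoc]
        congr 1
        refine Finset.prod_congr rfl fun i hi => ?_
        rw [Function.update_of_ne (Finset.mem_range.1 hi).ne]
      _ ≤ _ := by
        rw [ENNReal.tsum_mul_left]
        gcongr
        exact ENNReal.tsum_comp_le_tsum_of_injective Subtype.val_injective
          (fun g => μ g * Pr μ n {l | g :: l ∈ S})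

/-- Lower bounds for the law of the walk follow from upper bounds for the complement. -/
lemma le_walkProb {n : ℕ} {A : Set G} {ε : ℝ} (hε : 0 ≤ ε)
    (h : Pr μ n {l | l.prod ∉ A} ≤ ENNReal.ofReal ε) : 1 - ε ≤ walkProb μ n A := by
  let _ : MeasurableSpace G := ⊤
  have hprob : IsProbabilityMeasure (stepMeasure μ) := by
    unfold stepMeasure; infer_instance
  have h1 : stepMeasure μ {ω | walk ω n ∉ A} ≤ ENNReal.ofReal ε := by
    refine le_trans ?_ h
    have := stepMeasure_cyl_inter_le (μ := μ) n (fun _ => 1) 0 {l | l.prod ∉ A}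
    simp only [Finset.range_zero, Finset.prod_empty, one_mul] at this
    refine le_trans (measure_mono ?_) this
    intro ω hω
    exact ⟨fun i hi => absurd hi (Nat.not_lt_zero i), by simpa [walk_eq_prod] using hω⟩
  have h2 : 1 ≤ stepMeasure μ {ω | walk ω n ∈ A} + ENNReal.ofReal ε := by
    rw [← hprob.measure_univ]
    refine le_trans (le_trans (measure_mono ?_) (measure_union_le _ _)) (add_le_add le_rfl h1)
    intro ω _
    exact em (walk ω n ∈ A)
  have h3 : stepMeasure μ {ω | walk ω n ∈ A} ≠ ⊤ := measure_ne_top _ _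
  have h4 := ENNReal.toReal_mono (ENNReal.add_ne_top.2 ⟨h3, ENNReal.ofReal_ne_top⟩) h2
  rw [ENNReal.toReal_add h3 ENNReal.ofReal_ne_top, ENNReal.toReal_ofReal hε,
    ENNReal.toReal_one] at h4
  unfold walkProb
  linarith

end PathMeasure

/-! ### Averaging the exponential potential over a Schottky family. -/

section Decay

open scoped ENNReal

variable {G : Type*} [Group G] {X : Type*} [MetricSpace X] [MulAction G X] [IsIsometricSMul G X]
  {δ : ℝ}

/-- The potential `exp (-t d(y, x))`. -/
noncomputable def decay (t : ℝ) (x y : X) : ℝ≥0∞ := ENNReal.ofReal (Real.exp (-t * dist y x))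

lemma decay_le {t : ℝ} (ht : 0 ≤ t) {x y z : X} {A : ℝ} (h : dist y x ≤ dist z x + A) :
    decay t x z ≤ ENNReal.ofReal (Real.exp (t * A)) * decay t x y := by
  rw [decay, decay, ← ENNReal.ofReal_mul (Real.exp_nonneg _), ← Real.exp_add]
  refine ENNReal.ofReal_le_ofReal (Real.exp_le_exp.2 ?_)
  nlinarith [mul_le_mul_of_nonneg_left h ht]

lemma decay_smul_le {t : ℝ} (ht : 0 ≤ t) {x : X} {A : ℝ} {w : G} (h : dist x (w • x) ≤ A) (y : X) :
    decay t x (w⁻¹ • y) ≤ ENNReal.ofReal (Real.exp (t * A)) * decay t x y := by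
  refine decay_le ht ?_
  rw [dist_smul_left, inv_inv]
  have := dist_triangle y (w • x) x
  rw [dist_comm (w • x) x] at this
  linarith

lemma le_decay_smul {t : ℝ} (ht : 0 ≤ t) {x : X} {A : ℝ} {w : G} (h : dist x (w • x) ≤ A) (y : X) :
    decay t x y ≤ ENNReal.ofReal (Real.exp (t * A)) * decay t x (w⁻¹ • y) := by
  refine decay_le ht ?_
  rw [dist_smul_left, inv_inv]
  have := dist_triangle y x (w • x)
  linarith

lemma decay_ne_top (t : ℝ) (x y : X) : decay t x y ≠ ⊤ := ENNReal.ofReal_ne_top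

/-- Six good indices gain a factor `exp (-u)` and two bad ones lose at most `exp (2 * u)`. To first
order this is `8 - 2 * u`; the quadratic error `14 * u ^ 2` is at most `u`. -/
lemma exp_average_le {u : ℝ} (h0 : 0 ≤ u) (h1 : u ≤ 1 / 14) :
    6 * Real.exp (-u) + 2 * Real.exp (2 * u) ≤ 8 - u := by
  have a := Real.abs_exp_sub_one_sub_id_le (x := -u) (by rw [abs_neg, abs_of_nonneg h0]; linarith)
  have b := Real.abs_exp_sub_one_sub_id_le (x := 2 * u) (by rw [abs_of_nonneg] <;> linarith)
  have a' := (abs_le.1 a).2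
  have b' := (abs_le.1 b).2
  nlinarith

/-- On average over a Schottky family, the potential decreases, whatever isometry `w` follows. -/
lemma IsSchottky.sum_decay_le (h4 : FourPoint X δ) (hδ : 0 ≤ δ) {x : X} {C E : ℝ} {s : Fin 8 → G}
    (h : IsSchottky x δ C E s) {t : ℝ} (ht : 0 ≤ t) {w : G}
    (hw : t * (E + dist x (w • x)) ≤ 1 / 14) (y : X) :
    ∑ i, decay t x (w⁻¹ • (s i)⁻¹ • y) ≤ 8 * (ENNReal.ofReal (1 - t / 8) * decay t x y) := by
  classical
  set b := E + dist x (w • x) with hb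
  set u := t * b with hu
  have hE := h.one_le
  have hb1 : 1 ≤ b := by linarith [dist_nonneg (x := x) (y := w • x)]
  have hu0 : 0 ≤ u := by positivity
  set good : Fin 8 → Prop := fun i => gp x y (s i • x) ≤ C + δ ∧ gp x ((s i)⁻¹ • x) (w • x) ≤ C + δ
  -- A good index increases the distance by at least `b`: the two turns cost `2 * (C + δ) + 2 * (C +
  -- 2 * δ)`, exactly the margin in `IsSchottky.long`. A bad one decreases it by at most `2 * b`, by
  -- the triangle inequality.
  have hterm : ∀ i, Real.exp (-t * dist (w⁻¹ • (s i)⁻¹ • y) x) ≤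
      (Real.exp (-u) + if good i then 0 else Real.exp (2 * u) - Real.exp (-u)) *
        Real.exp (-t * dist y x) := by
    intro i
    rw [dist_smul_left, inv_inv]
    by_cases hi : good i
    · rw [if_pos hi, add_zero, ← Real.exp_add, Real.exp_le_exp]
      have h1 := h.gp_le h4 hδ hi.1 hi.2
      have h2 := dist_eq_gp x ((s i)⁻¹ • y) (w • x)
      have h3 := dist_eq_gp x y (s i • x)
      have h5 : dist x ((s i)⁻¹ • y) = dist y (s i • x) := by
        rw [dist_comm, dist_smul_left, inv_inv]
      have h6 := h.long i
      have h7 : dist y x + b ≤ dist ((s i)⁻¹ • y) (w • x) := by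
        rw [dist_comm y x]; linarith [hi.1]
      nlinarith [mul_le_mul_of_nonneg_left h7 ht]
    · rw [if_neg hi, add_sub_cancel, ← Real.exp_add, Real.exp_le_exp]
      have h2 := dist_triangle4 y (s i • x) (s i • w • x) x
      have h3 := dist_triangle y (s i • w • x) x
      have h5 : dist ((s i)⁻¹ • y) (w • x) = dist y (s i • w • x) := by
        rw [dist_smul_left, inv_inv]
      have h6 := dist_triangle (s i • w • x) (s i • x) x
      rw [dist_smul, dist_comm (w • x) x, dist_comm (s i • x) x] at h6
      have h7 : dist y x ≤ dist ((s i)⁻¹ • y) (w • x) + 2 * b := by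
        linarith [h.short i, dist_nonneg (x := x) (y := w • x)]
      nlinarith [mul_le_mul_of_nonneg_left h7 ht]
  have hcard := h.card_bad_le h4 y (w • x)
  have hsum : ∑ i, Real.exp (-t * dist (w⁻¹ • (s i)⁻¹ • y) x) ≤
      8 * ((1 - t / 8) * Real.exp (-t * dist y x)) := by
    refine (Finset.sum_le_sum fun i _ => hterm i).trans ?_
    rw [← Finset.sum_mul, Finset.sum_add_distrib, ← mul_assoc (8 : ℝ)]
    refine mul_le_mul_of_nonneg_right ?_ (Real.exp_nonneg _)
    rw [Finset.sum_const, Finset.card_univ, Fintype.card_fin,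
      ← Finset.sum_filter_not_add_sum_filter _ good]
    rw [Finset.sum_congr rfl (g := fun _ => Real.exp (2 * u) - Real.exp (-u))
      (fun i hi => if_neg (Finset.mem_filter.1 hi).2), Finset.sum_const,
      Finset.sum_congr rfl (g := fun _ => (0 : ℝ))
      (fun i hi => if_pos (Finset.mem_filter.1 hi).2), Finset.sum_const_zero]
    simp only [nsmul_eq_mul, Nat.cast_ofNat, add_zero]
    have h1 : ((Finset.univ.filter fun i => ¬ good i).card : ℝ) ≤ 2 := by exact_mod_cast hcard
    have h2 : 0 ≤ Real.exp (2 * u) - Real.exp (-u) := by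
      rw [sub_nonneg, Real.exp_le_exp]; linarith
    have h3 := mul_le_mul_of_nonneg_right h1 h2
    have h5 := exp_average_le hu0 hw
    have h6 : t ≤ u := by nlinarith
    linarith
  have ht1 : t ≤ 1 / 14 := by nlinarith
  simp only [decay]
  rw [← ENNReal.ofReal_sum_of_nonneg (fun i _ => Real.exp_nonneg _),
    ← ENNReal.ofReal_mul (by linarith), show (8 : ℝ≥0∞) = ENNReal.ofReal 8 by simp,
    ← ENNReal.ofReal_mul (by norm_num)]
  exact ENNReal.ofReal_le_ofReal hsum

end Decay

/-! ### Splitting off a uniform part from the law of a block. -/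

section Splitting

open scoped ENNReal

variable {G : Type*} {μ : PMF G}

lemma Ex_eq_tsum (n : ℕ) (F : List G → ℝ≥0∞) : Ex μ n F = ∑' l, Pr μ n {l} * F l := by
  have : F = fun l => ∑' l', ({l'} : Set (List G)).indicator 1 l * F l' := by
    ext l
    rw [tsum_eq_single l]
    · simp
    · intro l' hl'
      rw [Set.indicator_of_notMem (by simpa using hl'.symm), zero_mul]
  conv_lhs => rw [this]
  rw [Ex_tsum]
  simp only [Ex_mul_const, Pr]

lemma mem_support_of_Pr_ne_zero {n : ℕ} {l : List G} (h : Pr μ n {l} ≠ 0) :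
    l.length = n ∧ ∀ g ∈ l, g ∈ μ.support := by
  by_contra hl
  refine h (le_antisymm ((Pr_mono (T := ∅) ?_).trans ?_) zero_le)
  · rintro l' h1 h2 rfl
    exact hl ⟨h1, h2⟩
  · simp [Pr, Ex_const]

/-- The law of a block of steps is the sum of a uniform measure on given words and a remainder. -/
lemma exists_split (m : ℕ) {word : Fin 8 → List G} (hinj : Function.Injective word)
    (hlen : ∀ i, (word i).length = m) (hsupp : ∀ i, ∀ g ∈ word i, g ∈ μ.support) :
    ∃ (a : ℝ≥0∞) (r : List G → ℝ≥0∞), 0 < a ∧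
      (∀ F, Ex μ m F = a * ∑ i, F (word i) + ∑' l, r l * F l) ∧
      (∀ l, r l ≠ 0 → l.length = m ∧ ∀ g ∈ l, g ∈ μ.support) := by
  classical
  -- The smallest of the eight probabilities can be removed from each word, leaving a nonnegative
  -- remainder.
  set a := Finset.univ.inf' Finset.univ_nonempty fun i => Pr μ m {word i}
  have ha : ∀ i, a ≤ Pr μ m {word i} := fun i => Finset.inf'_le _ (Finset.mem_univ i)
  refine ⟨a, fun l => Pr μ m {l} - if l ∈ Finset.univ.image word then a else 0, ?_, fun F => ?_,
    fun l hl => ?_⟩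
  · rw [Finset.lt_inf'_iff]
    intro i _
    rw [← hlen i]
    exact Pr_singleton_pos (hsupp i)
  · have h1 : a * ∑ i, F (word i) = ∑' l, (if l ∈ Finset.univ.image word then a else 0) * F l := by
      rw [tsum_eq_sum (s := Finset.univ.image word) (fun l hl => by rw [if_neg hl, zero_mul]),
        Finset.sum_image (fun i _ j _ h => hinj h), Finset.mul_sum]
      exact Finset.sum_congr rfl fun i _ => by
        rw [if_pos (Finset.mem_image_of_mem _ (Finset.mem_univ i))]
    rw [h1, ← ENNReal.tsum_add, Ex_eq_tsum]
    refine tsum_congr fun l => ?_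
    rw [← add_mul, add_tsub_cancel_of_le]
    split_ifs with hl
    · obtain ⟨i, -, rfl⟩ := Finset.mem_image.1 hl
      exact ha i
    · exact zero_le
  · refine mem_support_of_Pr_ne_zero (μ := μ) fun h => hl ?_
    simp only [h, zero_tsub]

end Splitting

/-! ### The potential averaged over the remainder steps. -/

section Lyapunov

open scoped ENNReal

variable {G : Type*} [Group G] {X : Type*} [MetricSpace X] [MulAction G X] [IsIsometricSMul G X]
  {δ : ℝ}

/-- Averages of the potential over a geometrically distributed number (at most `J`) of
remainder steps. -/
noncomputable def lyap (t : ℝ) (x : X) (α : ℝ≥0∞) (r : List G → ℝ≥0∞) : ℕ → X → ℝ≥0∞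
  | 0, y => decay t x y
  | J + 1, y => α * decay t x y + ∑' l, r l * lyap t x α r J (l.prod⁻¹ • y)

variable {t Λ : ℝ} {x : X} {α : ℝ≥0∞} {r : List G → ℝ≥0∞}

/-- At most `J` remainder words are applied, and each changes the distance by at most `Λ`. -/
lemma lyap_le (ht : 0 ≤ t) (hΛ : 0 ≤ Λ) (hmass : α + ∑' l, r l = 1)
    (hr : ∀ l, r l ≠ 0 → dist x (l.prod • x) ≤ Λ) (J : ℕ) (y : X) :
    lyap t x α r J y ≤ ENNReal.ofReal (Real.exp (t * (J * Λ))) * decay t x y := by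
  induction J generalizing y with
  | zero => simp [lyap]
  | succ J ih =>
    set c := ENNReal.ofReal (Real.exp (t * ((J + 1 : ℕ) * Λ))) with hc
    have hc1 : 1 ≤ c := by
      rw [hc, ENNReal.one_le_ofReal]
      exact Real.one_le_exp (by positivity)
    have h1 : ∀ l, r l * lyap t x α r J (l.prod⁻¹ • y) ≤ r l * (c * decay t x y) := by
      intro l
      by_cases hl : r l = 0
      · simp [hl]
      gcongr
      refine (ih _).trans ?_
      have h2 := decay_smul_le ht (hr l hl) y
      have h3 : c = ENNReal.ofReal (Real.exp (t * (J * Λ))) * ENNReal.ofReal (Real.exp (t * Λ)) := by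
        rw [hc, ← ENNReal.ofReal_mul (Real.exp_nonneg _), ← Real.exp_add]
        push_cast; ring_nf
      rw [h3, mul_assoc]
      gcongr
    calc lyap t x α r (J + 1) y ≤ α * (c * decay t x y) + ∑' l, r l * (c * decay t x y) := by
          refine add_le_add ?_ (ENNReal.tsum_le_tsum h1)
          gcongr
          exact le_mul_of_one_le_left zero_le hc1
      _ = c * decay t x y := by rw [ENNReal.tsum_mul_right, ← add_mul, hmass, one_mul]

lemma le_lyap (ht : 0 ≤ t) (hΛ : 0 ≤ Λ) (hmass : α + ∑' l, r l = 1)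
    (hr : ∀ l, r l ≠ 0 → dist x (l.prod • x) ≤ Λ) (J : ℕ) (y : X) :
    decay t x y ≤ ENNReal.ofReal (Real.exp (t * (J * Λ))) * lyap t x α r J y := by
  induction J generalizing y with
  | zero => simp [lyap]
  | succ J ih =>
    set c := ENNReal.ofReal (Real.exp (t * ((J + 1 : ℕ) * Λ))) with hc
    have hc1 : 1 ≤ c := by
      rw [hc, ENNReal.one_le_ofReal]
      exact Real.one_le_exp (by positivity)
    have h1 : ∀ l, r l * decay t x y ≤ c * (r l * lyap t x α r J (l.prod⁻¹ • y)) := by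
      intro l
      by_cases hl : r l = 0
      · simp [hl]
      rw [mul_left_comm]
      gcongr
      refine (le_decay_smul ht (hr l hl) y).trans ?_
      have h3 : c = ENNReal.ofReal (Real.exp (t * Λ)) * ENNReal.ofReal (Real.exp (t * (J * Λ))) := by
        rw [hc, ← ENNReal.ofReal_mul (Real.exp_nonneg _), ← Real.exp_add]
        push_cast; ring_nf
      rw [h3, mul_assoc]
      gcongr
      exact ih _
    calc decay t x y = α * decay t x y + ∑' l, r l * decay t x y := by
          rw [ENNReal.tsum_mul_right, ← add_mul, hmass, one_mul]
      _ ≤ c * (α * decay t x y) + ∑' l, c * (r l * lyap t x α r J (l.prod⁻¹ • y)) :=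
          add_le_add (le_mul_of_one_le_left zero_le hc1) (ENNReal.tsum_le_tsum h1)
      _ = _ := by rw [ENNReal.tsum_mul_left, ← mul_add, lyap]

/-- The two truncations differ only when `J` remainder steps occur in a row, which has weight `(∑'
l, r l) ^ J`; there one more remainder step changes the potential by a factor of at most `exp (t *
Λ)`. -/
lemma lyap_succ_le (ht : 0 ≤ t) (hΛ : 0 ≤ Λ) (hmass : α + ∑' l, r l = 1)
    (hr : ∀ l, r l ≠ 0 → dist x (l.prod • x) ≤ Λ) (J : ℕ) (y : X) :
    lyap t x α r (J + 1) y ≤ lyap t x α r J y + (∑' l, r l) ^ J *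
      ENNReal.ofReal ((Real.exp (t * Λ) - 1) * Real.exp (t * (J * Λ))) * decay t x y := by
  induction J generalizing y with
  | zero =>
    have h1 : lyap t x α r 1 y ≤ ENNReal.ofReal (Real.exp (t * Λ)) * decay t x y := by
      simpa using lyap_le ht hΛ hmass hr 1 y
    refine h1.trans (le_of_eq ?_)
    have h2 : ENNReal.ofReal (Real.exp (t * Λ)) = 1 + ENNReal.ofReal (Real.exp (t * Λ) - 1) := by
      rw [← ENNReal.ofReal_one, ← ENNReal.ofReal_add zero_le_one
        (by linarith [Real.one_le_exp (show 0 ≤ t * Λ by positivity)])]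
      congr 1; ring
    rw [h2]
    simp [lyap, add_mul]
  | succ J ih =>
    set ρ := ∑' l, r l
    set e := fun k : ℕ => ENNReal.ofReal ((Real.exp (t * Λ) - 1) * Real.exp (t * (k * Λ))) with he
    have hstep : e (J + 1) = e J * ENNReal.ofReal (Real.exp (t * Λ)) := by
      rw [he, ← ENNReal.ofReal_mul (mul_nonneg (by
        linarith [Real.one_le_exp (show 0 ≤ t * Λ by positivity)]) (Real.exp_nonneg _)), mul_assoc,
        ← Real.exp_add]
      push_cast; ring_nf
    have h1 : ∀ l, r l * lyap t x α r (J + 1) (l.prod⁻¹ • y) ≤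
        r l * lyap t x α r J (l.prod⁻¹ • y) + r l * (ρ ^ J * e (J + 1) * decay t x y) := by
      intro l
      by_cases hl : r l = 0
      · simp [hl]
      rw [← mul_add]
      gcongr
      refine (ih _).trans (add_le_add le_rfl ?_)
      rw [hstep]
      calc ρ ^ J * e J * decay t x (l.prod⁻¹ • y)
          ≤ ρ ^ J * e J * (ENNReal.ofReal (Real.exp (t * Λ)) * decay t x y) :=
            mul_le_mul_right (decay_smul_le ht (hr l hl) y) _
        _ = _ := by ring
    have h2 := ENNReal.tsum_le_tsum h1
    rw [ENNReal.tsum_add, ENNReal.tsum_mul_right] at h2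
    calc lyap t x α r (J + 1 + 1) y
        = α * decay t x y + ∑' l, r l * lyap t x α r (J + 1) (l.prod⁻¹ • y) := rfl
      _ ≤ α * decay t x y + (∑' l, r l * lyap t x α r J (l.prod⁻¹ • y) +
            ρ * (ρ ^ J * e (J + 1) * decay t x y)) := by gcongr
      _ = _ := by
        rw [← add_assoc, pow_succ']
        simp only [lyap, he, mul_assoc]

/-- `IsSchottky.sum_decay_le` permits any isometry after the Schottky word, so the remainder words
can be absorbed into `w`. The term `J * Λ` in the smallness condition reserves room for them. -/
lemma IsSchottky.sum_lyap_le (h4 : FourPoint X δ) (hδ : 0 ≤ δ) {C E : ℝ} {s : Fin 8 → G}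
    (h : IsSchottky x δ C E s) (ht : 0 ≤ t) (hmass : α + ∑' l, r l = 1)
    (hr : ∀ l, r l ≠ 0 → dist x (l.prod • x) ≤ Λ) (J : ℕ) {w : G}
    (hw : t * (E + dist x (w • x) + J * Λ) ≤ 1 / 14) (hΛ : 0 ≤ Λ) (y : X) :
    ∑ i, lyap t x α r J (w⁻¹ • (s i)⁻¹ • y) ≤ 8 * (ENNReal.ofReal (1 - t / 8) * decay t x y) := by
  induction J generalizing w with
  | zero => exact h.sum_decay_le h4 hδ ht (by simpa using hw) y
  | succ J ih =>
    set B := 8 * (ENNReal.ofReal (1 - t / 8) * decay t x y)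
    push_cast at hw
    have hw0 : t * (E + dist x (w • x)) ≤ 1 / 14 := by
      refine le_trans (mul_le_mul_of_nonneg_left ?_ ht) hw
      nlinarith [mul_nonneg (Nat.cast_nonneg (α := ℝ) J) hΛ]
    have h1 : ∀ l, r l * ∑ i, lyap t x α r J (l.prod⁻¹ • w⁻¹ • (s i)⁻¹ • y) ≤ r l * B := by
      intro l
      by_cases hl : r l = 0
      · simp [hl]
      gcongr
      have := ih (w := w * l.prod) (by
        refine le_trans (mul_le_mul_of_nonneg_left ?_ ht) hw
        have h2 := dist_triangle x (w • x) (w • l.prod • x)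
        rw [dist_smul] at h2
        have h3 := hr l hl
        rw [mul_smul]
        linarith)
      simpa only [mul_inv_rev, mul_smul] using this
    calc ∑ i, lyap t x α r (J + 1) (w⁻¹ • (s i)⁻¹ • y)
        = α * ∑ i, decay t x (w⁻¹ • (s i)⁻¹ • y) +
          ∑' l, r l * ∑ i, lyap t x α r J (l.prod⁻¹ • w⁻¹ • (s i)⁻¹ • y) := by
          simp only [lyap, Finset.sum_add_distrib, Finset.mul_sum]
          rw [Summable.tsum_finsetSum (fun _ _ => ENNReal.summable)]
      _ ≤ α * B + ∑' l, r l * B := by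
          refine add_le_add ?_ (ENNReal.tsum_le_tsum h1)
          gcongr
          exact h.sum_decay_le h4 hδ ht hw0 y
      _ = B := by rw [ENNReal.tsum_mul_right, ← add_mul, hmass, one_mul]

end Lyapunov

/-! ### Contraction of the potential by the walk. -/

section Drift

open scoped ENNReal

variable {G : Type*} [Group G] {X : Type*} [MetricSpace X] [MulAction G X] [IsIsometricSMul G X]
  {δ : ℝ} {μ : PMF G} {x : X}

lemma exp_sub_one_le {v : ℝ} (h0 : 0 ≤ v) (h1 : v ≤ 1) : Real.exp v ≤ 1 + 2 * v := by
  have := (abs_le.1 (Real.abs_exp_sub_one_sub_id_le (x := v) (by rwa [abs_of_nonneg h0]))).2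
  nlinarith

/-- A potential, comparable to `exp (-t d(y, x))`, which is contracted by blocks of steps. -/
lemma IsSchottky.exists_contracted (h4 : FourPoint X δ) (hδ : 0 ≤ δ) {m : ℕ} {C E L : ℝ}
    {word : Fin 8 → List G} (hm : 0 < m) (hlen : ∀ i, (word i).length = m)
    (hsupp : ∀ i, ∀ g ∈ word i, g ∈ μ.support) (h : IsSchottky x δ C E fun i => (word i).prod)
    (hL : 1 ≤ L) (hμ : ∀ g ∈ μ.support, dist x (g • x) ≤ L) :
    ∃ (t κ A : ℝ) (φ : X → ℝ≥0∞), 0 < t ∧ 0 < κ ∧ κ < 1 ∧ 1 ≤ A ∧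
      (∀ y, decay t x y ≤ ENNReal.ofReal A * φ y) ∧ (∀ y, φ y ≤ ENNReal.ofReal A * decay t x y) ∧
      ∀ y, Ex μ m (fun l => φ (l.prod⁻¹ • y)) ≤ ENNReal.ofReal κ * φ y := by
  have hinj : Function.Injective word := by
    intro i j hij
    by_contra hne
    have h1 := h.sep i j hne
    simp only [hij] at h1
    have h2 : gp x ((word j).prod • x) ((word j).prod • x) = dist x ((word j).prod • x) := by
      simp [gp]
    rw [h2] at h1
    linarith [h.long j, h.one_le, h.nonneg]
  obtain ⟨a, r, ha, hsplit, hr⟩ := exists_split m hinj hlen hsupp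
  set Λ := L * m with hΛdef
  have hm1 : (1 : ℝ) ≤ m := by exact_mod_cast hm
  have hΛ : 0 < Λ := by positivity
  have hrΛ : ∀ l, r l ≠ 0 → dist x (l.prod • x) ≤ Λ := fun l hl => by
    obtain ⟨h1, h2⟩ := hr l hl
    have := dist_list_prod_le (x := x) (l := l) (L := L) fun g hg => hμ g (h2 g hg)
    rwa [h1] at this
  set α : ℝ≥0∞ := a * 8 with hα
  have hmass : α + ∑' l, r l = 1 := by
    have := hsplit fun _ => 1
    rw [Ex_const] at this
    simp only [Finset.sum_const, Finset.card_univ, Fintype.card_fin, mul_one, nsmul_eq_mul] at this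
    rw [this]; norm_num [hα]
  set ρ := ∑' l, r l with hρ
  have hα1 : α ≤ 1 := hmass ▸ le_self_add
  have hρ1 : ρ ≤ 1 := hmass ▸ le_add_self
  have hαt : α ≠ ⊤ := ne_top_of_le_ne_top ENNReal.one_ne_top hα1
  have hρt : ρ ≠ ⊤ := ne_top_of_le_ne_top ENNReal.one_ne_top hρ1
  set α' := α.toReal
  set ρ' := ρ.toReal
  have hsum : α' + ρ' = 1 := by
    rw [← ENNReal.toReal_add hαt hρt, hmass, ENNReal.toReal_one]
  have hα0 : 0 < α' := ENNReal.toReal_pos (by simpa [hα] using ha.ne') hαt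
  have hρ0 : 0 ≤ ρ' := ENNReal.toReal_nonneg
  -- `J` makes the truncation error at most half of the Schottky gain `α' * t / 8`. It is fixed
  -- before `t`, and the condition does not involve `t` because both quantities are linear in it.
  obtain ⟨J, hJ⟩ := exists_pow_lt_of_lt_one (show 0 < α' / (96 * Λ) by positivity)
    (show ρ' < 1 by linarith)
  rw [lt_div_iff₀ (by positivity)] at hJ
  have hE := h.one_le
  set S := E + J * Λ + Λ with hS
  have hJΛ : 0 ≤ J * Λ := by positivity
  have hS0 : 1 ≤ S := by linarith
  set t := 1 / (14 * S) with htdef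
  have ht : 0 < t := by positivity
  have htS : t * S = 1 / 14 := by rw [htdef]; field_simp
  have htΛ : t * Λ ≤ 1 / 14 := by
    rw [← htS]; gcongr; linarith
  have htJ : t * (J * Λ) ≤ 1 / 14 := by
    rw [← htS]; gcongr; linarith
  have htE : t * (E + J * Λ) ≤ 1 / 14 := by
    rw [← htS]; gcongr; linarith
  have ht1 : t ≤ 1 / 14 := by rw [← htS]; nlinarith
  have hexpJ : Real.exp (t * (J * Λ)) ≤ 3 := by
    linarith [exp_sub_one_le (v := t * (J * Λ)) (by positivity) (by linarith)]
  set φ := lyap t x α r J with hφ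
  have hφle : ∀ y, φ y ≤ ENNReal.ofReal 3 * decay t x y := fun y =>
    (lyap_le ht.le hΛ.le hmass hrΛ J y).trans (by gcongr)
  have hleφ : ∀ y, decay t x y ≤ ENNReal.ofReal 3 * φ y := fun y =>
    (le_lyap ht.le hΛ.le hmass hrΛ J y).trans (by gcongr)
  have hα'1 : α' ≤ 1 := by linarith
  -- The net gain is `α' * t / 16` times the potential, which is at least a third of `φ`.
  refine ⟨t, 1 - α' * t / 48, 3, φ, ht, by nlinarith, by nlinarith [mul_pos hα0 ht], by norm_num,
    hleφ, hφle, fun y => ?_⟩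
  set ε := ρ' ^ J * ((Real.exp (t * Λ) - 1) * Real.exp (t * (J * Λ)))
  have hexp1 : 0 ≤ Real.exp (t * Λ) - 1 := by
    linarith [Real.one_le_exp (show 0 ≤ t * Λ by positivity)]
  have hε : ε ≤ α' * t / 16 := by
    have e1 : Real.exp (t * Λ) - 1 ≤ 2 * (t * Λ) := by
      linarith [exp_sub_one_le (v := t * Λ) (by positivity) (by linarith)]
    calc ρ' ^ J * ((Real.exp (t * Λ) - 1) * Real.exp (t * (J * Λ)))
        ≤ ρ' ^ J * ((2 * (t * Λ)) * 3) := by gcongr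
      _ = ρ' ^ J * (96 * Λ) * t / 16 := by ring
      _ ≤ _ := by gcongr
  -- The recursion for `lyap` turns the remainder part of the expectation, together with `α * decay
  -- t x y`, into the next truncation, which is almost `φ y`. The term is added on the left since
  -- subtraction in `ℝ≥0∞` truncates.
  have hkey : Ex μ m (fun l => φ (l.prod⁻¹ • y)) + α * decay t x y ≤
      α * (ENNReal.ofReal (1 - t / 8) * decay t x y) + (φ y + ENNReal.ofReal ε * decay t x y) := by
    have k1 := lyap_succ_le ht.le hΛ.le hmass hrΛ J y
    have k2 := h.sum_lyap_le h4 hδ ht.le hmass hrΛ J (w := 1) (by simpa using htE) hΛ.le y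
    have k3 : ρ ^ J * ENNReal.ofReal ((Real.exp (t * Λ) - 1) * Real.exp (t * (J * Λ))) =
        ENNReal.ofReal ε := by
      rw [show ENNReal.ofReal ε = ENNReal.ofReal (ρ' ^ J) * ENNReal.ofReal
        ((Real.exp (t * Λ) - 1) * Real.exp (t * (J * Λ))) from ENNReal.ofReal_mul (by positivity),
        ENNReal.ofReal_pow hρ0, ENNReal.ofReal_toReal hρt]
    rw [k3] at k1
    simp only [inv_one, one_smul] at k2
    rw [hsplit]
    calc _ = a * ∑ i, φ ((word i).prod⁻¹ • y) + lyap t x α r (J + 1) y := by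
          rw [lyap, add_assoc, add_comm (∑' l, _)]
      _ ≤ a * (8 * (ENNReal.ofReal (1 - t / 8) * decay t x y)) +
          (φ y + ENNReal.ofReal ε * decay t x y) := by gcongr
      _ = _ := by rw [hα]; ring
  have hft := decay_ne_top t x y
  have hgt : φ y ≠ ⊤ := ne_top_of_le_ne_top (ENNReal.mul_ne_top ENNReal.ofReal_ne_top hft) (hφle y)
  set f := decay t x y
  set g := φ y
  set p := Ex μ m (fun l => φ (l.prod⁻¹ • y))
  have hR1 : α * (ENNReal.ofReal (1 - t / 8) * f) ≠ ⊤ :=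
    ENNReal.mul_ne_top hαt (ENNReal.mul_ne_top ENNReal.ofReal_ne_top hft)
  have hR2 : ENNReal.ofReal ε * f ≠ ⊤ := ENNReal.mul_ne_top ENNReal.ofReal_ne_top hft
  have hpt : p ≠ ⊤ := by
    refine ne_top_of_le_ne_top ?_ (le_self_add.trans hkey)
    exact ENNReal.add_ne_top.2 ⟨hR1, ENNReal.add_ne_top.2 ⟨hgt, hR2⟩⟩
  have hreal := ENNReal.toReal_mono
    (ENNReal.add_ne_top.2 ⟨hR1, ENNReal.add_ne_top.2 ⟨hgt, hR2⟩⟩) hkey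
  have hε0 : 0 ≤ ε := by positivity
  have t1 : (α * f).toReal = α' * f.toReal := ENNReal.toReal_mul
  have t2 : (α * (ENNReal.ofReal (1 - t / 8) * f)).toReal = α' * ((1 - t / 8) * f.toReal) := by
    rw [ENNReal.toReal_mul (a := α), ENNReal.toReal_mul (b := f),
      ENNReal.toReal_ofReal (by linarith)]
  rw [ENNReal.toReal_add hpt (ENNReal.mul_ne_top hαt hft), t1,
    ENNReal.toReal_add hR1 (ENNReal.add_ne_top.2 ⟨hgt, hR2⟩), t2, ENNReal.toReal_add hgt hR2,
    ENNReal.toReal_mul (b := f), ENNReal.toReal_ofReal hε0] at hreal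
  have hg3 := ENNReal.toReal_mono (ENNReal.mul_ne_top ENNReal.ofReal_ne_top hft) (hφle y)
  rw [ENNReal.toReal_mul, ENNReal.toReal_ofReal (by norm_num)] at hg3
  have hf0 : 0 ≤ f.toReal := ENNReal.toReal_nonneg
  rw [← ENNReal.toReal_le_toReal hpt (ENNReal.mul_ne_top ENNReal.ofReal_ne_top hgt),
    ENNReal.toReal_mul, ENNReal.toReal_ofReal (by nlinarith)]
  have hεf := mul_le_mul_of_nonneg_right hε hf0
  have hg4 := mul_le_mul_of_nonneg_left hg3 (show 0 ≤ α' * t / 48 by positivity)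
  change α' * t / 48 * g.toReal ≤ _ at hg4
  linarith

lemma Ex_pow_le {φ : X → ℝ≥0∞} {m : ℕ} {c : ℝ≥0∞}
    (h : ∀ y, Ex μ m (fun l => φ (l.prod⁻¹ • y)) ≤ c * φ y) (k : ℕ) (y : X) :
    Ex μ (m * k) (fun l => φ (l.prod⁻¹ • y)) ≤ c ^ k * φ y := by
  induction k generalizing y with
  | zero => simp [Ex]
  | succ k ih =>
    rw [show m * (k + 1) = m + m * k by ring, Ex_append]
    calc _ ≤ Ex μ m (fun l => c ^ k * φ (l.prod⁻¹ • y)) := by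
          refine Ex_mono fun l _ _ => ?_
          simpa only [List.prod_append, mul_inv_rev, mul_smul] using ih (l.prod⁻¹ • y)
      _ ≤ c ^ k * (c * φ y) := by
          rw [Ex_const_mul]
          gcongr
          exact h y
      _ = _ := by rw [pow_succ, mul_assoc]

/-- The walk satisfies a uniform exponential drift estimate. -/
lemma exists_drift (h4 : FourPoint X δ) (hδ : 0 ≤ δ) (hne : IsNonElementary X μ) (x : X)
    {L : ℝ} (hL : 1 ≤ L) (hμ : ∀ g ∈ μ.support, dist x (g • x) ≤ L) :
    ∃ t B c : ℝ, 0 < t ∧ 0 < B ∧ 0 < c ∧ c < 1 ∧ ∀ (n : ℕ) (y : X),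
      Ex μ n (fun l => decay t x (l.prod⁻¹ • y)) ≤ ENNReal.ofReal (B * c ^ n) * decay t x y := by
  obtain ⟨m, C, E, word, hm, hlen, hsupp, hS⟩ := hne.exists_isSchottky h4 hδ x
  obtain ⟨t, κ, A, φ, ht, hκ0, hκ1, hA, hφ1, hφ2, hφ3⟩ :=
    hS.exists_contracted h4 hδ hm hlen hsupp hL hμ
  set c := κ ^ ((m : ℝ)⁻¹) with hc
  have hc0 : 0 < c := Real.rpow_pos_of_pos hκ0 _
  have hc1 : c < 1 := Real.rpow_lt_one hκ0.le hκ1 (by positivity)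
  have hcm : c ^ m = κ := by
    rw [hc, ← Real.rpow_natCast, ← Real.rpow_mul hκ0.le, inv_mul_cancel₀ (by positivity),
      Real.rpow_one]
  set M := Real.exp (t * (L * m)) with hM
  -- One factor `A` for each comparison with `φ`, `M` for the incomplete last block, and `κ⁻¹` for
  -- rounding `n / m` down.
  refine ⟨t, M * A * A * κ⁻¹, c, ht, by positivity, hc0, hc1, fun n y => ?_⟩
  have hn : m * (n / m) + n % m = n := Nat.div_add_mod n m
  have hmod : n % m < m := Nat.mod_lt n hm
  calc Ex μ n (fun l => decay t x (l.prod⁻¹ • y))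
      = Ex μ (m * (n / m)) (fun l => Ex μ (n % m)
          fun l' => decay t x ((l ++ l').prod⁻¹ • y)) := by
        conv_lhs => rw [← hn, Ex_append]
    _ ≤ Ex μ (m * (n / m)) (fun l => ENNReal.ofReal (M * A) * φ (l.prod⁻¹ • y)) := by
        refine Ex_mono fun l _ _ => ?_
        rw [← Ex_const (μ := μ) (n % m) (ENNReal.ofReal (M * A) * φ (l.prod⁻¹ • y))]
        refine Ex_mono fun l' hl' hs => ?_
        rw [List.prod_append, mul_inv_rev, mul_smul, ENNReal.ofReal_mul (Real.exp_nonneg _),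
          mul_assoc]
        refine (decay_smul_le ht.le (A := L * m) ?_ _).trans (by gcongr; exact hφ1 _)
        refine (dist_list_prod_le fun g hg => hμ g (hs g hg)).trans ?_
        rw [hl']
        gcongr
    _ ≤ ENNReal.ofReal (M * A) * (ENNReal.ofReal κ ^ (n / m) * φ y) := by
        rw [Ex_const_mul]
        gcongr
        exact Ex_pow_le hφ3 _ y
    _ ≤ ENNReal.ofReal (M * A) * (ENNReal.ofReal κ ^ (n / m) * (ENNReal.ofReal A * decay t x y)) := by
        gcongr
        exact hφ2 y
    _ = ENNReal.ofReal (M * A * (κ ^ (n / m) * A)) * decay t x y := by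
        rw [← ENNReal.ofReal_pow hκ0.le, ENNReal.ofReal_mul (p := M * A) (by positivity),
          ENNReal.ofReal_mul (p := κ ^ (n / m)) (by positivity)]
        ring
    _ ≤ _ := by
        gcongr ?_ * _
        refine ENNReal.ofReal_le_ofReal ?_
        have : κ ^ (n / m) ≤ κ⁻¹ * c ^ n := by
          rw [inv_mul_eq_div, le_div_iff₀ hκ0]
          conv_rhs => rw [← hn, pow_add, pow_mul, hcm]
          gcongr
          rw [← hcm]
          exact pow_le_pow_of_le_one hc0.le hc1.le hmod.le
        calc M * A * (κ ^ (n / m) * A) ≤ M * A * (κ⁻¹ * c ^ n * A) := by gcongr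
          _ = _ := by ring

end Drift

/-! ### Linear escape from every point with exponential error bounds. -/

section LinearDrift

open scoped ENNReal

variable {G : Type*} [Group G] {X : Type*} [MetricSpace X] [MulAction G X] [IsIsometricSMul G X]
  {δ : ℝ} {μ : PMF G} {x : X}

/-- The walk moves away from every point at speed at least `κ`, up to exponentially small
probability. -/
structure LinearDrift (μ : PMF G) (x : X) (κ t B q : ℝ) : Prop where
  speed_pos : 0 < κ
  rate_pos : 0 < t
  const_pos : 0 < B
  base_pos : 0 < q
  base_lt_one : q < 1
  bound : ∀ (n : ℕ) (y : X) (A : ℝ),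
    Pr μ n {l | dist y (l.prod • x) < dist y x + κ * n - A} ≤
      ENNReal.ofReal (B * q ^ n * Real.exp (-(t * A)))

/-- Markov's inequality for the exponential potential; half of its decay rate is spent on the speed.
-/
lemma exists_linearDrift (h4 : FourPoint X δ) (hδ : 0 ≤ δ) (hne : IsNonElementary X μ) (x : X)
    {L : ℝ} (hL : 1 ≤ L) (hμ : ∀ g ∈ μ.support, dist x (g • x) ≤ L) :
    ∃ κ t B q : ℝ, LinearDrift μ x κ t B q := by
  obtain ⟨t, B, c, ht, hB, hc0, hc1, h⟩ := exists_drift h4 hδ hne x hL hμ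
  have hlog : Real.log c < 0 := Real.log_neg hc0 hc1
  -- With this speed `exp (t * κ) = c ^ (-1 / 2)`, so that `q` is the square root of `c`.
  set κ := -Real.log c / (2 * t) with hκ
  have htκ : t * κ = -Real.log c / 2 := by rw [hκ]; field_simp
  set q := c * Real.exp (t * κ) with hq
  have hq1 : q < 1 := by
    rw [hq, htκ]
    nth_rewrite 1 [← Real.exp_log hc0]
    rw [← Real.exp_add, Real.exp_lt_one_iff]
    linarith
  refine ⟨κ, t, B, q, div_pos (by linarith) (by positivity), ht, hB, by positivity, hq1,
    fun n y A => ?_⟩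
  set a := Real.exp (t * (dist y x + κ * n - A)) with ha
  calc Pr μ n {l | dist y (l.prod • x) < dist y x + κ * n - A}
      ≤ Ex μ n (fun l => ENNReal.ofReal a * decay t x (l.prod⁻¹ • y)) := by
        refine Ex_mono fun l _ _ => ?_
        by_cases hl : dist y (l.prod • x) < dist y x + κ * n - A
        · rw [Set.indicator_of_mem (by exact hl), decay, ← ENNReal.ofReal_mul (by positivity), ha,
            ← Real.exp_add, dist_smul_left, inv_inv]
          simp only [Pi.one_apply, ENNReal.one_le_ofReal]
          refine Real.one_le_exp ?_
          nlinarith [mul_lt_mul_of_pos_left hl ht]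
        · rw [Set.indicator_of_notMem (by exact hl)]
          exact zero_le
    _ ≤ ENNReal.ofReal a * (ENNReal.ofReal (B * c ^ n) * decay t x y) := by
        rw [Ex_const_mul]
        gcongr
        exact h n y
    _ = _ := by
        rw [decay, ← ENNReal.ofReal_mul (by positivity), ← ENNReal.ofReal_mul (by positivity)]
        congr 1
        rw [hq, mul_pow, ← Real.exp_nat_mul, ha]
        have : t * (dist y x + κ * n - A) = n * (t * κ) + (-(t * A)) + t * dist y x := by ring
        rw [this, Real.exp_add, Real.exp_add, neg_mul, Real.exp_neg (t * dist y x)]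
        field_simp

/-- The path with steps `l` moves away linearly from `z`. -/
def Diverges (κ A : ℝ) (x z : X) (l : List G) : Prop :=
  ∀ i ≤ l.length, dist z x + κ * i - A ≤ dist z ((l.take i).prod • x)

lemma prod_take_succ (l : List G) {i : ℕ} (hi : i < l.length) :
    (l.take (i + 1)).prod = (l.take i).prod * l[i] := by
  rw [List.take_add_one, List.getElem?_eq_getElem hi, Option.toList_some, List.prod_append,
    List.prod_singleton]

lemma Diverges.gp_le (hX : GromovSpace X δ) {L κ A : ℝ} {s : ℕ} (hL : 0 ≤ L) (hκ : 0 ≤ κ)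
    (hs : 2 * δ ≤ κ * s) (hs0 : 0 < s) {z : X} {l : List G} (hl : ∀ g ∈ l, dist x (g • x) ≤ L)
    (h : Diverges κ A x z l) : gp x z (l.prod • x) ≤ A + L * s + 2 * δ := by
  have := hX.gp_le_of_diverges (v := fun i => (l.take i).prod • x) (n := l.length) (s := s) (L := L)
    (κ := κ) (A := A) (z := z) hL hκ hs hs0 ?_ ?_
  · simpa using this
  · intro i hi
    rw [prod_take_succ l hi, mul_smul, dist_smul]
    exact hl _ (List.getElem_mem hi)
  · intro i hi
    simpa using h i hi

lemma dist_take_le {L : ℝ} {l : List G} (hL : 0 ≤ L) (hl : ∀ g ∈ l, dist x (g • x) ≤ L) (i : ℕ) :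
    dist x ((l.take i).prod • x) ≤ L * i := by
  refine (dist_list_prod_le fun g hg => hl g (List.mem_of_mem_take hg)).trans ?_
  gcongr
  simp

lemma sum_geometric_le {q : ℝ} (h0 : 0 ≤ q) (h1 : q < 1) (a b : ℕ) :
    ∑ i ∈ Finset.Ico a b, q ^ i ≤ q ^ a / (1 - q) := by
  have h2 : 0 < 1 - q := by linarith
  rcases le_total a b with hab | hab
  · rw [geom_sum_Ico h1.ne hab, ← neg_div_neg_eq, neg_sub, neg_sub]
    gcongr
    linarith [pow_nonneg h0 b]
  · rw [Finset.Ico_eq_empty_of_le hab, Finset.sum_empty]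
    positivity

/-- Before time `j` nothing can fail: steps of length at most `L` stay within the allowance `(L + κ)
* j`. Later failures are summed as a geometric series. -/
lemma LinearDrift.Pr_not_diverges_le {κ t B q L : ℝ} (hd : LinearDrift μ x κ t B q) (hL : 0 ≤ L)
    (hμ : ∀ g ∈ μ.support, dist x (g • x) ≤ L) (n j : ℕ) (y : X) :
    Pr μ n {l | ¬ Diverges κ ((L + κ) * j) x y l} ≤ ENNReal.ofReal (B / (1 - q) * q ^ j) := by
  have hq := hd.base_lt_one
  have hκ := hd.speed_pos
  have hB := hd.const_pos
  have hq0 := hd.base_pos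
  calc Pr μ n {l | ¬ Diverges κ ((L + κ) * j) x y l}
      ≤ Pr μ n (⋃ i ∈ Finset.Ico j (n + 1), {l | l.take i ∈
          {l | dist y (l.prod • x) < dist y x + κ * i - 0}}) := by
        refine Pr_mono fun l hl hs hdiv => ?_
        simp only [Set.mem_ofPred_eq, Diverges, not_forall, not_le] at hdiv
        obtain ⟨i, hi, hlt⟩ := hdiv
        have hκj : 0 ≤ (L + κ) * j := by positivity
        have hji : j ≤ i := by
          by_contra! hij
          have h1 := dist_take_le (x := x) hL (fun g hg => hμ g (hs g hg)) i
          have h2 := dist_triangle y ((l.take i).prod • x) x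
          rw [dist_comm ((l.take i).prod • x) x] at h2
          have h3 : (L + κ) * i ≤ (L + κ) * j := by gcongr
          linarith
        simp only [Set.mem_iUnion]
        refine ⟨i, Finset.mem_Ico.2 ⟨hji, by omega⟩, ?_⟩
        simp only [Set.mem_ofPred_eq]
        linarith
    _ ≤ ∑ i ∈ Finset.Ico j (n + 1), ENNReal.ofReal (B * q ^ i) := by
        refine (Pr_biUnion_le _ _ _).trans (Finset.sum_le_sum fun i hi => ?_)
        rw [Pr_take (by have := (Finset.mem_Ico.1 hi).2; omega)]
        simpa using hd.bound i y 0
    _ ≤ _ := by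
        rw [← ENNReal.ofReal_sum_of_nonneg (fun i _ => by positivity), ← Finset.mul_sum]
        refine ENNReal.ofReal_le_ofReal ?_
        rw [div_mul_eq_mul_div, mul_div_assoc]
        gcongr
        exact sum_geometric_le hq0.le hq _ _

end LinearDrift

/-! ### The walk finds a prescribed pattern and then diverges. -/

section Matching

open scoped ENNReal

variable {G : Type*} [Group G] {X : Type*} [MetricSpace X] [MulAction G X] [IsIsometricSMul G X]
  {δ : ℝ} {μ : PMF G} {x : X}

/-- Some time before `j`, the walk `l` follows the word prescribed by `W` for the position of `y`
seen from the current location, and moves away linearly from `y` afterwards. -/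
def Matches (W : X → List G) (κ A : ℝ) (x : X) (j : ℕ) (y : X) (l : List G) : Prop :=
  ∃ l₁ l₃ : List G, l = l₁ ++ (W (l₁.prod⁻¹ • y) ++ l₃) ∧ l₁.length < j ∧
    Diverges κ A x ((W (l₁.prod⁻¹ • y)).prod⁻¹ • l₁.prod⁻¹ • y) l₃

lemma Matches.append_left {W : X → List G} {κ A : ℝ} {j : ℕ} {y : X} {u v : List G}
    (h : Matches W κ A x (j - u.length) (u.prod⁻¹ • y) v) : Matches W κ A x j y (u ++ v) := by
  obtain ⟨l₁, l₃, hl, hlen, hdiv⟩ := h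
  have e : (u ++ l₁).prod⁻¹ • y = l₁.prod⁻¹ • u.prod⁻¹ • y := by
    rw [List.prod_append, mul_inv_rev, mul_smul]
  refine ⟨u ++ l₁, l₃, ?_, by rw [List.length_append]; omega, ?_⟩
  · rw [e, hl]; simp
  · rw [e]; exact hdiv

lemma not_matches_word {W : X → List G} {κ A : ℝ} {j : ℕ} {y : X} {l : List G} (hj : 0 < j)
    (h : ¬ Matches W κ A x j y (W y ++ l)) : ¬ Diverges κ A x ((W y).prod⁻¹ • y) l :=
  fun hd => h ⟨[], l, by simp, by simpa using hj, by simpa using hd⟩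

/-- The walk matches early with exponentially high probability. -/
lemma LinearDrift.exists_Pr_not_matches_le {κ t B q : ℝ} (hd : LinearDrift μ x κ t B q)
    {W : X → List G} {m : ℕ} (hm : 0 < m) (hW : ∀ z, (W z).length = m) {p A : ℝ} (hp0 : 0 < p)
    (hp : ∀ z, ENNReal.ofReal p ≤ Pr μ m {W z})
    (hA : B * Real.exp (-(t * A)) / (1 - √q) ≤ 1 / 2) :
    ∃ D ρ : ℝ, 0 < D ∧ 0 < ρ ∧ ρ < 1 ∧ ∀ (n j : ℕ) (y : X), j ≤ n →
      Pr μ n {l | ¬ Matches W κ A x j y l} ≤ ENNReal.ofReal (D * ρ ^ j) := by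
  have hq0 := hd.base_pos
  have hB := hd.const_pos
  have hsq1 : √q < 1 := by rw [Real.sqrt_lt' one_pos]; simpa using hd.base_lt_one
  have hsq0 : 0 < √q := Real.sqrt_pos.2 hq0
  have hp1 : p ≤ 1 := by
    have := (hp x).trans (Pr_le_one _ _)
    rwa [ENNReal.ofReal_le_one] at this
  have hb0 : 0 < 1 - p / 2 := by linarith
  -- Two demands on the rate: one attempt of `m` steps must gain `1 - p / 2`, and `q / ρ ≤ √q` must
  -- keep the sum over restart times convergent.
  set ρ := max (√q) ((1 - p / 2) ^ ((m : ℝ)⁻¹)) with hρ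
  have hρ0 : 0 < ρ := lt_max_of_lt_left hsq0
  have hρ1 : ρ < 1 := max_lt hsq1 (Real.rpow_lt_one hb0.le (by linarith) (by positivity))
  have hρm : 1 - p / 2 ≤ ρ ^ m := by
    have : ((1 - p / 2) ^ ((m : ℝ)⁻¹)) ^ m = 1 - p / 2 := by
      rw [← Real.rpow_natCast, ← Real.rpow_mul hb0.le, inv_mul_cancel₀ (by positivity),
        Real.rpow_one]
    rw [← this]
    gcongr
    exact le_max_right _ _
  have hqρ : q / ρ ≤ √q := by
    rw [div_le_iff₀ hρ0]
    calc q = √q * √q := (Real.mul_self_sqrt hq0.le).symm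
      _ ≤ √q * ρ := by gcongr; exact le_max_left _ _
  -- This makes the bound trivial for `j ≤ m`, the base of the induction.
  set D := (ρ ^ m)⁻¹ with hD
  have hD0 : 0 < D := by positivity
  refine ⟨D, ρ, hD0, hρ0, hρ1, fun n => ?_⟩
  induction n using Nat.strong_induction_on with
  | _ n ih =>
    intro j y hjn
    rcases le_or_gt j m with hjm | hjm
    · refine (Pr_le_one _ _).trans ?_
      rw [ENNReal.one_le_ofReal, hD, inv_mul_eq_div, one_le_div (by positivity)]
      exact pow_le_pow_of_le_one hρ0.le hρ1.le hjm
    obtain ⟨n', rfl⟩ := Nat.exists_eq_add_of_le (hjm.le.trans hjn)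
    set c := D * ρ ^ (j - m) with hc
    have hc0 : 0 < c := by positivity
    have hgen : ∀ l₁ : List G, l₁.length = m →
        Pr μ n' {l' | l₁ ++ l' ∈ {l | ¬ Matches W κ A x j y l}} ≤ ENNReal.ofReal c := by
      intro l₁ hl₁
      refine (Pr_mono fun l' _ _ hl' => ?_).trans
        (ih n' (by omega) (j - m) (l₁.prod⁻¹ • y) (by omega))
      intro hM
      rw [← hl₁] at hM
      exact hl' hM.append_left
    -- After the right word, a failure to match means that divergence breaks at some time `i`, and
    -- that the steps after `i`, which are independent of this, also fail with the remaining budget.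
    -- Summing over `i` gives a factor of at most one half by the choice of `A`.
    have hspec : Pr μ n' {l' | W y ++ l' ∈ {l | ¬ Matches W κ A x j y l}} ≤
        ENNReal.ofReal (c / 2) := by
      set z := (W y).prod⁻¹ • y with hz
      set fail : ℕ → Set (List G) := fun i => {u | dist z (u.prod • x) < dist z x + κ * i - A}
      calc Pr μ n' {l' | W y ++ l' ∈ {l | ¬ Matches W κ A x j y l}}
          ≤ Pr μ n' (⋃ i ∈ Finset.Ico 0 (n' + 1), {l | l.take i ∈ fail i ∧
              ¬ Matches W κ A x (j - m - i) ((l.take i).prod⁻¹ • z) (l.drop i)}) := by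
            refine Pr_mono fun l hl _ hM => ?_
            have h1 := not_matches_word (by omega) hM
            simp only [Diverges, not_forall, not_le] at h1
            obtain ⟨i, hi, hlt⟩ := h1
            simp only [Set.mem_iUnion]
            refine ⟨i, Finset.mem_Ico.2 ⟨Nat.zero_le _, by omega⟩, hlt, fun hM' => hM ?_⟩
            refine Matches.append_left ?_
            rw [hW, ← List.take_append_drop i l]
            refine Matches.append_left ?_
            rwa [List.length_take, min_eq_left hi]
        _ ≤ ∑ i ∈ Finset.Ico 0 (n' + 1), ENNReal.ofReal (c * (B * Real.exp (-(t * A))) * √q ^ i) := by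
            refine (Pr_biUnion_le _ _ _).trans (Finset.sum_le_sum fun i hi => ?_)
            have hi' : i ≤ n' := by have := (Finset.mem_Ico.1 hi).2; omega
            obtain ⟨k, rfl⟩ := Nat.exists_eq_add_of_le hi'
            rw [Pr_append]
            calc _ ≤ Ex μ i (fun u => (fail i).indicator 1 u *
                  ENNReal.ofReal (D * ρ ^ (j - m - i))) := by
                  refine Ex_mono fun u hu _ => ?_
                  by_cases hf : u ∈ fail i
                  · rw [Set.indicator_of_mem hf, Pi.one_apply, one_mul]
                    refine (Pr_mono fun v _ _ hv => ?_).trans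
                      (ih k (by omega) (j - m - i) (u.prod⁻¹ • z) (by omega))
                    have := hv.2
                    rwa [← hu, List.take_left, List.drop_left, hu] at this
                  · rw [Set.indicator_of_notMem hf, zero_mul]
                    refine (Pr_mono (T := ∅) fun v _ _ hv => ?_).trans (by simp [Pr, Ex_const])
                    have := hv.1
                    rw [← hu, List.take_left, hu] at this
                    exact hf this
              _ ≤ ENNReal.ofReal (B * q ^ i * Real.exp (-(t * A))) *
                  ENNReal.ofReal (D * ρ ^ (j - m - i)) := by
                  rw [Ex_mul_const]
                  gcongr
                  exact hd.bound i z A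
              _ ≤ _ := by
                  rw [← ENNReal.ofReal_mul (by positivity)]
                  refine ENNReal.ofReal_le_ofReal ?_
                  -- Only an inequality: the budget `j - m - i` is truncated at zero once `i`
                  -- exceeds `j - m`.
                  have h1 : ρ ^ (j - m - i) * ρ ^ i ≤ ρ ^ (j - m) := by
                    rw [← pow_add]
                    exact pow_le_pow_of_le_one hρ0.le hρ1.le (by omega)
                  have h2 : q ^ i ≤ √q ^ i * ρ ^ i := by
                    rw [← mul_pow]
                    gcongr
                    rwa [div_le_iff₀ hρ0] at hqρ
                  calc B * q ^ i * Real.exp (-(t * A)) * (D * ρ ^ (j - m - i))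
                      ≤ B * (√q ^ i * ρ ^ i) * Real.exp (-(t * A)) * (D * ρ ^ (j - m - i)) := by
                        gcongr
                    _ = D * (ρ ^ (j - m - i) * ρ ^ i) * (B * Real.exp (-(t * A))) * √q ^ i := by ring
                    _ ≤ _ := by rw [hc]; gcongr
        _ ≤ _ := by
            rw [← ENNReal.ofReal_sum_of_nonneg (fun i _ => by positivity), ← Finset.mul_sum]
            refine ENNReal.ofReal_le_ofReal ?_
            calc c * (B * Real.exp (-(t * A))) * ∑ i ∈ Finset.Ico 0 (n' + 1), √q ^ i
                ≤ c * (B * Real.exp (-(t * A))) * (√q ^ 0 / (1 - √q)) := by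
                  gcongr
                  exact sum_geometric_le hsq0.le hsq1 _ _
              _ = c * (B * Real.exp (-(t * A)) / (1 - √q)) := by rw [pow_zero]; ring
              _ ≤ c * (1 / 2) := by gcongr
              _ = c / 2 := by ring
    have hsum := Pr_add_compl (μ := μ) m {W y}
    set P := Pr μ m {W y}
    set P' := Pr μ m {W y}ᶜ
    have hPt : P ≠ ⊤ := ne_top_of_le_ne_top ENNReal.one_ne_top (Pr_le_one _ _)
    have hP't : P' ≠ ⊤ := ne_top_of_le_ne_top ENNReal.one_ne_top (Pr_le_one _ _)
    have hPr : p ≤ P.toReal := by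
      rw [← ENNReal.ofReal_le_iff_le_toReal hPt]; exact hp y
    have hsumr : P.toReal + P'.toReal = 1 := by
      rw [← ENNReal.toReal_add hPt hP't, hsum, ENNReal.toReal_one]
    calc Pr μ (m + n') {l | ¬ Matches W κ A x j y l}
        ≤ Ex μ m (fun l₁ => ({W y} : Set (List G)).indicator 1 l₁ * ENNReal.ofReal (c / 2) +
            ({W y}ᶜ : Set (List G)).indicator 1 l₁ * ENNReal.ofReal c) := by
          rw [Pr_append]
          refine Ex_mono fun l₁ hl₁ _ => ?_
          by_cases hl : l₁ = W y
          · subst hl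
            simpa using hspec
          · simpa [hl] using hgen l₁ hl₁
      _ = P * ENNReal.ofReal (c / 2) + P' * ENNReal.ofReal c := by
          rw [Ex_add, Ex_mul_const, Ex_mul_const]; rfl
      _ = ENNReal.ofReal (P.toReal * (c / 2) + P'.toReal * c) := by
          rw [ENNReal.ofReal_add (by positivity) (by positivity),
            ENNReal.ofReal_mul ENNReal.toReal_nonneg, ENNReal.ofReal_mul ENNReal.toReal_nonneg,
            ENNReal.ofReal_toReal hPt, ENNReal.ofReal_toReal hP't]
      _ ≤ _ := by
          refine ENNReal.ofReal_le_ofReal ?_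
          -- The bound improves by half on an event of probability at least `p`, hence by `1 - p /
          -- 2` on average.
          have h1 : P.toReal * (c / 2) + P'.toReal * c ≤ (1 - p / 2) * c := by nlinarith
          have h2 : (1 - p / 2) * c ≤ ρ ^ m * c := by gcongr
          have h3 : ρ ^ m * c = D * ρ ^ j := by
            rw [hc, ← Nat.add_sub_cancel' hjm.le, pow_add, Nat.add_sub_cancel_left]; ring
          linarith

end Matching

/-! ### Stability of small Gromov products. -/

section Geometry

variable {X : Type*} [MetricSpace X] {δ : ℝ}

/-- If `[z, b]` passes near `a`, `[z, e]` passes near `b`, and `a`, `b` are far apart, the two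
segments still travel together at `a`. -/
lemma FourPoint.gp_le_of_long (h4 : FourPoint X δ) {z a b e : X} {c₀ c₂ : ℝ} (h1 : gp a z b ≤ c₂)
    (h2 : gp b z e ≤ c₀) (h3 : c₀ + c₂ + 2 * δ < dist a b) : gp a z e ≤ c₂ + δ := by
  have hδ : 0 ≤ δ := by have : Nonempty X := ⟨z⟩; exact h4.nonneg
  have h5 := gp_base_swap b a z
  rw [dist_comm, gp_comm a b z] at h5
  have h6 : gp b e a ≤ c₀ + δ := by
    refine h4.gp_le (b := z) (by rwa [gp_comm]) ?_
    rw [gp_comm]; linarith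
  have h7 := gp_base_swap a b e
  rw [gp_comm b a e] at h7
  exact h4.gp_le h1 (by linarith)

/-- Moving the ends of a segment does not change the Gromov product at a point far from them. -/
lemma FourPoint.gp_le_of_near (h4 : FourPoint X δ) {o a b a' b' : X} {c r : ℝ} (h : gp o a b ≤ c)
    (ha : dist a a' ≤ r) (hb : dist b b' ≤ r) (hoa : r + c + 2 * δ < dist o a)
    (hob : r + c + 2 * δ < dist o b) : gp o a' b' ≤ c + 2 * δ := by
  have h1 := dist_sub_dist_le_gp o a a'
  have h2 := dist_sub_dist_le_gp o b b'
  have hδ : 0 ≤ δ := by have : Nonempty X := ⟨o⟩; exact h4.nonneg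
  have h3 : gp o a b' ≤ c + δ := h4.gp_le h (by linarith)
  rw [gp_comm] at h3 ⊢
  have h5 := h4.gp_le h3 (c := a') (by linarith)
  linarith

/-- A `(1, K)`-quasigeodesic passes near `x` if the Gromov product of two of its points is
small. -/
lemma FourPoint.exists_dist_quasigeodesic_le (h4 : FourPoint X δ) {K : ℝ} {γ : ℝ → X}
    (hγ : IsQuasigeodesicOn 1 K Set.univ γ) (x : X) (s t : ℝ) :
    ∃ r, dist x (γ r) ≤ gp x (γ s) (γ t) + 5 * K + 2 * δ := by
  wlog hst : s ≤ t generalizing s t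
  · rw [gp_comm]; exact this t s (le_of_not_ge hst)
  have hq : ∀ a b : ℝ, a ≤ b → b - a - K ≤ dist (γ a) (γ b) ∧ dist (γ a) (γ b) ≤ b - a + K := by
    intro a b hab
    have := hγ a trivial b trivial
    rwa [abs_sub_comm, abs_of_nonneg (by linarith), inv_one, one_mul] at this
  set e := gp (γ s) x (γ t)
  have he0 : 0 ≤ e := gp_nonneg _ _ _
  have heT : e ≤ t - s + K := (gp_le_right _ _ _).trans (hq s t hst).2
  -- `e` is the distance from `γ s` at which the side to `γ t` comes closest to `x`; it is capped to
  -- stay in the parameter interval, which costs at most `K`.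
  set ρ := min e (t - s) with hρ
  have hρ0 : 0 ≤ ρ := le_min he0 (by linarith)
  have hρe : ρ ≤ e := min_le_left _ _
  have hρT : ρ ≤ t - s := min_le_right _ _
  have hK : 0 ≤ K := by
    have := (hq s s le_rfl).2
    simpa using this
  have heρ : e - K ≤ ρ := le_min (by linarith) (by linarith)
  obtain ⟨a1, a2⟩ := hq s (s + ρ) (by linarith)
  obtain ⟨b1, b2⟩ := hq (s + ρ) t (by linarith)
  obtain ⟨c1, c2⟩ := hq s t hst
  have h1 : ρ - 3 / 2 * K ≤ gp (γ s) (γ t) (γ (s + ρ)) := by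
    rw [gp_comm]; simp only [gp]; linarith
  have h2 := h4 (γ s) x (γ t) (γ (s + ρ))
  have h3 : ρ - 3 / 2 * K ≤ min (gp (γ s) x (γ t)) (gp (γ s) (γ t) (γ (s + ρ))) :=
    le_min (by linarith) h1
  have h5 := dist_eq_gp (γ s) x (γ (s + ρ))
  have h6 := gp_base_swap x (γ s) (γ t)
  rw [dist_comm x (γ s)] at h6
  exact ⟨s + ρ, by linarith⟩

end Geometry

/-! ### Quasi-axes, conjugation of stabilizers, and the WPD condition. -/

section Axes

variable {G : Type*} [Group G] {X : Type*} [MetricSpace X] [MulAction G X] [IsIsometricSMul G X]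
  {δ : ℝ} {x : X}

lemma IsQuasiAxis.pow_smul_mem {K : ℝ} {w : G} {α : Set X} (h : IsQuasiAxis K w α) {p : X}
    (hp : p ∈ α) (i : ℕ) : w ^ i • p ∈ α ∧ w⁻¹ ^ i • p ∈ α := by
  have h1 : ∀ q ∈ α, w • q ∈ α := fun q hq => h.2 ▸ ⟨q, hq, rfl⟩
  have h2 : ∀ q ∈ α, w⁻¹ • q ∈ α := by
    intro q hq
    rw [← h.2] at hq
    obtain ⟨q', hq', rfl⟩ := hq
    simpa using hq'
  induction i with
  | zero => simpa using hp
  | succ i ih =>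
    rw [pow_succ', pow_succ', mul_smul, mul_smul]
    exact ⟨h1 _ ih.1, h2 _ ih.2⟩

/-- A quasi-axis of `w` passes near `x` if `(w⁻¹ x | w x)_x` is small compared to `d(x, w x)`. -/
lemma dist_closestPoint_le (h4 : FourPoint X δ) (hδ : 0 ≤ δ) {w : G} {R K : ℝ} (hR : 0 ≤ R)
    (h1 : gp x (w⁻¹ • x) (w • x) ≤ R) (h2 : 2 * R + 3 * δ < dist x (w • x)) {α : Set X} {p : X}
    (hα : IsQuasiAxis K w α) (hp : IsClosestPoint x α p) :
    dist x p ≤ R + 6 * δ + 5 * K := by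
  -- For such `i`, the points `w ^ i • p` and `w⁻¹ ^ i • p` of the quasi-axis have, up to `δ`, the
  -- directions of the orbit points of `x`, so the axis crosses near `x`.
  obtain ⟨i, hi⟩ : ∃ i : ℕ, dist x p + R + 4 * δ < dist x (w ^ i • x) := by
    obtain ⟨i, hi⟩ := exists_nat_gt
      ((dist x p + R + 4 * δ) / (dist x (w • x) - 2 * R - 2 * δ))
    rw [div_lt_iff₀ (by linarith)] at hi
    have := le_dist_pow h4 hδ hR (by linarith) h1 le_rfl i
    exact ⟨i, by linarith⟩
  have h3 := gp_pow_le h4 hδ hR h2 h1 le_rfl i i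
  have h5 : gp x (w⁻¹ ^ i • p) (w ^ i • p) ≤ R + 4 * δ := by
    have e1 : ∀ v : G, dist x (v • x) - dist x p ≤ gp x (v • x) (v • p) := fun v => by
      simpa only [dist_smul] using dist_sub_dist_le_gp x (v • x) (v • p)
    have e2 := e1 (w ^ i)
    have e3 := e1 (w⁻¹ ^ i)
    rw [inv_pow, dist_inv_smul_self, ← inv_pow] at e3
    have e4 := h4.gp_le h3 (c := w ^ i • p) (by linarith)
    rw [gp_comm] at e4 ⊢
    have e5 := h4.gp_le e4 (c := w⁻¹ ^ i • p) (by linarith)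
    linarith
  obtain ⟨m1, m2⟩ := hα.pow_smul_mem hp.1 i
  obtain ⟨⟨γ, hγ, rfl⟩, -⟩ := hα
  obtain ⟨t, ht⟩ := m1
  obtain ⟨s, hs⟩ := m2
  obtain ⟨r, hr⟩ := h4.exists_dist_quasigeodesic_le hγ x s t
  rw [hs, ht] at hr
  have := hp.2 (γ r) ⟨r, rfl⟩
  linarith

/-- An element displacing `P` and `Q` little displaces every point near `[P, Q]` little; conjugation
by `u` moves two such points to `x` and `f • x` and is injective. -/
lemma encard_jointStab_le (h4 : FourPoint X δ) {P Q : X} {u f : G} {K c : ℝ}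
    (h1 : gp (u • x) P Q ≤ c) (h2 : gp (u • f • x) P Q ≤ c) :
    (jointStab G K P Q).encard ≤ (jointStab G (7 * K + 2 * c + 2 * δ) x (f • x)).encard := by
  refine Set.encard_le_encard_of_injOn (f := fun g => u⁻¹ * g * u) ?_ ?_
  · rintro g ⟨hP, hQ⟩
    have key : ∀ o : X, gp (u • o) P Q ≤ c →
        dist o ((u⁻¹ * g * u) • o) ≤ 7 * K + 2 * c + 2 * δ := by
      intro o ho
      have := h4.dist_smul_le hP hQ ho
      rwa [dist_smul_left, ← mul_smul, ← mul_smul] at this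
    exact ⟨key _ h1, key _ h2⟩
  · intro a _ b _ hab
    simpa using hab

/-- Powers of a WPD element have finite joint stabilizers from some point on. -/
lemma IsWPD.exists_finite (h4 : FourPoint X δ) (hδ : 0 ≤ δ) {h : G} (hw : IsWPD X h) (x : X)
    {K : ℝ} (hK : 0 ≤ K) : ∃ M₀ : ℕ, ∀ M ≥ M₀, (jointStab G K x (h ^ M • x)).Finite := by
  obtain ⟨C, hC⟩ := hw.1.exists_gp_le h4 hδ x
  have hC0 : 0 ≤ C := (gp_nonneg _ _ _).trans (hC 0 0)
  -- The orbit point at time `M₀` is near the segment to any later one, so the larger constant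
  -- accounts for its displacement.
  obtain ⟨M₀, -, hfin⟩ := hw.2 (7 * K + 2 * C + 2 * δ) (by positivity) x
  refine ⟨M₀, fun M hM => hfin.subset ?_⟩
  rintro g ⟨g1, g2⟩
  refine ⟨by linarith, h4.dist_smul_le g1 g2 ?_⟩
  rw [gp_smul_base, ← inv_pow, ← mul_smul]
  have : h⁻¹ ^ M₀ * h ^ M = h ^ (M - M₀) := by
    rw [inv_pow, inv_mul_eq_iff_eq_mul, ← pow_add, Nat.add_sub_cancel' hM]
  rw [this]
  exact hC _ _

end Axes

/-! ### What a match says about the segment to the end of the walk. -/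

section MatchGeometry

variable {G : Type*} [Group G] {X : Type*} [MetricSpace X] [MulAction G X] [IsIsometricSMul G X]
  {δ : ℝ} {x : X}

/-- At a match, the geodesic from `y` to the end of the walk passes near `u x` and `u f x`, where
`u` is a location of the walk. -/
lemma Matches.exists_gp_le (hX : GromovSpace X δ) {C E L κ A : ℝ} {s m : ℕ}
    {word : Fin 8 → List G} (hS : IsSchottky x δ C E fun i => (word i).prod) {F : List G}
    (hL : 0 ≤ L) (hκ : 0 ≤ κ) (hs : 2 * δ ≤ κ * s) (hs0 : 0 < s) {idx : X → Fin 8}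
    (hidx : ∀ z, gp x z ((word (idx z)).prod • x) ≤ C + δ ∧
      gp x ((word (idx z)).prod⁻¹ • x) (F.prod • x) ≤ C + δ)
    (hm : ∀ z, (word (idx z) ++ F).length = m)
    (hlong : (A + L * s + 2 * δ) + (C + 2 * δ) + 2 * δ < dist x (F.prod • x))
    {j : ℕ} {y : X} {l : List G} (hl : ∀ g ∈ l, dist x (g • x) ≤ L)
    (h : Matches (fun z => word (idx z) ++ F) κ A x j y l) :
    ∃ k k' : ℕ, k ≤ l.length ∧ k' ≤ l.length ∧ k ≤ j + m ∧ k' ≤ j + m ∧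
      (l.take k').prod = (l.take k).prod * F.prod ∧
      gp ((l.take k).prod • x) y (l.prod • x) ≤ C + 3 * δ ∧
      gp ((l.take k).prod • F.prod • x) y (l.prod • x) ≤ A + L * s + 2 * δ := by
  obtain ⟨l₁, l₃, hl₁₃, hlen, hdiv⟩ := h
  set z := l₁.prod⁻¹ • y with hz
  simp only at hl₁₃ hdiv
  set w := word (idx z) with hw
  set u := (l₁ ++ w).prod with hu
  have hlw : (w ++ F).length = m := hm z
  rw [List.length_append] at hlw
  have e0 : l = (l₁ ++ w) ++ (F ++ l₃) := by rw [hl₁₃]; simp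
  have e0' : l = (l₁ ++ w ++ F) ++ l₃ := by rw [hl₁₃]; simp
  have t1 : l.take (l₁ ++ w).length = l₁ ++ w := by rw [e0, List.take_left]
  have t2 : l.take (l₁ ++ w ++ F).length = l₁ ++ w ++ F := by rw [e0', List.take_left]
  have b1 : gp (u • x) y (u • F.prod • x) ≤ C + 2 * δ := by
    rw [gp_smul_base, inv_smul_smul, hu, List.prod_append, mul_inv_rev, mul_smul]
    exact hS.gp_le hX.fourPoint hX.nonneg (hidx z).1 (hidx z).2
  have b2 : gp (u • F.prod • x) y (l.prod • x) ≤ A + L * s + 2 * δ := by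
    have hl₃ : ∀ g ∈ l₃, dist x (g • x) ≤ L := fun g hg => hl g (by
      rw [e0']; exact List.mem_append_right _ hg)
    have := hdiv.gp_le hX hL hκ hs hs0 hl₃
    refine le_trans (le_of_eq ?_) this
    rw [← mul_smul, gp_smul_base, e0', hz]
    simp only [hu, List.prod_append, mul_inv_rev, mul_smul, inv_smul_smul]
  have b3 := hX.fourPoint.gp_le_of_long b1 b2 (by rw [dist_smul]; exact hlong)
  refine ⟨(l₁ ++ w).length, (l₁ ++ w ++ F).length, ?_, ?_, ?_, ?_, ?_, ?_, ?_⟩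
  · rw [e0]; simp
  · rw [e0']; simp
  · simp only [List.length_append]; omega
  · simp only [List.length_append]; omega
  · rw [t1, t2, List.prod_append (l₁ := l₁ ++ w)]
  · rw [t1]; linarith
  · rw [t1]; exact b2

end MatchGeometry

/-! ### Conditioning on the first or on the last steps. -/

section Conditioning

open scoped ENNReal

variable {G : Type*} {μ : PMF G}

lemma Ex_swap (m n : ℕ) (F : List G → List G → ℝ≥0∞) :
    Ex μ m (fun u => Ex μ n fun v => F u v) = Ex μ n fun v => Ex μ m fun u => F u v := by
  induction m generalizing F with
  | zero => rfl
  | succ m ih => simp only [Ex, ih, Ex_tsum, Ex_const_mul]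

lemma Pr_split_le_left {a n : ℕ} (ha : a ≤ n) {Q : List G → List G → Prop} {c : ℝ≥0∞}
    (h : ∀ u, Pr μ (n - a) {v | Q u v} ≤ c) : Pr μ n {l | Q (l.take a) (l.drop a)} ≤ c := by
  obtain ⟨k, rfl⟩ := Nat.exists_eq_add_of_le ha
  rw [Nat.add_sub_cancel_left] at h
  rw [Pr_append, ← Ex_const (μ := μ) a c]
  refine Ex_mono fun u hu _ => (le_of_eq ?_).trans (h u)
  congr 1
  ext v
  simp [← hu]

/-- Fixing the later steps and averaging over the earlier ones requires exchanging the sums, by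
`Ex_swap`. -/
lemma Pr_split_le_right {a n : ℕ} (ha : a ≤ n) {Q : List G → List G → Prop} {c : ℝ≥0∞}
    (h : ∀ v, Pr μ a {u | Q u v} ≤ c) : Pr μ n {l | Q (l.take a) (l.drop a)} ≤ c := by
  classical
  obtain ⟨k, rfl⟩ := Nat.exists_eq_add_of_le ha
  have h1 : Pr μ (a + k) {l | Q (l.take a) (l.drop a)} =
      Ex μ a fun u => Ex μ k fun v => if Q u v then 1 else 0 := by
    rw [Pr, Ex_append]
    refine Ex_congr fun u hu => Ex_congr fun v _ => ?_
    simp [Set.indicator_apply, ← hu]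
  rw [h1, Ex_swap, ← Ex_const (μ := μ) k c]
  refine Ex_mono fun v _ _ => (le_of_eq ?_).trans (h v)
  refine Ex_congr fun u _ => ?_
  simp [Set.indicator_apply]

end Conditioning

/-! ### Deep matches and the final probability estimates. -/

section Final

open scoped ENNReal

variable {G : Type*} [Group G] {X : Type*} [MetricSpace X] [MulAction G X] [IsIsometricSMul G X]
  {δ : ℝ} {μ : PMF G} {x : X}

lemma take_prod_mul_drop_prod (l : List G) (a : ℕ) :
    (l.take a).prod * (l.drop a).prod = l.prod := by
  rw [← List.prod_append, List.take_append_drop]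

/-- A walk that moves away linearly from the past and the future has a small Gromov product
`(w⁻¹ x | w x)_x`. -/
lemma gp_inv_prod_le (h4 : FourPoint X δ) {u v : G} {r d : ℝ} (hu : d ≤ dist x (u • x))
    (hv : d ≤ dist x (v • x)) (h1 : gp x (v⁻¹ • x) (u • x) ≤ r)
    (h2 : gp x (u⁻¹ • x) (v • x) ≤ r) (hd : 2 * r + 2 * δ < d) :
    gp x ((u * v)⁻¹ • x) ((u * v) • x) ≤ r + 2 * δ := by
  have hδ : 0 ≤ δ := by have : Nonempty X := ⟨x⟩; exact h4.nonneg
  have e1 : gp x (u • x) ((u * v) • x) = dist x (u • x) - gp x (u⁻¹ • x) (v • x) := by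
    rw [gp_base_swap, gp_smul_base, mul_smul, inv_smul_smul]
  have e2 : gp x (v⁻¹ • x) ((u * v)⁻¹ • x) = dist x (v • x) - gp x (u⁻¹ • x) (v • x) := by
    rw [gp_base_swap, gp_smul_base, inv_inv, mul_inv_rev, mul_smul, smul_inv_smul,
      dist_inv_smul_self, gp_comm x (v • x)]
  have h3 := h4.gp_le h1 (c := (u * v) • x) (by linarith)
  rw [gp_comm] at h3 ⊢
  have h5 := h4.gp_le h3 (c := (u * v)⁻¹ • x) (by linarith)
  linarith

/-- The two geometric properties of `w` which bound joint stabilizers along its quasi-axes. -/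
def HasDeepMatch (x : X) (δ c r K₁ : ℝ) (f w : G) : Prop :=
  gp x (w⁻¹ • x) (w • x) ≤ r ∧ 2 * r + 3 * δ < dist x (w • x) ∧
    ∃ u : G, ∀ o ∈ ({u • x, u • f • x} : Set X), gp o x (w • x) ≤ c ∧
      r + 8 * δ + 5 * K₁ + c < dist o x ∧ r + 8 * δ + 5 * K₁ + c < dist o (w • x)

lemma HasDeepMatch.isLoxodromic (h4 : FourPoint X δ) (hδ : 0 ≤ δ) {c r K₁ : ℝ} {f w : G}
    (h : HasDeepMatch x δ c r K₁ f w) : IsLoxodromic X w := by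
  have hr : 0 ≤ r := (gp_nonneg _ _ _).trans h.1
  refine isLoxodromic_of_linear (x := x) (c := dist x (w • x) - 2 * r - 2 * δ) ?_
    (le_dist_pow h4 hδ hr ?_ h.1 le_rfl) <;> linarith [h.2.1]

lemma HasDeepMatch.encard_le (h4 : FourPoint X δ) (hδ : 0 ≤ δ) {c r K K₁ : ℝ} {f w : G}
    (h : HasDeepMatch x δ c r K₁ f w) {α : Set X} {p : X} (hα : IsQuasiAxis K₁ w α)
    (hp : IsClosestPoint x α p) : (jointStab G K p (w • p)).encard ≤
      (jointStab G (7 * K + 2 * (c + 2 * δ) + 2 * δ) x (f • x)).encard := by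
  obtain ⟨h1, h2, u, hu⟩ := h
  have hr : 0 ≤ r := (gp_nonneg _ _ _).trans h1
  -- The ends move by at most `r + 6 * δ + 5 * K₁`; the depth `r + 8 * δ + 5 * K₁ + c` adds the `c +
  -- 2 * δ` needed by `FourPoint.gp_le_of_near`.
  have hxp := dist_closestPoint_le h4 hδ hr h1 h2 hα hp
  have key : ∀ o ∈ ({u • x, u • f • x} : Set X), gp o p (w • p) ≤ c + 2 * δ := by
    intro o ho
    obtain ⟨a1, a2, a3⟩ := hu o ho
    exact h4.gp_le_of_near a1 hxp (by rwa [dist_smul]) (by linarith) (by linarith)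
  exact encard_jointStab_le h4 (key (u • x) (by simp)) (key (u • f • x) (by simp))

/-- Matches in the middle of a walk which makes linear progress are deep. -/
lemma hasDeepMatch_of_matches (hX : GromovSpace X δ) {C E L κ A Y c K₁ : ℝ} {s m : ℕ}
    {word : Fin 8 → List G} (hS : IsSchottky x δ C E fun i => (word i).prod) {F : List G}
    (hL : 0 ≤ L) (hκ : 0 ≤ κ) (hs : 2 * δ ≤ κ * s) (hs0 : 0 < s) {idx : X → Fin 8}
    (hidx : ∀ z, gp x z ((word (idx z)).prod • x) ≤ C + δ ∧
      gp x ((word (idx z)).prod⁻¹ • x) (F.prod • x) ≤ C + δ)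
    (hm : ∀ z, (word (idx z) ++ F).length = m)
    (hlong : (A + L * s + 2 * δ) + (C + 2 * δ) + 2 * δ < dist x (F.prod • x))
    {a : ℕ} {l : List G} (hl : ∀ g ∈ l, dist x (g • x) ≤ L) (hma : m ≤ a) (ha : 4 * a ≤ l.length)
    (hc1 : C + 3 * δ ≤ c) (hc2 : A + L * s + 2 * δ ≤ c) (hY : 0 ≤ Y) (hK₁ : 0 ≤ K₁)
    (hlarge : 3 * Y + (2 * (L * s) + 20 * δ + 5 * K₁ + c) < κ * a)
    (g1 : Matches (fun z => word (idx z) ++ F) κ A x a ((l.take a).prod⁻¹ • x) (l.drop a))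
    (g2 : Diverges κ Y x x l)
    (g3 : ∀ i ≤ l.length - a, κ * a ≤ dist x ((l.drop i).prod • x))
    (g4 : Diverges κ Y x ((l.drop a).prod⁻¹ • x) (l.take a))
    (g5 : Diverges κ Y x ((l.take a).prod⁻¹ • x) (l.drop a)) :
    HasDeepMatch x δ c (Y + L * s + 4 * δ) K₁ F.prod l.prod := by
  have hδ := hX.nonneg
  have hLs : 0 ≤ L * s := by positivity
  have hc0 : 0 ≤ c := le_trans (by linarith [hS.nonneg]) hc1
  have hfar : ∀ i, a ≤ i → i ≤ l.length → κ * a - Y ≤ dist x ((l.take i).prod • x) := by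
    intro i hai hil
    have h1 := g2 i hil
    rw [dist_self] at h1
    have h2 : κ * a ≤ κ * i := by gcongr
    linarith
  set u := (l.take a).prod with hu
  set v := (l.drop a).prod with hv
  have huv : u * v = l.prod := take_prod_mul_drop_prod l a
  have b1 := g4.gp_le hX hL hκ hs hs0 fun g hg => hl g (List.mem_of_mem_take hg)
  have b2 := g5.gp_le hX hL hκ hs hs0 fun g hg => hl g (List.mem_of_mem_drop hg)
  have b3 := gp_inv_prod_le hX.fourPoint (d := κ * a - Y) (hfar a le_rfl (by omega))
    (by linarith [g3 a (by omega)]) b1 b2 (by linarith)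
  rw [huv] at b3
  have hlast := hfar l.length (by omega) le_rfl
  rw [List.take_length] at hlast
  obtain ⟨k, k', hk, hk', hkj, hk'j, hkk', e1, e2⟩ := g1.exists_gp_le hX hS hL hκ hs hs0 hidx hm
    hlong fun g hg => hl g (List.mem_of_mem_drop hg)
  rw [List.length_drop] at hk hk'
  have htake : ∀ i, (l.take (a + i)).prod = u * ((l.drop a).take i).prod := by
    intro i
    rw [List.take_add, List.prod_append]
  -- The indices found satisfy `a + i ≤ 3 * a`, so at least `a` steps of the walk remain on either
  -- side, and both ends are far away.
  have hpoint : ∀ i, i ≤ l.length - a → i ≤ a + m →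
      gp (((l.drop a).take i).prod • x) (u⁻¹ • x) (v • x) ≤ c →
      gp ((l.take (a + i)).prod • x) x (l.prod • x) ≤ c ∧
      Y + L * s + 4 * δ + 8 * δ + 5 * K₁ + c < dist ((l.take (a + i)).prod • x) x ∧
      Y + L * s + 4 * δ + 8 * δ + 5 * K₁ + c < dist ((l.take (a + i)).prod • x) (l.prod • x) := by
    intro i hi him hgp
    refine ⟨?_, ?_, ?_⟩
    · rwa [htake, mul_smul, gp_smul_base, ← huv, mul_smul, inv_smul_smul]
    · have := hfar (a + i) (by omega) (by omega)
      rw [dist_comm]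
      linarith
    · have := g3 (a + i) (by omega)
      rw [← take_prod_mul_drop_prod l (a + i), mul_smul, dist_smul]
      linarith
  refine ⟨by linarith, by linarith, (l.take (a + k)).prod, fun o ho => ?_⟩
  rcases ho with rfl | rfl
  · exact hpoint k (by omega) hkj (e1.trans hc1)
  · have : (l.take (a + k)).prod • F.prod • x = (l.take (a + k')).prod • x := by
      rw [htake, htake, hkk', mul_smul, mul_smul, mul_smul]
    rw [this]
    refine hpoint k' (by omega) hk'j ?_
    rw [hkk', mul_smul]
    exact e2.trans hc2

lemma IsSchottky.exists_index (h4 : FourPoint X δ) {C E : ℝ} {s : Fin 8 → G}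
    (h : IsSchottky x δ C E s) (y z : X) :
    ∃ i, gp x y (s i • x) ≤ C + δ ∧ gp x ((s i)⁻¹ • x) z ≤ C + δ := by
  by_contra! hcon
  have h1 := h.card_bad_le h4 y z
  rw [Finset.filter_true_of_mem fun i _ hi => absurd hi.2 (not_le.2 (hcon i hi.1))] at h1
  simp at h1

/-- A suffix of `k` steps is itself distributed as a walk of length `k`; the union bound runs over
`k ≥ a`. -/
lemma LinearDrift.Pr_short_suffix_le {κ t B q : ℝ} (hd : LinearDrift μ x κ t B q) {n : ℕ} (a : ℕ) :
    Pr μ n {l | ¬ ∀ i ≤ l.length - a, a ≤ l.length → κ * a ≤ dist x ((l.drop i).prod • x)} ≤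
      ENNReal.ofReal (B / (1 - q) * q ^ a) := by
  have hq := hd.base_lt_one
  have hκ := hd.speed_pos
  have hB := hd.const_pos
  have hq0 := hd.base_pos
  calc _ ≤ Pr μ n (⋃ k ∈ Finset.Ico a (n + 1), {l | l.drop (n - k) ∈
          {l | dist x (l.prod • x) < dist x x + κ * k - 0}}) := by
        refine Pr_mono fun l hl _ hbad => ?_
        simp only [Set.mem_ofPred_eq, not_forall, not_le] at hbad
        obtain ⟨i, hi, hal, hlt⟩ := hbad
        simp only [Set.mem_iUnion]
        refine ⟨n - i, Finset.mem_Ico.2 ⟨by omega, by omega⟩, ?_⟩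
        have hk : (a : ℝ) ≤ (n - i : ℕ) := by exact_mod_cast (by omega : a ≤ n - i)
        simp only [Set.mem_ofPred_eq, dist_self, zero_add, sub_zero]
        rw [show n - (n - i) = i by omega]
        exact hlt.trans_le (by gcongr)
    _ ≤ ∑ k ∈ Finset.Ico a (n + 1), ENNReal.ofReal (B * q ^ k) := by
        refine (Pr_biUnion_le _ _ _).trans (Finset.sum_le_sum fun k hk => ?_)
        have := (Finset.mem_Ico.1 hk).2
        rw [Pr_drop (by omega), show n - (n - k) = k by omega]
        simpa using hd.bound k x 0
    _ ≤ _ := by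
        rw [← ENNReal.ofReal_sum_of_nonneg (fun i _ => by positivity), ← Finset.mul_sum]
        refine ENNReal.ofReal_le_ofReal ?_
        rw [div_mul_eq_mul_div, mul_div_assoc]
        gcongr
        exact sum_geometric_le hq0.le hq _ _

lemma pow_le_rpow_sqrt {c : ℝ} (h0 : 0 < c) (h1 : c < 1) (n : ℕ) : c ^ n ≤ c ^ √(n : ℝ) := by
  rw [← Real.rpow_natCast]
  refine Real.rpow_le_rpow_of_exponent_ge h0 h1.le ?_
  rw [Real.sqrt_le_left (by positivity)]
  have : n ≤ n ^ 2 := Nat.le_self_pow two_ne_zero n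
  exact_mod_cast this

/-- The data produced by the probabilistic part of the argument. -/
lemma exists_matches_bound (hX : GromovSpace X δ) (hne : IsNonElementary X μ)
    (hbdd : HasBoundedSupport X μ) (hwpd : IsWPDMeasure X μ) (x : X) {K K₁ : ℝ} (hK : 0 ≤ K)
    (hK₁ : 0 ≤ K₁) :
    ∃ (f : G) (c B θ : ℝ), 0 < B ∧ 0 < θ ∧ θ < 1 ∧
      (jointStab G (7 * K + 2 * (c + 2 * δ) + 2 * δ) x (f • x)).Finite ∧ ∀ n : ℕ,
      Pr μ n {l | ¬ ∃ u : G, gp (u • x) x (l.prod • x) ≤ c ∧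
        gp (u • f • x) x (l.prod • x) ≤ c} ≤ ENNReal.ofReal (B * θ ^ n) ∧
      Pr μ n {l | ¬ ∃ r, HasDeepMatch x δ c r K₁ f l.prod} ≤ ENNReal.ofReal (B * θ ^ n) := by
  have h4 := hX.fourPoint
  have hδ := hX.nonneg
  obtain ⟨L, hL1, hμ⟩ := hbdd.exists_dist_le x
  have hL : 0 ≤ L := by linarith
  obtain ⟨κ, t, B, q, hd⟩ := exists_linearDrift h4 hδ hne x hL1 hμ
  obtain ⟨m₁, C, E, word, hm₁, hlen, hsupp, hS⟩ := hne.exists_isSchottky h4 hδ x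
  have hκ := hd.speed_pos
  have ht := hd.rate_pos
  have hB := hd.const_pos
  have hq0 := hd.base_pos
  have hq1 := hd.base_lt_one
  have hsq1 : √q < 1 := by rw [Real.sqrt_lt' one_pos]; simpa using hq1
  obtain ⟨A, hA0, hA⟩ : ∃ A : ℝ, 0 ≤ A ∧ B * Real.exp (-(t * A)) / (1 - √q) ≤ 1 / 2 := by
    have h1 : Tendsto (fun A : ℝ => B * Real.exp (-(t * A)) / (1 - √q)) atTop (𝓝 0) := by
      have h2 := Real.tendsto_exp_neg_atTop_nhds_zero.comp (tendsto_id.const_mul_atTop ht)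
      have h3 := (h2.const_mul B).div_const (1 - √q)
      simpa using h3
    obtain ⟨A, h5, h6⟩ := ((h1.eventually (gt_mem_nhds (show (0 : ℝ) < 1 / 2 by norm_num))).and
      (eventually_ge_atTop 0)).exists
    exact ⟨A, h6, h5.le⟩
  obtain ⟨s, hs⟩ := exists_nat_gt (max 0 (2 * δ / κ))
  rw [max_lt_iff, div_lt_iff₀ hκ] at hs
  have hs0 : 0 < s := by exact_mod_cast hs.1
  have hs2 : 2 * δ ≤ κ * s := by linarith [hs.2]
  set c := max (C + 3 * δ) (A + L * s + 2 * δ) with hc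
  have hc1 : C + 3 * δ ≤ c := le_max_left _ _
  have hc2 : A + L * s + 2 * δ ≤ c := le_max_right _ _
  have hC0 := hS.nonneg
  have hc0 : 0 ≤ c := le_trans (by positivity) hc1
  obtain ⟨h, hh, hW⟩ := hwpd
  obtain ⟨H, hH0, hH, rfl⟩ := exists_list_of_mem_generatedSemigroup hh
  obtain ⟨M₀, hM₀⟩ := hW.exists_finite h4 hδ x
    (show 0 ≤ 7 * K + 2 * (c + 2 * δ) + 2 * δ by positivity)
  obtain ⟨τ, hτ, hlim⟩ := hW.1
  -- `M` serves two purposes: finiteness from the WPD condition, and an `F` long enough for the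
  -- turns before and after it not to interact.
  obtain ⟨M, hM⟩ := exists_nat_gt
    (max (M₀ : ℝ) (((A + L * s + 2 * δ) + (C + 2 * δ) + 2 * δ) / τ))
  rw [max_lt_iff, div_lt_iff₀ hτ] at hM
  have hMM : M₀ ≤ M := by exact_mod_cast hM.1.le
  set F := listPow H M with hF
  have hFprod : F.prod = H.prod ^ M := listPow_prod H M
  have hlong : (A + L * s + 2 * δ) + (C + 2 * δ) + 2 * δ < dist x (F.prod • x) := by
    rw [hFprod]
    linarith [IsLoxodromic.le_dist (hlim x) M, hM.2]
  choose idx hidx using fun z => hS.exists_index h4 z (F.prod • x)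
  set m := m₁ + F.length with hm
  have hlenW : ∀ z, (word (idx z) ++ F).length = m := fun z => by
    rw [List.length_append, hlen]
  have hpos : ∀ i, 0 < Pr μ m {word i ++ F} := fun i => by
    rw [show m = (word i ++ F).length by rw [List.length_append, hlen]]
    refine Pr_singleton_pos fun g hg => ?_
    rcases List.mem_append.1 hg with hg | hg
    exacts [hsupp i g hg, hH g (mem_listPow hg)]
  obtain ⟨p, hp0, hp⟩ : ∃ p : ℝ, 0 < p ∧ ∀ i, ENNReal.ofReal p ≤ Pr μ m {word i ++ F} := by
    have ht : ∀ i, Pr μ m {word i ++ F} ≠ ⊤ := fun i =>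
      ne_top_of_le_ne_top ENNReal.one_ne_top (Pr_le_one _ _)
    refine ⟨Finset.univ.inf' Finset.univ_nonempty fun i => (Pr μ m {word i ++ F}).toReal, ?_,
      fun i => ?_⟩
    · rw [Finset.lt_inf'_iff]
      exact fun i _ => ENNReal.toReal_pos (hpos i).ne' (ht i)
    · rw [ENNReal.ofReal_le_iff_le_toReal (ht i)]
      exact Finset.inf'_le _ (Finset.mem_univ i)
  obtain ⟨D, ρ, hD, hρ0, hρ1, hmatch⟩ := hd.exists_Pr_not_matches_le
    (W := fun z => word (idx z) ++ F) (m := m) (by omega) hlenW hp0 (fun z => hp (idx z)) hA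
  set ϑ := max ρ q with hϑ
  have hϑ0 : 0 < ϑ := lt_max_of_lt_left hρ0
  have hϑ1 : ϑ < 1 := max_lt hρ1 hq1
  -- Deviations `Y = (L + κ) * j` with `j ≤ η * a` are at most `κ * a / 6`, so `3 * Y` uses half of
  -- the progress `κ * a`. The choice of `a₀` below makes the constants fit into the other half.
  set η := κ / (6 * (L + κ)) with hη
  have hη0 : 0 < η := by positivity
  have hη1 : η ≤ 1 := by
    rw [hη, div_le_one (by positivity)]; linarith
  set θ := ϑ ^ (η / 4) with hθ
  have hθ0 : 0 < θ := Real.rpow_pos_of_pos hϑ0 _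
  have hθ1 : θ < 1 := Real.rpow_lt_one hϑ0.le hϑ1 (by positivity)
  have hϑθ : ϑ ≤ θ := by
    conv_lhs => rw [← Real.rpow_one ϑ]
    exact Real.rpow_le_rpow_of_exponent_ge hϑ0 hϑ1.le (by linarith)
  obtain ⟨a₀, ha₀⟩ := exists_nat_gt
    (max (m : ℝ) ((2 * (L * s) + 20 * δ + 5 * K₁ + c) * 2 / κ))
  rw [max_lt_iff, div_lt_iff₀ hκ] at ha₀
  have hma₀ : m ≤ a₀ := by exact_mod_cast ha₀.1.le
  set B₁ := D + 4 * (B / (1 - q)) with hB₁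
  have hBq : 0 < B / (1 - q) := div_pos hB (by linarith)
  have hB₁0 : 0 < B₁ := by positivity
  -- The summands serve, in order, the first estimate, the second one (with `ϑ ^ 2` for rounding `n
  -- / 4` and `η * a`), and the trivial bound for `n < 4 * a₀`.
  set B₂ := D + (ϑ ^ 2)⁻¹ * B₁ + (θ ^ (4 * a₀))⁻¹ with hB₂
  have hFfin : (jointStab G (7 * K + 2 * (c + 2 * δ) + 2 * δ) x (F.prod • x)).Finite := by
    rw [hFprod]; exact hM₀ M hMM
  refine ⟨F.prod, c, B₂, θ, by positivity, hθ0, hθ1, hFfin, fun n => ⟨?_, ?_⟩⟩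
  · refine (Pr_mono fun l _ hsl hl => ?_).trans ((hmatch n n x le_rfl).trans
      (ENNReal.ofReal_le_ofReal ?_))
    · intro hM
      obtain ⟨k, k', -, -, -, -, -, e1, e2⟩ := hM.exists_gp_le hX hS hL hκ.le hs2 hs0 hidx hlenW
        hlong fun g hg => hμ g (hsl g hg)
      exact hl ⟨_, e1.trans hc1, e2.trans hc2⟩
    · have h1 : ρ ^ n ≤ θ ^ n := pow_le_pow_left₀ hρ0.le ((le_max_left _ _).trans hϑθ) n
      have h2 : D ≤ B₂ := by
        have : 0 < (ϑ ^ 2)⁻¹ * B₁ := by positivity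
        have : 0 < (θ ^ (4 * a₀))⁻¹ := by positivity
        linarith
      exact mul_le_mul h2 h1 (by positivity) (by positivity)
  rcases lt_or_ge n (4 * a₀) with hn | hn
  · refine (Pr_le_one _ _).trans ?_
    rw [ENNReal.one_le_ofReal]
    have h1 : (θ ^ (4 * a₀))⁻¹ ≤ B₂ := by
      have : 0 < (ϑ ^ 2)⁻¹ * B₁ := by positivity
      linarith
    have h2 : θ ^ (4 * a₀) ≤ θ ^ n := pow_le_pow_of_le_one hθ0.le hθ1.le hn.le
    calc (1 : ℝ) = (θ ^ (4 * a₀))⁻¹ * θ ^ (4 * a₀) := by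
          rw [inv_mul_cancel₀ (by positivity)]
      _ ≤ _ := mul_le_mul h1 h2 (by positivity) (by positivity)
  -- Four quarters: an initial stretch, one in which the match begins, one with room for the word
  -- since `m ≤ a`, and a final stretch.
  set a := n / 4 with ha
  have haa₀ : a₀ ≤ a := by omega
  have han : 4 * a ≤ n := by omega
  set j := ⌊η * a⌋₊ with hj
  have hjη : (j : ℝ) ≤ η * a := Nat.floor_le (by positivity)
  have hja : j ≤ a := by
    have : (j : ℝ) ≤ a := hjη.trans (mul_le_of_le_one_left (by positivity) hη1)
    exact_mod_cast this
  set Y := (L + κ) * j with hY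
  have hY0 : 0 ≤ Y := by positivity
  have hlarge : 3 * Y + (2 * (L * s) + 20 * δ + 5 * K₁ + c) < κ * a := by
    have h1 : Y ≤ (L + κ) * (η * a) := by rw [hY]; gcongr
    have h2 : (L + κ) * (η * a) = κ * a / 6 := by
      rw [hη]; field_simp
    have h3 : (a₀ : ℝ) * κ ≤ a * κ := by gcongr
    linarith [ha₀.2]
  set W : X → List G := fun z => word (idx z) ++ F
  set S₁ : Set (List G) := {l | ¬ Matches W κ A x a ((l.take a).prod⁻¹ • x) (l.drop a)}
  set S₂ : Set (List G) := {l | ¬ Diverges κ Y x x l}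
  set S₃ : Set (List G) :=
    {l | ¬ ∀ i ≤ l.length - a, a ≤ l.length → κ * a ≤ dist x ((l.drop i).prod • x)}
  set S₄ : Set (List G) := {l | ¬ Diverges κ Y x ((l.drop a).prod⁻¹ • x) (l.take a)}
  set S₅ : Set (List G) := {l | ¬ Diverges κ Y x ((l.take a).prod⁻¹ • x) (l.drop a)}
  have hsub : Pr μ n {l | ¬ ∃ r, HasDeepMatch x δ c r K₁ F.prod l.prod} ≤
      Pr μ n (S₁ ∪ (S₂ ∪ (S₃ ∪ (S₄ ∪ S₅)))) := by
    refine Pr_mono fun l hl hsl hbad => ?_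
    by_contra hcon
    simp only [Set.mem_union, not_or] at hcon
    obtain ⟨k1, k2, k3, k4, k5⟩ := hcon
    have k3' := not_not.1 k3
    exact hbad ⟨_, hasDeepMatch_of_matches hX hS hL hκ.le hs2 hs0 hidx hlenW hlong
      (fun g hg => hμ g (hsl g hg)) (hma₀.trans haa₀) (by omega) hc1 hc2 hY0 hK₁ hlarge
      (not_not.1 k1) (not_not.1 k2) (fun i hi => k3' i hi (by omega)) (not_not.1 k4)
      (not_not.1 k5)⟩
  -- The target is determined by the first `a` steps, and the matching bound is uniform in the
  -- target; so it applies conditionally on them.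
  have p1 : Pr μ n S₁ ≤ ENNReal.ofReal (D * ρ ^ a) :=
    Pr_split_le_left (Q := fun u v => ¬ Matches W κ A x a (u.prod⁻¹ • x) v) (by omega)
      fun u => hmatch (n - a) a _ (by omega)
  have p2 : Pr μ n S₂ ≤ ENNReal.ofReal (B / (1 - q) * q ^ j) := hd.Pr_not_diverges_le hL hμ n j x
  have p3 : Pr μ n S₃ ≤ ENNReal.ofReal (B / (1 - q) * q ^ a) := hd.Pr_short_suffix_le a
  -- Here the target is determined by the later steps, so the conditioning is on the suffix.
  have p4 : Pr μ n S₄ ≤ ENNReal.ofReal (B / (1 - q) * q ^ j) :=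
    Pr_split_le_right (Q := fun u v => ¬ Diverges κ Y x (v.prod⁻¹ • x) u) (by omega)
      fun v => hd.Pr_not_diverges_le hL hμ a j _
  have p5 : Pr μ n S₅ ≤ ENNReal.ofReal (B / (1 - q) * q ^ j) :=
    Pr_split_le_left (Q := fun u v => ¬ Diverges κ Y x (u.prod⁻¹ • x) v) (by omega)
      fun u => hd.Pr_not_diverges_le hL hμ (n - a) j _
  have hrate : ϑ ^ j ≤ (ϑ ^ 2)⁻¹ * θ ^ n := by
    have h1 : η / 4 * n - 2 ≤ (j : ℝ) := by
      have e1 := Nat.lt_floor_add_one (η * a)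
      have e2 : (n : ℝ) ≤ 4 * a + 3 := by exact_mod_cast (by omega : n ≤ 4 * a + 3)
      nlinarith
    rw [← Real.rpow_natCast ϑ j, ← Real.rpow_natCast ϑ 2, ← Real.rpow_neg hϑ0.le, hθ,
      ← Real.rpow_natCast (ϑ ^ (η / 4)), ← Real.rpow_mul hϑ0.le, ← Real.rpow_add hϑ0]
    refine Real.rpow_le_rpow_of_exponent_ge hϑ0 hϑ1.le ?_
    push_cast; linarith
  have hρa : ρ ^ a ≤ ϑ ^ j := (pow_le_pow_left₀ hρ0.le (le_max_left _ _) a).trans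
    (pow_le_pow_of_le_one hϑ0.le hϑ1.le hja)
  have hqa : q ^ a ≤ ϑ ^ j := (pow_le_pow_left₀ hq0.le (le_max_right _ _) a).trans
    (pow_le_pow_of_le_one hϑ0.le hϑ1.le hja)
  have hqj : q ^ j ≤ ϑ ^ j := pow_le_pow_left₀ hq0.le (le_max_right _ _) j
  calc _ ≤ _ := hsub
    _ ≤ Pr μ n S₁ + (Pr μ n S₂ + (Pr μ n S₃ + (Pr μ n S₄ + Pr μ n S₅))) := by
        refine (Pr_union_le _ _ _).trans (add_le_add le_rfl ?_)
        refine (Pr_union_le _ _ _).trans (add_le_add le_rfl ?_)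
        refine (Pr_union_le _ _ _).trans (add_le_add le_rfl ?_)
        exact Pr_union_le _ _ _
    _ ≤ ENNReal.ofReal (D * ρ ^ a) + (ENNReal.ofReal (B / (1 - q) * q ^ j) +
          (ENNReal.ofReal (B / (1 - q) * q ^ a) + (ENNReal.ofReal (B / (1 - q) * q ^ j) +
          ENNReal.ofReal (B / (1 - q) * q ^ j)))) := by gcongr
    _ = ENNReal.ofReal (D * ρ ^ a + (B / (1 - q) * q ^ j + (B / (1 - q) * q ^ a +
          (B / (1 - q) * q ^ j + B / (1 - q) * q ^ j)))) := by
        rw [← ENNReal.ofReal_add (by positivity) (by positivity),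
          ← ENNReal.ofReal_add (by positivity) (by positivity),
          ← ENNReal.ofReal_add (by positivity) (by positivity),
          ← ENNReal.ofReal_add (by positivity) (by positivity)]
    _ ≤ _ := by
        refine ENNReal.ofReal_le_ofReal ?_
        have h1 := mul_le_mul_of_nonneg_left hρa hD.le
        have h2 := mul_le_mul_of_nonneg_left hqa hBq.le
        have h3 := mul_le_mul_of_nonneg_left hqj hBq.le
        have h5 : B₁ * ϑ ^ j ≤ B₁ * ((ϑ ^ 2)⁻¹ * θ ^ n) := by gcongr
        have h6 : 0 ≤ D * θ ^ n := by positivity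
        have h7 : 0 ≤ (θ ^ (4 * a₀))⁻¹ * θ ^ n := by positivity
        rw [hB₂]
        rw [hB₁] at h5 ⊢
        linarith

end Final

end HypWalk

theorem mainTheorem9 {G : Type*} [Group G] {X : Type*} [MetricSpace X] [MulAction G X]
    [IsIsometricSMul G X] (hX : HypWalk.IsGromovHyperbolic X) (μ : PMF G)
    (hne : HypWalk.IsNonElementary X μ) (hbdd : HypWalk.HasBoundedSupport X μ)
    (hwpd : HypWalk.IsWPDMeasure X μ) (x : X) (K K₁ : ℝ) (hK : 0 ≤ K) (hK₁ : 0 ≤ K₁) :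
    ∃ N : ℕ, 0 < N ∧ ∃ B c : ℝ, 0 < B ∧ 0 < c ∧ c < 1 ∧ ∀ n : ℕ,
      1 - B * c ^ Real.sqrt n ≤
          HypWalk.walkProb μ n {w | (HypWalk.jointStab G K x (w • x)).encard ≤ N} ∧
      1 - B * c ^ Real.sqrt n ≤
          HypWalk.walkProb μ n {w | HypWalk.IsLoxodromic X w ∧
            ∀ (α : Set X) (p : X), HypWalk.IsQuasiAxis K₁ w α → HypWalk.IsClosestPoint x α p →
              (HypWalk.jointStab G K p (w • p)).encard ≤ N} := by
  have : Nonempty X := ⟨x⟩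
  obtain ⟨δ, hX⟩ := hX.exists_gromovSpace
  obtain ⟨f, c, B, θ, hB, hθ0, hθ1, hfin, hbound⟩ :=
    HypWalk.exists_matches_bound hX hne hbdd hwpd x hK hK₁
  have hδ := hX.nonneg
  -- One finite stabilizer, with the constant `c + 2 * δ` needed for quasi-axes, serves both
  -- estimates; adding `1` keeps `N` positive.
  have hN : ∀ S : Set G,
      S.encard ≤ (HypWalk.jointStab G (7 * K + 2 * (c + 2 * δ) + 2 * δ) x (f • x)).encard →
      S.encard ≤ (hfin.toFinset.card + 1 : ℕ) := by
    intro S hS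
    rw [hfin.encard_eq_coe_toFinset_card] at hS
    exact hS.trans (by exact_mod_cast Nat.le_succ _)
  have hrate : ∀ n : ℕ, ENNReal.ofReal (B * θ ^ n) ≤ ENNReal.ofReal (B * θ ^ Real.sqrt n) :=
    fun n => ENNReal.ofReal_le_ofReal
      (mul_le_mul_of_nonneg_left (HypWalk.pow_le_rpow_sqrt hθ0 hθ1 n) hB.le)
  refine ⟨hfin.toFinset.card + 1, Nat.succ_pos _, B, θ, hB, hθ0, hθ1, fun n => ⟨?_, ?_⟩⟩
  · refine HypWalk.le_walkProb (by positivity) (le_trans ?_ (((hbound n).1).trans (hrate n)))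
    refine HypWalk.Pr_mono fun l _ _ hl hmatch => hl ?_
    obtain ⟨u, h1, h2⟩ := hmatch
    exact hN _ (HypWalk.encard_jointStab_le hX.fourPoint (h1.trans (by linarith))
      (h2.trans (by linarith)))
  · refine HypWalk.le_walkProb (by positivity) (le_trans ?_ (((hbound n).2).trans (hrate n)))
    refine HypWalk.Pr_mono fun l _ _ hl hmatch => hl ?_
    obtain ⟨r, hr⟩ := hmatch
    exact ⟨hr.isLoxodromic hX.fourPoint hδ, fun α p hα hp =>
      hN _ (hr.encard_le hX.fourPoint hδ hα hp)⟩
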